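/- Let $M$ be a compact $d$-dimensional $C^\infty$ Riemannian manifold without boundary, $X$ a $C^1$ vector field on $M$ with flow $\varphi_t$, $\Phi_t=d\varphi_t$ its tangent flow, $\mathrm{Sing}(X)=\{x: X(x)=0\}$, and $\Lambda\subset M$ a compact $\varphi_t$-invariant set. **Linear flows.** For $x\notin\mathrm{Sing}(X)$ let $N_x=X(x)^\perp\subset T_xM$, let $\pi_x:T_xM\to N_x$ be the orthogonal projection, and let $\psi_t=\pi_{\varphi_t(x)}\circ\Phi_t|_{N_x}$ be the linear Poincaré flow. For a unit vector $e\in SM$ with base point $j(e)$ let $N_e=e^\perp\subset T_{j(e)}M$, $\Phi^\#_t(e)=\Phi_t(e)/\|\Phi_t(e)\|$, and, for $v\in N_e$, $\tilde\psi_t(v)=\Phi_t(v)-\langle\Phi_t(v),\Phi^\#_t(e)\rangle\,\Phi^\#_t(e)$ (the extended linear Poincaré flow). Let $\tilde\Lambda$ be the closure of $\{X(x)/\|X(x)\|:x\in\Lambda\setminus\mathrm{Sing}(X)\}$ in the unit sphere bundle $SM$. **Dominated splittings.** For one of the linear flows $A_t\in\{\Phi_t,\psi_t,\tilde\psi_t\}$,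 covering a flow $f_t$ of its base, a splitting $E\oplus F$ of the bundle over an invariant set $S$ is $(C,\lambda)$-dominated if it is continuous, $A_t$-invariant and $\|A_t|_{E_b}\|\cdot\|A_{-t}|_{F_{f_t(b)}}\|<Ce^{-\lambda t}$ for all $b\in S$, $t>0$. For a positive function $h_t(b)$, $E$ is $(C,\lambda)$-contracting for $h_t\cdot A_t$ if $\|h_t(b)A_t(v)\|<Ce^{-\lambda t}\|v\|$, and $F$ is $(C,\lambda)$-expanding for $h_t\cdot A_t$ if $\|h_{-t}(b)A_{-t}(v)\|<Ce^{-\lambda t}\|v\|$, for all $b\in S$, $t>0$ and all $v\neq0$ in the fibre over $b$ of $E$, respectively $F$. **Singular hyperbolicity.** $\Lambda$ is positively $(C,\lambda)$-singular hyperbolic for $X$ ($C>1$, $\lambda>0$) with splitting $T_\Lambda M=E\oplus F$ if this splitting is $(C,\lambda)$-dominated for $\Phi_t$; $\|\Phi_t|_{E_x}\|<Ce^{-\lambda t}$ and $|\det(\Phi_{-t}|_L)|<Ce^{-\lambda t}$ for all $x\in\Lambda$, $t>0$ and all two-dimensional subspaces $L\subset F_x$; and every singularity in $\Lambda$ is hyperbolic.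 $\Lambda$ is singular hyperbolic if, for some $C>1$, $\lambda>0$ and some splitting, it is so for $X$ or for $-X$. **Multisingular hyperbolicity.** A cocycle is a continuous $h:\tilde\Lambda\times\mathbb R\to(0,\infty)$, $h(e,t)=h_t(e)$, with $h_{s+t}(e)=h_s(e)\,h_t(\Phi^\#_s(e))$. It is pragmatical with respect to $\sigma\in\mathrm{Sing}(X)$ with isolating neighborhood $U$ (a neighborhood of $\sigma$ such that $\{\sigma\}$ is the maximal invariant set in $\overline U$) if $h_t(e)=\|\Phi_t(e)\|$ whenever $j(e)$ and $j(\Phi^\#_t(e))$ are both in $U$, and $h_t(e)=1$ whenever both are outside $U$. A reparametrizing cocycle is a finite (possibly empty) product of pragmatical cocycles with pairwise disjoint isolating neighborhoods. $\Lambda$ is $(C,\lambda)$-multisingular hyperbolic ($C>1$, $\lambda>0$) with splitting $N_{\tilde\Lambda}=\Delta^s\oplus\Delta^u$ if this splitting is $(C,\lambda)$-dominated for $\tilde\psi_t$ and there are reparametrizing cocycles $h^s,h^u$ such that $\Delta^s$ is $(C,\lambda)$-contracting for $h^s_t\cdot\tilde\psi_t$ and $\Delta^u$ is $(C,\lambda)$-expanding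 for $h^u_t\cdot\tilde\psi_t$. $\Lambda$ is multisingular hyperbolic if this holds for some $C>1$, $\lambda>0$ and some splitting. **Proposition.** If $\Lambda$ is singular hyperbolic for $X$, then $\Lambda$ is multisingular hyperbolic for $X$. Moreover, if $\Lambda$ is positively $(C,\lambda)$-singular hyperbolic for $X$ with splitting $T_\Lambda M=E\oplus F$, then there are $C'>1$ and $\lambda'>0$ such that, with $\Delta^s(x)=\pi_x(E_x)$ and $\Delta^u(x)=\pi_x(F_x)$ for $x\in\Lambda\setminus\mathrm{Sing}(X)$: 1. $N_{\Lambda\setminus\mathrm{Sing}(X)}=\Delta^s\oplus\Delta^u$ is a $(C',\lambda')$-dominated splitting for $\psi_t$; 2. $\Delta^s$ is $(C',\lambda')$-contracting for $\psi_t$; 3. $\Delta^u$ is $(C',\lambda')$-expanding for $\|\Phi_t|_{\langle X\rangle}\|\cdot\psi_t$; 4. $\Delta^s\oplus\Delta^u$ extends (identifying $x$ with $X(x)/\|X(x)\|$) to a splitting of $N_{\tilde\Lambda}$ with which $\Lambda$ is $(C',\lambda')$-multisingular hyperbolic. -/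

import Mathlib

open Set Topology Manifold Bundle
open scoped ContDiff

noncomputable section SingularHyperbolicity

variable {d : ℕ} {M : Type*} [TopologicalSpace M] [ChartedSpace (EuclideanSpace ℝ (Fin d)) M]
  [IsManifold (𝓡 d) ∞ M] [RiemannianBundle (fun x : M => TangentSpace (𝓡 d) x)]

/-! ### Flows, singularities, and the linear flows attached to a vector field -/

/-- `φ` is the flow generated by the vector field `X`: `t ↦ φ t x` is the integral curve of `X`
through `x`, for every `x`. -/
def IsFlowOf (φ : ℝ → M → M) (X : ∀ x : M, TangentSpace (𝓡 d) x) : Prop :=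
  ∀ x, φ 0 x = x ∧ IsMIntegralCurve (I := 𝓡 d) (fun t => φ t x) X

/-- The set of singularities (zeros) of a vector field. -/
def singSet (X : ∀ x : M, TangentSpace (𝓡 d) x) : Set M := {x | X x = 0}

/-- The tangent flow `Φ_t = dφ_t`, as a linear map `T_x M → T_{φ_t x} M`. -/
def tangentFlow (φ : ℝ → M → M) (t : ℝ) (x : M) :
    TangentSpace (𝓡 d) x →L[ℝ] TangentSpace (𝓡 d) (φ t x) :=
  mfderiv (𝓡 d) (𝓡 d) (φ t) x

/-- For `w ≠ 0`, the orthogonal projection `v ↦ v - (⟨w, v⟩ / ‖w‖²) w` of `T_x M` onto the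
orthogonal complement of `w`. If `‖w‖ = 1` this is `v ↦ v - ⟨w, v⟩ w`. -/
def normalProj (x : M) (w : TangentSpace (𝓡 d) x) :
    TangentSpace (𝓡 d) x →L[ℝ] TangentSpace (𝓡 d) x :=
  ContinuousLinearMap.id ℝ (TangentSpace (𝓡 d) x) -
    ((‖w‖ ^ 2)⁻¹ • (innerSL ℝ w : TangentSpace (𝓡 d) x →L[ℝ] ℝ)).smulRight w

/-- The normal space `{v ∈ T_x M : v ⊥ w}`. -/
def normalSpace (x : M) (w : TangentSpace (𝓡 d) x) : Submodule ℝ (TangentSpace (𝓡 d) x) :=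
  (ℝ ∙ w)ᗮ

/-- The linear Poincaré flow `ψ_t` of `X` at `x` (meaningful on `N_x` when `X x ≠ 0`). -/
def poincareFlow (φ : ℝ → M → M) (X : ∀ x : M, TangentSpace (𝓡 d) x) (t : ℝ) (x : M) :
    TangentSpace (𝓡 d) x →L[ℝ] TangentSpace (𝓡 d) (φ t x) :=
  (normalProj (φ t x) (X (φ t x))).comp (tangentFlow φ t x)

/-- The flow `Φ_t^#(e) = Φ_t(e) / ‖Φ_t(e)‖` (meaningful on the unit sphere bundle). -/
def sphereFlow (φ : ℝ → M → M) (t : ℝ) (e : TangentBundle (𝓡 d) M) : TangentBundle (𝓡 d) M :=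
  ⟨φ t e.proj, ‖tangentFlow φ t e.proj e.2‖⁻¹ • tangentFlow φ t e.proj e.2⟩

/-- The extended linear Poincaré flow
`ψ̃_t(v) = Φ_t(v) - ⟨Φ_t(v), Φ_t^#(e)⟩ Φ_t^#(e)` for `v ∈ N_e`, `‖e‖ = 1`. -/
def extPoincareFlow (φ : ℝ → M → M) (t : ℝ) (e : TangentBundle (𝓡 d) M) :
    TangentSpace (𝓡 d) e.proj →L[ℝ] TangentSpace (𝓡 d) (sphereFlow φ t e).proj :=
  (normalProj (sphereFlow φ t e).proj (sphereFlow φ t e).2).comp (tangentFlow φ t e.proj)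

/-- The unit vector `X(x) / ‖X(x)‖`, as a point of the tangent bundle. -/
def unitDir (X : ∀ x : M, TangentSpace (𝓡 d) x) (x : M) : TangentBundle (𝓡 d) M :=
  ⟨x, ‖X x‖⁻¹ • X x⟩

/-- The set `Λ̃`, the closure of `{X(x)/‖X(x)‖ : x ∈ Λ \ Sing(X)}`. The unit sphere bundle is closed
in the tangent bundle, so the closure may be taken in the latter. -/
def extendedSet (X : ∀ x : M, TangentSpace (𝓡 d) x) (Λ : Set M) : Set (TangentBundle (𝓡 d) M) :=
  closure (unitDir X '' (Λ \ singSet X))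

/-! ### Splittings

A family of tangent spaces over a base `B` is given by a map `p : B → M`; over it we consider
linear maps `A t b : T_{p b} M → T_{p (f t b)} M` covering a flow `f` of `B`. This is used for
`Φ_t` and `ψ_t` (with `B = M`) and for `ψ̃_t` (with `B = TM`). -/

section Splittings

variable {B : Type*} [TopologicalSpace B]

/-- The norm `‖A|_S‖` of the restriction of a linear map of tangent spaces to a subspace. -/
def restrNorm {x y : M} (A : TangentSpace (𝓡 d) x →L[ℝ] TangentSpace (𝓡 d) y)
    (S : Submodule ℝ (TangentSpace (𝓡 d) x)) : ℝ :=
  ‖A.comp S.subtypeL‖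

/-- `|det (A|_L)|` for a plane `L`, computed as the square root of the Gram determinant of the
images of an orthonormal basis of `L` (it does not depend on the basis). -/
def absDet {x y : M} (A : TangentSpace (𝓡 d) x →L[ℝ] TangentSpace (𝓡 d) y)
    {L : Submodule ℝ (TangentSpace (𝓡 d) x)} (u : OrthonormalBasis (Fin 2) ℝ L) : ℝ :=
  √(Matrix.det (Matrix.of fun i j : Fin 2 =>
    (inner ℝ (A (u i : TangentSpace (𝓡 d) x)) (A (u j : TangentSpace (𝓡 d) x)) : ℝ)))

/-- A family of subspaces `E b ⊆ T_{p b} M`, `b ∈ S`, is a continuous subbundle over `S`: near each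
point of `S` it has a continuous frame. -/
def IsContinuousSubbundle (p : B → M) (S : Set B)
    (E : ∀ b, Submodule ℝ (TangentSpace (𝓡 d) (p b))) : Prop :=
  ∀ b₀ ∈ S, ∃ V ∈ 𝓝 b₀, ∃ k : ℕ, ∃ s : Fin k → ∀ b, TangentSpace (𝓡 d) (p b),
    (∀ i, ContinuousOn (fun b => (⟨p b, s i b⟩ : TangentBundle (𝓡 d) M)) (S ∩ V)) ∧
    ∀ b ∈ S ∩ V, LinearIndependent ℝ (fun i => s i b) ∧
      Submodule.span ℝ (range fun i => s i b) = E b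

/-- `N = E ⊕ F` over `S` is a continuous `A`-invariant `(C, r)`-dominated splitting. -/
structure IsDominatedSplitting (p : B → M) (f : ℝ → B → B)
    (A : ∀ t b, TangentSpace (𝓡 d) (p b) →L[ℝ] TangentSpace (𝓡 d) (p (f t b)))
    (S : Set B) (N E F : ∀ b, Submodule ℝ (TangentSpace (𝓡 d) (p b))) (C r : ℝ) : Prop where
  continuous_left : IsContinuousSubbundle p S E
  continuous_right : IsContinuousSubbundle p S F
  inf_eq : ∀ b ∈ S, E b ⊓ F b = ⊥
  sup_eq : ∀ b ∈ S, E b ⊔ F b = N b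
  map_left : ∀ b ∈ S, ∀ t, (E b).map (A t b).toLinearMap = E (f t b)
  map_right : ∀ b ∈ S, ∀ t, (F b).map (A t b).toLinearMap = F (f t b)
  dominated : ∀ b ∈ S, ∀ t > 0,
    restrNorm (A t b) (E b) * restrNorm (A (-t) (f t b)) (F (f t b)) < C * Real.exp (-r * t)

/-- The subbundle `E` is `(C, r)`-contracting for `h_t · A_t`. -/
def IsContractingFor (p : B → M) (f : ℝ → B → B)
    (A : ∀ t b, TangentSpace (𝓡 d) (p b) →L[ℝ] TangentSpace (𝓡 d) (p (f t b)))
    (h : B → ℝ → ℝ) (S : Set B) (E : ∀ b, Submodule ℝ (TangentSpace (𝓡 d) (p b)))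
    (C r : ℝ) : Prop :=
  ∀ b ∈ S, ∀ t > 0, ∀ v ∈ E b, v ≠ 0 → ‖h b t • A t b v‖ < C * Real.exp (-r * t) * ‖v‖

/-- The subbundle `F` is `(C, r)`-expanding for `h_t · A_t`. -/
def IsExpandingFor (p : B → M) (f : ℝ → B → B)
    (A : ∀ t b, TangentSpace (𝓡 d) (p b) →L[ℝ] TangentSpace (𝓡 d) (p (f t b)))
    (h : B → ℝ → ℝ) (S : Set B) (F : ∀ b, Submodule ℝ (TangentSpace (𝓡 d) (p b)))
    (C r : ℝ) : Prop :=
  ∀ b ∈ S, ∀ t > 0, ∀ v ∈ F b, v ≠ 0 →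
    ‖h b (-t) • A (-t) b v‖ < C * Real.exp (-r * t) * ‖v‖

end Splittings

/-! ### Singular hyperbolic sets -/

/-- The singularity `σ` is hyperbolic: `T_σ M` splits into two `Φ_t`-invariant subspaces, one
exponentially contracted in the future, the other one in the past. -/
def IsHyperbolicSingularity (φ : ℝ → M → M) (X : ∀ x : M, TangentSpace (𝓡 d) x) (σ : M) : Prop :=
  X σ = 0 ∧ ∃ Es Eu : ∀ x : M, Submodule ℝ (TangentSpace (𝓡 d) x), ∃ C > 1, ∃ r > 0,
    IsCompl (Es σ) (Eu σ) ∧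
    (∀ t, (Es σ).map (tangentFlow φ t σ).toLinearMap = Es (φ t σ)) ∧
    (∀ t, (Eu σ).map (tangentFlow φ t σ).toLinearMap = Eu (φ t σ)) ∧
    (∀ t > 0, restrNorm (tangentFlow φ t σ) (Es σ) < C * Real.exp (-r * t)) ∧
    (∀ t > 0, restrNorm (tangentFlow φ (-t) σ) (Eu σ) < C * Real.exp (-r * t))

/-- `Λ` is positively `(C, r)`-singular hyperbolic with the splitting `T_Λ M = E ⊕ F`. -/
structure IsPosSingularHyperbolicWith (φ : ℝ → M → M) (X : ∀ x : M, TangentSpace (𝓡 d) x)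
    (Λ : Set M) (E F : ∀ x : M, Submodule ℝ (TangentSpace (𝓡 d) x)) (C r : ℝ) : Prop where
  one_lt : 1 < C
  pos : 0 < r
  splitting : IsDominatedSplitting (fun x : M => x) φ (tangentFlow φ) Λ (fun _ => ⊤) E F C r
  contracting : ∀ x ∈ Λ, ∀ t > 0, restrNorm (tangentFlow φ t x) (E x) < C * Real.exp (-r * t)
  area_expanding : ∀ x ∈ Λ, ∀ L : Submodule ℝ (TangentSpace (𝓡 d) x), L ≤ F x →
    ∀ u : OrthonormalBasis (Fin 2) ℝ L, ∀ t > 0,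
      absDet (tangentFlow φ (-t) x) u < C * Real.exp (-r * t)
  hyperbolic : ∀ σ ∈ Λ ∩ singSet X, IsHyperbolicSingularity φ X σ

/-- `Λ` is positively singular hyperbolic for `X`, the flow of which is `φ`. -/
def IsPosSingularHyperbolic (φ : ℝ → M → M) (X : ∀ x : M, TangentSpace (𝓡 d) x)
    (Λ : Set M) : Prop :=
  ∃ E F : ∀ x : M, Submodule ℝ (TangentSpace (𝓡 d) x), ∃ C r : ℝ,
    IsPosSingularHyperbolicWith φ X Λ E F C r

/-- `Λ` is singular hyperbolic for `X`: positively singular hyperbolic for `X` or for `-X` (the flow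
of which is `t ↦ φ (-t)`). -/
def IsSingularHyperbolic (φ : ℝ → M → M) (X : ∀ x : M, TangentSpace (𝓡 d) x)
    (Λ : Set M) : Prop :=
  IsPosSingularHyperbolic φ X Λ ∨
    IsPosSingularHyperbolic (fun t => φ (-t)) (fun x => -X x) Λ

/-! ### Multisingular hyperbolic sets -/

/-- `h : Λ̃ × ℝ → (0, ∞)` is a (continuous) cocycle of `X` on `Λ̃`. Values outside `Λ̃` are
irrelevant. -/
structure IsCocycleOn (φ : ℝ → M → M) (X : ∀ x : M, TangentSpace (𝓡 d) x) (Λ : Set M)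
    (h : TangentBundle (𝓡 d) M → ℝ → ℝ) : Prop where
  continuousOn : ContinuousOn (fun q : TangentBundle (𝓡 d) M × ℝ => h q.1 q.2)
    (extendedSet X Λ ×ˢ (univ : Set ℝ))
  pos : ∀ e ∈ extendedSet X Λ, ∀ t, 0 < h e t
  add : ∀ e ∈ extendedSet X Λ, ∀ s t, h e (s + t) = h e s * h (sphereFlow φ s e) t

/-- `U` is an isolating neighborhood of the singularity `σ`: a neighborhood of `σ` such that `{σ}`
is the maximal invariant set in the closure of `U`. In particular `σ` is the only singularity in
the closure of `U`. -/
def IsIsolatingNhd (φ : ℝ → M → M) (U : Set M) (σ : M) : Prop :=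
  U ∈ 𝓝 σ ∧ {x | ∀ t, φ t x ∈ closure U} = {σ}

/-- The cocycle `h` is pragmatical with respect to the singularity `σ`, with isolating
neighborhood `U`. -/
structure IsPragmatical (φ : ℝ → M → M) (X : ∀ x : M, TangentSpace (𝓡 d) x) (Λ : Set M)
    (σ : M) (U : Set M) (h : TangentBundle (𝓡 d) M → ℝ → ℝ) : Prop where
  cocycle : IsCocycleOn φ X Λ h
  sing : σ ∈ singSet X
  isolating : IsIsolatingNhd φ U σ
  inside : ∀ e ∈ extendedSet X Λ, ∀ t, e.proj ∈ U → (sphereFlow φ t e).proj ∈ U →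
    h e t = ‖tangentFlow φ t e.proj e.2‖
  outside : ∀ e ∈ extendedSet X Λ, ∀ t, e.proj ∉ U → (sphereFlow φ t e).proj ∉ U → h e t = 1

/-- A reparametrizing cocycle: a finite (possibly empty) product of pragmatical cocycles with
disjoint isolating neighborhoods. -/
def IsReparametrizing (φ : ℝ → M → M) (X : ∀ x : M, TangentSpace (𝓡 d) x) (Λ : Set M)
    (h : TangentBundle (𝓡 d) M → ℝ → ℝ) : Prop :=
  ∃ (s : Finset M) (U : M → Set M) (k : M → TangentBundle (𝓡 d) M → ℝ → ℝ),
    (∀ σ ∈ s, IsPragmatical φ X Λ σ (U σ) (k σ)) ∧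
    (∀ σ ∈ s, ∀ τ ∈ s, σ ≠ τ → Disjoint (U σ) (U τ)) ∧
    ∀ e ∈ extendedSet X Λ, ∀ t, h e t = ∏ σ ∈ s, k σ e t

/-- `Λ` is `(C, r)`-multisingular hyperbolic with the splitting `N_Λ̃ = Δs ⊕ Δu`. -/
structure IsMultisingularHyperbolicWith (φ : ℝ → M → M) (X : ∀ x : M, TangentSpace (𝓡 d) x)
    (Λ : Set M) (Δs Δu : ∀ e : TangentBundle (𝓡 d) M, Submodule ℝ (TangentSpace (𝓡 d) e.proj))
    (C r : ℝ) : Prop where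
  one_lt : 1 < C
  pos : 0 < r
  splitting : IsDominatedSplitting (fun e : TangentBundle (𝓡 d) M => e.proj) (sphereFlow φ)
    (extPoincareFlow φ) (extendedSet X Λ) (fun e => normalSpace e.proj e.2) Δs Δu C r
  contracting : ∃ h, IsReparametrizing φ X Λ h ∧
    IsContractingFor (fun e : TangentBundle (𝓡 d) M => e.proj) (sphereFlow φ)
      (extPoincareFlow φ) h (extendedSet X Λ) Δs C r
  expanding : ∃ h, IsReparametrizing φ X Λ h ∧
    IsExpandingFor (fun e : TangentBundle (𝓡 d) M => e.proj) (sphereFlow φ)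
      (extPoincareFlow φ) h (extendedSet X Λ) Δu C r

/-- `Λ` is multisingular hyperbolic for `X`. -/
def IsMultisingularHyperbolic (φ : ℝ → M → M) (X : ∀ x : M, TangentSpace (𝓡 d) x)
    (Λ : Set M) : Prop :=
  ∃ Δs Δu : ∀ e : TangentBundle (𝓡 d) M, Submodule ℝ (TangentSpace (𝓡 d) e.proj), ∃ C r : ℝ,
    IsMultisingularHyperbolicWith φ X Λ Δs Δu C r

end SingularHyperbolicity

/-!
Along a positively singular hyperbolic set `Λ` with splitting `E ⊕ F` the field `X` lies in `F`: its
component in the contracted bundle `E` would otherwise grow without bound in the past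
(`field_mem_right`). As `F` is closed, every unit vector `e` of the extended set `Λ̃` lies in `F`.
Hence the projections `π_e(E)` and `π_e(F)` along `e` are complementary in `N_e`, continuous and
invariant, since the extended linear Poincaré flow is the action of the tangent flow on the
quotients by the lines `ℝ e`. The angle between `E` and `F` is bounded below on the compact set `Λ`
(`exists_norm_le_mul_norm_add`), so projecting `E` changes norms by a bounded factor only; and
`π_e(F) ⊆ F`. So domination and contraction pass to the projected splitting. For `v ∈ π_e(F)`,
the product `‖Φ_{-t} e‖ · ‖ψ̃_{-t} v‖` is `‖v‖` times the factor by which `Φ_{-t}` changes the area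
of the plane spanned by `e` and `v`, and is therefore exponentially small: `π(F)` is expanded by the
extended linear Poincaré flow multiplied by the growth of the vectors of `Λ̃`
(`norm_tangentFlow_mul_norm_extPoincareFlow_lt_of_mem_right`).

It remains to replace the growth `‖Φ_t e‖` by a reparametrizing cocycle. A hyperbolic singularity is
an isolated invariant set, by a cone argument for a time-`T` map that uses only its
differentiability at the singularity (`exists_forall_orbit_eq_fixedPoint`). So `Λ` contains finitely
many singularities `σ`, with disjoint isolating neighborhoods `U_σ` that contain all points of `Λ`
with speed less than some `c > 0`, and only such points (`exists_isolating_nhds`). Let `m_σ` be the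
speed `‖X‖` on `U_σ` and `c` elsewhere. The coboundary `m_σ(φ_t x) / m_σ(x)` of this function,
completed by `‖Φ_t e‖` over `σ`, is a pragmatical cocycle (`isPragmatical_speedCocycle`). The product
of these cocycles is the coboundary of `min ‖X‖ c`, which is at most a constant times the coboundary
`‖Φ_t e‖` of the bounded function `‖X‖` (`exists_isReparametrizing_le`). For the contraction of
`π(E)` the empty product serves.

The case of `-X` follows by reversing time, which exchanges the two bundles and replaces the vectors
of `Λ̃` by their opposites (`IsMultisingularHyperbolicWith.timeReversal`).

All of this needs the flow of a `C¹` field to be `C¹`, so that the tangent flow is jointly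
continuous. In a chart, the solutions of `γ' = t f(γ)`, `γ(0) = x`, on a fixed time interval are the
zeros of a `C¹` map between spaces of continuous curves, and the implicit function theorem at `t = 0`
applies (`exists_contDiffAt_rescaled_flow`). The group law and compactness give all times
(`contMDiff_flow`).
-/


/-! ### Local flows from the implicit function theorem -/

section Nemytskii

set_option synthInstance.maxHeartbeats 200000

variable {K E F : Type*} [TopologicalSpace K] [CompactSpace K] [NormedAddCommGroup E]
  [NormedSpace ℝ E] [NormedAddCommGroup F] [NormedSpace ℝ F]

/-- Pointwise application of a continuous family of continuous linear maps to a continuous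
function. -/
noncomputable def pointwiseApply (A : C(K, E →L[ℝ] F)) : C(K, E) →L[ℝ] C(K, F) :=
  let B : C(K, E) →ₗ[ℝ] C(K, F) :=
    { toFun := fun γ => ⟨fun s => A s (γ s), A.continuous.clm_apply γ.continuous⟩
      map_add' := fun _ _ => by ext; simp
      map_smul' := fun _ _ => by ext; simp }
  B.mkContinuous ‖A‖ (fun γ => by
    rw [ContinuousMap.norm_le _ (by positivity)]
    intro s
    exact ((A s).le_opNorm _).trans (mul_le_mul (A.norm_coe_le_norm s) (γ.norm_coe_le_norm s)
      (norm_nonneg (γ s)) (norm_nonneg A)))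

lemma continuous_pointwiseApply :
    Continuous (pointwiseApply : C(K, E →L[ℝ] F) → C(K, E) →L[ℝ] C(K, F)) := by
  have hL : LipschitzWith 1 (pointwiseApply : C(K, E →L[ℝ] F) → C(K, E) →L[ℝ] C(K, F)) := ?_
  · exact hL.continuous
  refine LipschitzWith.of_dist_le_mul fun A A' => ?_
  rw [dist_eq_norm, NNReal.coe_one, one_mul]
  refine ContinuousLinearMap.opNorm_le_bound _ dist_nonneg fun γ => ?_
  rw [ContinuousMap.norm_le _ (by positivity)]
  intro s
  have h : ‖(A s - A' s) (γ s)‖ ≤ dist A A' * ‖γ‖ := by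
    refine ((A s - A' s).le_opNorm _).trans ?_
    rw [← dist_eq_norm]
    exact mul_le_mul (ContinuousMap.dist_apply_le_dist s) (γ.norm_coe_le_norm s)
      (norm_nonneg _) dist_nonneg
  exact h

/-- The composition operator `γ ↦ f ∘ γ` on continuous functions is `C¹` if `f` is. -/
lemma contDiff_one_continuousMap_comp {f : E → F} (hf : ContDiff ℝ 1 f) :
    ContDiff ℝ 1 (fun γ : C(K, E) => (⟨f, hf.continuous⟩ : C(E, F)).comp γ) := by
  rw [contDiff_one_iff_hasFDerivAt]
  have hc : Continuous (fderiv ℝ f) := hf.continuous_fderiv one_ne_zero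
  have hN : Continuous fun γ : C(K, E) => (⟨fderiv ℝ f, hc⟩ : C(E, E →L[ℝ] F)).comp γ :=
    ContinuousMap.continuous_postcomp _
  refine ⟨fun γ => pointwiseApply ((⟨fderiv ℝ f, hc⟩ : C(E, E →L[ℝ] F)).comp γ),
    continuous_pointwiseApply.comp hN, fun γ => ?_⟩
  rw [hasFDerivAt_iff_isLittleO_nhds_zero, Asymptotics.isLittleO_iff]
  intro ε hε
  obtain ⟨δ, hδ, H⟩ := (Metric.continuousAt_iff (α := C(K, E)) (β := C(K, E →L[ℝ] F))).1
    (hN.continuousAt (x := γ)) ε hε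
  filter_upwards [Metric.ball_mem_nhds (0 : C(K, E)) hδ] with η hη
  rw [mem_ball_zero_iff] at hη
  rw [ContinuousMap.norm_le _ (by positivity)]
  intro s
  have key := (convex_ball (γ s) δ).norm_image_sub_le_of_norm_fderiv_le' (𝕜 := ℝ) (f := f)
    (φ := fderiv ℝ f (γ s)) (C := ε) (x := γ s) (y := γ s + η s)
    (fun x _ => (hf.differentiable one_ne_zero) x) (fun x hx => by
      -- compare with the translate of `γ` by the constant `x - γ s`
      have h1 : dist (γ + ContinuousMap.const K (x - γ s)) γ < δ := by
        rw [dist_eq_norm, add_sub_cancel_left]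
        refine lt_of_le_of_lt ((ContinuousMap.norm_le _ (norm_nonneg (x - γ s))).2 fun _ => ?_)
          (mem_ball_iff_norm.1 hx)
        simp
      have h2 := (ContinuousMap.dist_apply_le_dist s).trans (H h1).le
      simpa [dist_eq_norm] using h2) (Metric.mem_ball_self hδ)
    (by
      rw [mem_ball_iff_norm, add_sub_cancel_left]
      exact (η.norm_coe_le_norm s).trans_lt hη)
  rw [add_sub_cancel_left] at key
  exact key.trans (mul_le_mul_of_nonneg_left (η.norm_coe_le_norm s) hε.le)

end Nemytskii

section LocalFlow

variable {E : Type*} [NormedAddCommGroup E] [NormedSpace ℝ E]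

/-- The primitive `s ↦ ∫₀ˢ γ` of a curve on `[-1, 1]`, as a continuous linear map. -/
noncomputable def primitiveCLM (E : Type*) [NormedAddCommGroup E] [NormedSpace ℝ E] :
    C(Icc (-1 : ℝ) 1, E) →L[ℝ] C(Icc (-1 : ℝ) 1, E) :=
  have h01 : (-1 : ℝ) ≤ 1 := by norm_num
  have hi (γ : C(Icc (-1 : ℝ) 1, E)) (a b : ℝ) :
      IntervalIntegrable (IccExtend h01 γ) MeasureTheory.volume a b :=
    γ.continuous.Icc_extend'.intervalIntegrable _ _
  let J : C(Icc (-1 : ℝ) 1, E) →ₗ[ℝ] C(Icc (-1 : ℝ) 1, E) :=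
    { toFun := fun γ => ⟨fun s => ∫ u in (0 : ℝ)..s, IccExtend h01 γ u,
        (intervalIntegral.continuous_primitive (hi γ) 0).comp continuous_subtype_val⟩
      map_add' := fun γ η => by
        ext s
        exact intervalIntegral.integral_add (hi γ _ _) (hi η _ _)
      map_smul' := fun c γ => by
        ext s
        exact intervalIntegral.integral_smul c _ }
  J.mkContinuous 1 (fun γ => by
    rw [ContinuousMap.norm_le _ (by positivity)]
    intro s
    refine (intervalIntegral.norm_integral_le_of_norm_le_const
      (C := ‖γ‖) fun u _ => γ.norm_coe_le_norm _).trans ?_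
    rw [one_mul, sub_zero]
    exact mul_le_of_le_one_right (norm_nonneg _) (abs_le.2 s.2))

lemma primitiveCLM_apply (γ : C(Icc (-1 : ℝ) 1, E)) (s : Icc (-1 : ℝ) 1) :
    primitiveCLM E γ s = ∫ u in (0 : ℝ)..s, IccExtend (by norm_num) γ u := rfl

/-- Constant functions, as a continuous linear map. -/
noncomputable def constCLM (K E : Type*) [TopologicalSpace K] [CompactSpace K]
    [NormedAddCommGroup E] [NormedSpace ℝ E] : E →L[ℝ] C(K, E) :=
  LinearMap.mkContinuous
    { toFun := ContinuousMap.const K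
      map_add' := fun _ _ => rfl
      map_smul' := fun _ _ => rfl } 1 (fun x => by
    rw [ContinuousMap.norm_le _ (by positivity)]
    exact fun _ => (one_mul ‖x‖).ge)

/-- Local solutions of `γ' = t f(γ)`, `γ(0) = x`, on the fixed time interval `[-1, 1]`, depend in a
`C¹` way on `(x, t)` near `(x₀, 0)`. The rescaling of time makes this an instance of the implicit
function theorem in which the derivative with respect to the curve is the identity. -/
lemma exists_contDiffAt_rescaled_flow [CompleteSpace E] {f : E → E} (hf : ContDiff ℝ 1 f) (x₀ : E) :
    ∃ β : E × ℝ → C(Icc (-1 : ℝ) 1, E), ContDiffAt ℝ 1 β (x₀, 0) ∧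
      β (x₀, 0) = constCLM (Icc (-1 : ℝ) 1) E x₀ ∧
      ∀ᶠ p in 𝓝 (x₀, (0 : ℝ)), IccExtend (by norm_num) (β p) 0 = p.1 ∧
        ∀ s ∈ Ioo (-1 : ℝ) 1, HasDerivAt (IccExtend (by norm_num) (β p))
          (p.2 • f (IccExtend (by norm_num) (β p) s)) s := by
  let N : C(Icc (-1 : ℝ) 1, E) → C(Icc (-1 : ℝ) 1, E) := fun γ =>
    (⟨f, hf.continuous⟩ : C(E, E)).comp γ
  have hN : ContDiff ℝ 1 N := contDiff_one_continuousMap_comp hf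
  let G : (E × ℝ) × C(Icc (-1 : ℝ) 1, E) → C(Icc (-1 : ℝ) 1, E) := fun q =>
    q.2 - constCLM (Icc (-1 : ℝ) 1) E q.1.1 - q.1.2 • primitiveCLM E (N q.2)
  have hG : ContDiff ℝ 1 G := by
    refine (contDiff_snd.sub (ContDiff.comp (g := constCLM (Icc (-1 : ℝ) 1) E)
      (constCLM (Icc (-1 : ℝ) 1) E).contDiff (contDiff_fst.comp contDiff_fst))).sub ?_
    exact (contDiff_snd.comp contDiff_fst).smul
      (ContDiff.comp (g := primitiveCLM E) (primitiveCLM E).contDiff (hN.comp contDiff_snd))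
  let u : (E × ℝ) × C(Icc (-1 : ℝ) 1, E) := ((x₀, 0), constCLM (Icc (-1 : ℝ) 1) E x₀)
  have hu : G u = 0 := by simp [G, u]
  have hinv : (fderiv ℝ G u ∘L .inr ℝ (E × ℝ) C(Icc (-1 : ℝ) 1, E)).IsInvertible := by
    have h1 : HasFDerivAt (fun γ => G (u.1, γ))
        (fderiv ℝ G u ∘L .inr ℝ (E × ℝ) C(Icc (-1 : ℝ) 1, E)) u.2 :=
      HasFDerivAt.comp u.2 (g := G) (f := fun γ => (u.1, γ))
        ((hG.differentiable one_ne_zero) u).hasFDerivAt (hasFDerivAt_prodMk_right _ _)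
    have h2 : HasFDerivAt (fun γ => G (u.1, γ))
        (ContinuousLinearMap.id ℝ C(Icc (-1 : ℝ) 1, E)) u.2 := by
      have : (fun γ => G (u.1, γ)) = fun γ => γ - constCLM (Icc (-1 : ℝ) 1) E x₀ := by
        funext γ; simp [G, u]
      rw [this]
      exact (hasFDerivAt_id _).sub_const _
    rw [h1.unique h2]
    exact ⟨ContinuousLinearEquiv.refl ℝ _, rfl⟩
  have hGu := hG.contDiffAt (x := u)
  refine ⟨hGu.implicitFunction one_ne_zero hinv,
    hGu.contDiffAt_implicitFunction one_ne_zero hinv,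
    hGu.implicitFunction_apply_self one_ne_zero hinv, ?_⟩
  filter_upwards [hGu.eventually_apply_implicitFunction one_ne_zero hinv] with p hp
  set γ := hGu.implicitFunction one_ne_zero hinv p with hγ
  rw [hu] at hp
  have hval : ∀ s : Icc (-1 : ℝ) 1, γ s = p.1 + p.2 • ∫ u in (0 : ℝ)..s,
      f (IccExtend (by norm_num) γ u) := by
    intro s
    have h := congrArg (fun η : C(Icc (-1 : ℝ) 1, E) => η s) hp
    have h' : γ s - p.1 - p.2 • primitiveCLM E (N γ) s = 0 := h
    rw [primitiveCLM_apply] at h'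
    rw [sub_sub, sub_eq_zero] at h'
    exact h'
  have hcont : Continuous fun u => f (IccExtend (by norm_num) γ u) :=
    hf.continuous.comp (γ.continuous.Icc_extend')
  have hval' : ∀ s ∈ Icc (-1 : ℝ) 1, IccExtend (by norm_num) γ s = p.1 + p.2 • ∫ u in (0 : ℝ)..s,
      f (IccExtend (by norm_num) γ u) := fun s hs => by
    rw [IccExtend_of_mem _ _ hs]; exact hval ⟨s, hs⟩
  refine ⟨by rw [hval' 0 (by norm_num)]; simp, fun s hs => ?_⟩
  have hd : HasDerivAt (fun s => p.1 + p.2 • ∫ u in (0 : ℝ)..s, f (IccExtend (by norm_num) γ u))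
      (p.2 • f (IccExtend (by norm_num) γ s)) s :=
    ((intervalIntegral.integral_hasDerivAt_right (hcont.intervalIntegrable _ _)
      (hcont.stronglyMeasurableAtFilter _ _) hcont.continuousAt).const_smul p.2).const_add p.1
  refine hd.congr_of_eventuallyEq ?_
  filter_upwards [Icc_mem_nhds hs.1 hs.2] with s' hs' using hval' s' hs'

end LocalFlow

/-! ### The flow of a `C¹` vector field is `C¹` -/

section FlowRegularity

variable {d : ℕ} {M : Type*} [TopologicalSpace M] [ChartedSpace (EuclideanSpace ℝ (Fin d)) M]
  [IsManifold (𝓡 d) ∞ M]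

/-- The vector field `X` read in the extended chart at `x₀`. -/
noncomputable def chartField (X : ∀ x : M, TangentSpace (𝓡 d) x) (x₀ : M)
    (y : EuclideanSpace ℝ (Fin d)) : EuclideanSpace ℝ (Fin d) :=
  mfderiv (𝓡 d) 𝓘(ℝ, EuclideanSpace ℝ (Fin d)) (extChartAt (𝓡 d) x₀)
    ((extChartAt (𝓡 d) x₀).symm y) (X ((extChartAt (𝓡 d) x₀).symm y))

lemma trivializationAt_snd_eq_mfderiv (x₀ x : M)
    (hx : x ∈ (chartAt (EuclideanSpace ℝ (Fin d)) x₀).source)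
    (v : TangentSpace (𝓡 d) x) :
    (trivializationAt (EuclideanSpace ℝ (Fin d)) (TangentSpace (𝓡 d)) x₀
      (⟨x, v⟩ : TangentBundle (𝓡 d) M)).2 =
      mfderiv (𝓡 d) 𝓘(ℝ, EuclideanSpace ℝ (Fin d)) (extChartAt (𝓡 d) x₀) x v := by
  have h1 := DFunLike.congr_fun (TangentBundle.continuousLinearMapAt_trivializationAt
    (I := 𝓡 d) hx) v
  refine Eq.trans ?_ h1
  exact (congrFun (Trivialization.coe_linearMapAt_of_mem (R := ℝ)
    (trivializationAt (EuclideanSpace ℝ (Fin d)) (TangentSpace (𝓡 d)) x₀) hx) v).symm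

lemma contDiffAt_chartField {X : ∀ x : M, TangentSpace (𝓡 d) x}
    (hX : ContMDiff (𝓡 d) (𝓡 d).tangent 1 (fun x => (⟨x, X x⟩ : TangentBundle (𝓡 d) M)))
    (x₀ : M) {y : EuclideanSpace ℝ (Fin d)} (hy : y ∈ (extChartAt (𝓡 d) x₀).target) :
    ContDiffAt ℝ 1 (chartField X x₀) y := by
  have hsrc : (extChartAt (𝓡 d) x₀).symm y ∈ (chartAt (EuclideanSpace ℝ (Fin d)) x₀).source := by
    rw [← extChartAt_source (𝓡 d)]
    exact (extChartAt (𝓡 d) x₀).map_target hy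
  have htar : (extChartAt (𝓡 d) x₀).target ∈ 𝓝 y := (isOpen_extChartAt_target x₀).mem_nhds hy
  have h1 := ((trivializationAt (EuclideanSpace ℝ (Fin d)) (TangentSpace (𝓡 d))
    x₀).contMDiffAt_section_iff (IB := 𝓡 d) (n := 1) (s := X)
    (x₀ := (extChartAt (𝓡 d) x₀).symm y) hsrc).1 (hX _)
  have h2 : ContMDiffAt 𝓘(ℝ, EuclideanSpace ℝ (Fin d)) (𝓡 d) 1 (extChartAt (𝓡 d) x₀).symm y :=
    (contMDiffWithinAt_extChartAt_symm_target x₀ hy).contMDiffAt htar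
  have h3 := (h1.comp y h2).contDiffAt
  refine h3.congr_of_eventuallyEq ?_
  filter_upwards [htar] with z hz
  refine (trivializationAt_snd_eq_mfderiv _ _ ?_ _).symm
  rw [← extChartAt_source (𝓡 d)]
  exact (extChartAt (𝓡 d) x₀).map_target hz

/-- A curve in the chart domain is tangent to `X` if its expression in the chart is tangent to the
expression of `X`. -/
lemma hasMFDerivAt_extChartAt_symm_comp {X : ∀ x : M, TangentSpace (𝓡 d) x} {x₀ : M}
    {g : ℝ → EuclideanSpace ℝ (Fin d)} {s : ℝ} (hs : g s ∈ (extChartAt (𝓡 d) x₀).target)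
    (c : ℝ) (hg : HasDerivAt g (c • chartField X x₀ (g s)) s) :
    HasMFDerivAt 𝓘(ℝ, ℝ) (𝓡 d) (fun s => (extChartAt (𝓡 d) x₀).symm (g s)) s
      ((1 : ℝ →L[ℝ] ℝ).smulRight ((c • X) ((extChartAt (𝓡 d) x₀).symm (g s)))) := by
  have htar : (extChartAt (𝓡 d) x₀).target ∈ 𝓝 (g s) := (isOpen_extChartAt_target x₀).mem_nhds hs
  have h1 : MDifferentiableAt 𝓘(ℝ, EuclideanSpace ℝ (Fin d)) (𝓡 d)
      (extChartAt (𝓡 d) x₀).symm (g s) :=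
    ((contMDiffWithinAt_extChartAt_symm_target (n := 1) x₀ hs).contMDiffAt
      htar).mdifferentiableAt one_ne_zero
  have h2 : HasMFDerivAt 𝓘(ℝ, ℝ) 𝓘(ℝ, EuclideanSpace ℝ (Fin d)) g s
      ((1 : ℝ →L[ℝ] ℝ).smulRight (c • chartField X x₀ (g s))) :=
    hg.hasFDerivAt.hasMFDerivAt
  refine (h1.hasMFDerivAt.comp s h2).congr_mfderiv ?_
  have h3 := DFunLike.congr_fun
    (mfderivWithin_extChartAt_symm_comp_mfderiv_extChartAt (I := 𝓡 d) hs)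
    (X ((extChartAt (𝓡 d) x₀).symm (g s)))
  rw [show range (𝓡 d) = univ from (𝓡 d).range_eq_univ, mfderivWithin_univ] at h3
  have h4 : mfderiv 𝓘(ℝ, EuclideanSpace ℝ (Fin d)) (𝓡 d) (extChartAt (𝓡 d) x₀).symm (g s)
      (chartField X x₀ (g s)) = X ((extChartAt (𝓡 d) x₀).symm (g s)) := h3
  refine ContinuousLinearMap.ext fun (a : ℝ) => ?_
  change mfderiv 𝓘(ℝ, EuclideanSpace ℝ (Fin d)) (𝓡 d) (extChartAt (𝓡 d) x₀).symm (g s)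
    (a • (c • chartField X x₀ (g s))) = a • (c • X ((extChartAt (𝓡 d) x₀).symm (g s)))
  rw [← h4]
  exact ((mfderiv 𝓘(ℝ, EuclideanSpace ℝ (Fin d)) (𝓡 d) (extChartAt (𝓡 d) x₀).symm
    (g s)).map_smul a _).trans (congrArg (a • ·) ((mfderiv 𝓘(ℝ, EuclideanSpace ℝ (Fin d)) (𝓡 d)
      (extChartAt (𝓡 d) x₀).symm (g s)).map_smul c _))

variable [T2Space M] {X : ∀ x : M, TangentSpace (𝓡 d) x} {φ : ℝ → M → M}

/-- The flow of a `C¹` vector field is `C¹` in time and space near time `0`. -/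
lemma contMDiffAt_flow_zero
    (hX : ContMDiff (𝓡 d) (𝓡 d).tangent 1 (fun x => (⟨x, X x⟩ : TangentBundle (𝓡 d) M)))
    (hφ : IsFlowOf φ X) (x₀ : M) :
    ContMDiffAt (𝓘(ℝ, ℝ).prod (𝓡 d)) (𝓡 d) 1 (fun p : ℝ × M => φ p.1 p.2) (0, x₀) := by
  set χ := extChartAt (𝓡 d) x₀ with hχ
  set y₀ := χ x₀ with hy₀
  have hy₀t : y₀ ∈ χ.target := mem_extChartAt_target x₀
  obtain ⟨r, hr, hball⟩ := Metric.isOpen_iff.1 (isOpen_extChartAt_target (I := 𝓡 d) x₀) y₀ hy₀t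
  -- multiply the field by a bump function to make it globally defined and `C¹`
  let b : ContDiffBump y₀ := ⟨r / 3, r / 2, by positivity, by linarith⟩
  let f : EuclideanSpace ℝ (Fin d) → EuclideanSpace ℝ (Fin d) := fun y => b y • chartField X x₀ y
  have hf : ContDiff ℝ 1 f := by
    rw [contDiff_iff_contDiffAt]
    intro y
    by_cases hy : y ∈ Metric.ball y₀ r
    · exact b.contDiffAt.smul (contDiffAt_chartField hX x₀ (hball hy))
    · have : f =ᶠ[𝓝 y] fun _ => 0 := by
        have hy' : y ∈ (Metric.closedBall y₀ (r / 2))ᶜ := fun h =>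
          hy (Metric.closedBall_subset_ball (by linarith) h)
        filter_upwards [Metric.isClosed_closedBall.isOpen_compl.mem_nhds hy'] with z hz
        simp only [f]
        rw [b.zero_of_le_dist, zero_smul]
        exact (not_le.1 fun h => hz (Metric.mem_closedBall.2 h)).le
      exact contDiffAt_const.congr_of_eventuallyEq this
  obtain ⟨β, hβ, hβ₀, hev⟩ := exists_contDiffAt_rescaled_flow hf y₀
  have hnear : ∀ᶠ p in 𝓝 (y₀, (0 : ℝ)), ∀ s, IccExtend (by norm_num) (β p) s ∈
      Metric.ball y₀ (r / 3) := by
    filter_upwards [Metric.tendsto_nhds.1 hβ.continuousAt (r / 3) (by positivity)] with p hp s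
    rw [hβ₀] at hp
    exact (ContinuousMap.dist_apply_le_dist _).trans_lt hp
  have hmain : ∀ᶠ p in 𝓝 (y₀, (0 : ℝ)), φ (1 / 2 * p.2) (χ.symm p.1) =
      χ.symm (β p ⟨1 / 2, by norm_num, by norm_num⟩) := by
    filter_upwards [hev, hnear] with p hp hpn
    have hsm : IsMIntegralCurveOn (I := 𝓡 d)
        (fun s => χ.symm (IccExtend (by norm_num) (β p) s)) (p.2 • X) (Ioo (-1) 1) := by
      intro s hs
      refine (hasMFDerivAt_extChartAt_symm_comp (hball ?_) p.2 ?_).hasMFDerivWithinAt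
      · exact Metric.ball_subset_ball (by linarith) (hpn s)
      · have h := hp.2 s hs
        simp only [f] at h
        rwa [b.one_of_mem_closedBall (Metric.ball_subset_closedBall (hpn s)), one_smul] at h
    have hfl : IsMIntegralCurveOn (I := 𝓡 d)
        ((fun t => φ t (χ.symm p.1)) ∘ (· * p.2)) (p.2 • X) (Ioo (-1) 1) :=
      ((hφ (χ.symm p.1)).2.comp_mul p.2).isMIntegralCurveOn _
    have hpX : ContMDiff (𝓡 d) (𝓡 d).tangent 1
        (fun x => (⟨x, (p.2 • X) x⟩ : TangentBundle (𝓡 d) M)) := hX.const_smul_section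
    have heq := isMIntegralCurveOn_Ioo_eqOn_of_contMDiff_boundaryless (t₀ := 0)
      (by norm_num) hpX hfl hsm (by
        simp only [Function.comp_apply, zero_mul]
        rw [hp.1, (hφ _).1])
    have h2 := heq (show (1 / 2 : ℝ) ∈ Ioo (-1 : ℝ) 1 by norm_num)
    simp only [Function.comp_apply] at h2
    rw [h2, IccExtend_of_mem _ _ ⟨by norm_num, by norm_num⟩]
  let ev : C(Icc (-1 : ℝ) 1, EuclideanSpace ℝ (Fin d)) → EuclideanSpace ℝ (Fin d) :=
    fun γ => γ ⟨1 / 2, by norm_num, by norm_num⟩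
  have hevs : ContDiff ℝ 1 ev := (ContinuousMap.evalCLM (R := ℝ) (M := EuclideanSpace ℝ (Fin d))
    (⟨1 / 2, by norm_num, by norm_num⟩ : Icc (-1 : ℝ) 1)).contDiff
  let j : ℝ × M → EuclideanSpace ℝ (Fin d) × ℝ := fun p => (χ p.2, 2 * p.1)
  have hj0 : j (0, x₀) = (y₀, 0) := by simp [j, hy₀]
  have hj : ContMDiffAt (𝓘(ℝ, ℝ).prod (𝓡 d)) 𝓘(ℝ, EuclideanSpace ℝ (Fin d) × ℝ) 1 j (0, x₀) := by
    refine ContMDiffAt.prodMk_space ?_ ?_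
    · exact ContMDiffAt.comp (g := χ) (f := Prod.snd) ((0 : ℝ), x₀)
        (contMDiffAt_extChartAt (I := 𝓡 d)) contMDiffAt_snd
    · exact ContMDiffAt.comp (g := fun t : ℝ => 2 * t) (f := Prod.fst) ((0 : ℝ), x₀)
        (contDiff_const.mul contDiff_id).contDiffAt.contMDiffAt contMDiffAt_fst
  have hk : ContMDiffAt (𝓘(ℝ, ℝ).prod (𝓡 d)) 𝓘(ℝ, EuclideanSpace ℝ (Fin d)) 1
      (fun p => ev (β (j p))) (0, x₀) :=
    ContMDiffAt.comp_of_eq (g := fun q => ev (β q)) (f := j)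
      (hevs.contDiffAt.comp _ hβ).contMDiffAt hj hj0
  have hk0 : ev (β (j (0, x₀))) = y₀ := by rw [hj0, hβ₀]; rfl
  have hs : ContMDiffAt 𝓘(ℝ, EuclideanSpace ℝ (Fin d)) (𝓡 d) 1 χ.symm y₀ :=
    (contMDiffWithinAt_extChartAt_symm_target x₀ hy₀t).contMDiffAt
      ((isOpen_extChartAt_target x₀).mem_nhds hy₀t)
  refine (ContMDiffAt.comp_of_eq (g := χ.symm) (f := fun p => ev (β (j p))) hs hk
    hk0).congr_of_eventuallyEq ?_
  have hjc : Filter.Tendsto j (𝓝 (0, x₀)) (𝓝 (y₀, 0)) := hj0 ▸ hj.continuousAt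
  filter_upwards [hjc.eventually hmain, (continuous_snd.tendsto ((0 : ℝ), x₀)).eventually
    (extChartAt_source_mem_nhds (I := 𝓡 d) x₀)] with p hp hp2
  have h1 : χ.symm (j p).1 = p.2 := χ.left_inv hp2
  have h2 : 1 / 2 * (j p).2 = p.1 := by simp only [j]; ring
  rw [h1, h2] at hp
  exact hp

lemma flow_add
    (hX : ContMDiff (𝓡 d) (𝓡 d).tangent 1 (fun x => (⟨x, X x⟩ : TangentBundle (𝓡 d) M)))
    (hφ : IsFlowOf φ X) (s t : ℝ) (x : M) :
    φ (s + t) x = φ t (φ s x) := by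
  have h := isMIntegralCurve_Ioo_eq_of_contMDiff_boundaryless (t₀ := 0) hX
    ((hφ x).2.comp_add s) (hφ (φ s x)).2 (by simp [(hφ (φ s x)).1])
  have h2 := congrFun h t
  simpa [add_comm] using h2

lemma flow_eq_self
    (hX : ContMDiff (𝓡 d) (𝓡 d).tangent 1 (fun x => (⟨x, X x⟩ : TangentBundle (𝓡 d) M)))
    (hφ : IsFlowOf φ X) {σ : M} (hσ : X σ = 0) (t : ℝ) : φ t σ = σ :=
  congrFun (isMIntegralCurve_Ioo_eq_of_contMDiff_boundaryless (t₀ := 0) hX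
    (hφ σ).2 (isMIntegralCurve_const hσ) (hφ σ).1) t

lemma flow_injective
    (hX : ContMDiff (𝓡 d) (𝓡 d).tangent 1 (fun x => (⟨x, X x⟩ : TangentBundle (𝓡 d) M)))
    (hφ : IsFlowOf φ X) (t : ℝ) : Function.Injective (φ t) := by
  intro x y hxy
  have h := congrArg (φ (-t)) hxy
  rwa [← flow_add hX hφ, ← flow_add hX hφ, add_neg_cancel, (hφ x).1, (hφ y).1] at h

/-- The flow of a `C¹` vector field on a compact manifold is jointly `C¹`. -/
lemma contMDiff_flow [CompactSpace M]
    (hX : ContMDiff (𝓡 d) (𝓡 d).tangent 1 (fun x => (⟨x, X x⟩ : TangentBundle (𝓡 d) M)))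
    (hφ : IsFlowOf φ X) :
    ContMDiff (𝓘(ℝ, ℝ).prod (𝓡 d)) (𝓡 d) 1 (fun p : ℝ × M => φ p.1 p.2) := by
  have h0 : ∀ᶠ t in 𝓝 (0 : ℝ), ∀ x : M,
      ContMDiffAt (𝓘(ℝ, ℝ).prod (𝓡 d)) (𝓡 d) 1 (fun p : ℝ × M => φ p.1 p.2) (t, x) := by
    have := isCompact_univ.eventually_forall_of_forall_eventually (x₀ := (0 : ℝ)) (K := univ)
      (P := fun (t : ℝ) (x : M) =>
      ContMDiffAt (𝓘(ℝ, ℝ).prod (𝓡 d)) (𝓡 d) 1 (fun p : ℝ × M => φ p.1 p.2) (t, x))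
      (fun x _ => (contMDiffAt_iff_contMDiffAt_nhds (by simp)).1
        (contMDiffAt_flow_zero hX hφ x))
    simpa using this
  have hslice : ∀ t : ℝ, ∀ x : M, ContMDiffAt (𝓘(ℝ, ℝ).prod (𝓡 d)) (𝓡 d) 1
      (fun p : ℝ × M => φ p.1 p.2) (t, x) → ContMDiffAt (𝓡 d) (𝓡 d) 1 (φ t) x := fun t x h =>
    ContMDiffAt.comp (g := fun p : ℝ × M => φ p.1 p.2) (f := fun x => (t, x)) x h
      (contMDiffAt_const.prodMk contMDiffAt_id)
  -- every time-`t` map is an iterate of a map `φ (t / n)` with `t / n` small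
  have hiter : ∀ (n : ℕ) (s : ℝ) (x : M), φ (n * s) x = (φ s)^[n] x := by
    intro n s
    induction n with
    | zero => intro x; simp [(hφ x).1]
    | succ n ih =>
      intro x
      rw [Function.iterate_succ_apply, ← ih, ← flow_add hX hφ]
      congr 1; push_cast; ring
  have ht : ∀ t : ℝ, ContMDiff (𝓡 d) (𝓡 d) 1 (φ t) := by
    intro t
    have hlim : Filter.Tendsto (fun n : ℕ => t / n) Filter.atTop (𝓝 0) :=
      tendsto_const_div_atTop_nhds_zero_nat t
    obtain ⟨n, hn, hn0⟩ := ((hlim.eventually h0).and (Filter.eventually_gt_atTop 0)).exists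
    have hn' : ContMDiff (𝓡 d) (𝓡 d) 1 (φ (t / n)) := fun x => hslice _ _ (hn x)
    have hk : ∀ k : ℕ, ContMDiff (𝓡 d) (𝓡 d) 1 ((φ (t / n))^[k]) := by
      intro k
      induction k with
      | zero => exact contMDiff_id
      | succ k ih => rw [Function.iterate_succ]; exact ih.comp hn'
    have heq : φ t = (φ (t / n))^[n] := by
      funext x
      rw [← hiter]
      congr 1
      have : (n : ℝ) ≠ 0 := by exact_mod_cast hn0.ne'
      field_simp
    rw [heq]; exact hk n
  rintro ⟨t, x⟩
  have heq : (fun p : ℝ × M => φ p.1 p.2) = (φ t) ∘ (fun p : ℝ × M => φ (p.1 - t) p.2) := by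
    funext p
    simp only [Function.comp_apply]
    rw [← flow_add hX hφ]
    congr 1; ring
  rw [heq]
  refine ContMDiffAt.comp (t, x) (ht t _) ?_
  refine ContMDiffAt.comp_of_eq (g := fun p : ℝ × M => φ p.1 p.2)
    (f := fun p : ℝ × M => (p.1 - t, p.2)) (contMDiffAt_flow_zero hX hφ x) ?_ (by simp)
  refine ContMDiffAt.prodMk ?_ contMDiffAt_snd
  exact ContMDiffAt.comp (g := fun s : ℝ => s - t) (f := Prod.fst) (t, x)
    (contDiff_id.sub contDiff_const).contDiffAt.contMDiffAt contMDiffAt_fst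

end FlowRegularity

/-! ### The tangent flow, and continuity in the tangent bundle -/

section TangentFlow

variable {d : ℕ} {M : Type*} [TopologicalSpace M] [ChartedSpace (EuclideanSpace ℝ (Fin d)) M]
  {X : ∀ x : M, TangentSpace (𝓡 d) x} {φ : ℝ → M → M}

/-- The tangent flow as a map of the tangent bundle. -/
noncomputable def bundleFlow (φ : ℝ → M → M) (t : ℝ) (v : TangentBundle (𝓡 d) M) :
    TangentBundle (𝓡 d) M :=
  ⟨φ t v.proj, tangentFlow φ t v.proj v.2⟩

lemma bundleFlow_zero (hφ : IsFlowOf φ X) (v : TangentBundle (𝓡 d) M) :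
    bundleFlow φ 0 v = v := by
  have h : φ 0 = id := funext fun x => (hφ x).1
  have h1 : bundleFlow φ 0 v = tangentMap (𝓡 d) (𝓡 d) (φ 0) v := rfl
  rw [h1, h, tangentMap_id]
  rfl

variable [IsManifold (𝓡 d) ∞ M] [T2Space M] [CompactSpace M]

lemma mdifferentiableAt_flow
    (hX : ContMDiff (𝓡 d) (𝓡 d).tangent 1 (fun x => (⟨x, X x⟩ : TangentBundle (𝓡 d) M)))
    (hφ : IsFlowOf φ X) (t : ℝ) (x : M) : MDifferentiableAt (𝓡 d) (𝓡 d) (φ t) x :=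
  ((contMDiff_flow hX hφ).comp (f := fun x => (t, x))
    (contMDiff_const.prodMk contMDiff_id)).mdifferentiable one_ne_zero x

lemma continuous_flow
    (hX : ContMDiff (𝓡 d) (𝓡 d).tangent 1 (fun x => (⟨x, X x⟩ : TangentBundle (𝓡 d) M)))
    (hφ : IsFlowOf φ X) : Continuous fun p : ℝ × M => φ p.1 p.2 :=
  (contMDiff_flow hX hφ).continuous

lemma continuous_bundleFlow
    (hX : ContMDiff (𝓡 d) (𝓡 d).tangent 1 (fun x => (⟨x, X x⟩ : TangentBundle (𝓡 d) M)))
    (hφ : IsFlowOf φ X) :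
    Continuous fun q : ℝ × TangentBundle (𝓡 d) M => bundleFlow φ q.1 q.2 := by
  have h1 := (contMDiff_flow hX hφ).continuous_tangentMap le_rfl
  have h2 : Continuous fun t : ℝ => (⟨t, 0⟩ : TangentBundle 𝓘(ℝ, ℝ) ℝ) :=
    (contMDiff_zeroSection (n := 0) (IB := 𝓘(ℝ, ℝ)) ℝ (TangentSpace 𝓘(ℝ, ℝ))).continuous
  have h3 := (contMDiff_equivTangentBundleProd_symm (n := 0) (I := 𝓘(ℝ, ℝ)) (M := ℝ) (I' := 𝓡 d)
    (M' := M)).continuous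
  have h4 := h1.comp (h3.comp ((h2.comp continuous_fst).prodMk
    (continuous_snd (X := ℝ) (Y := TangentBundle (𝓡 d) M))))
  refine h4.congr fun q => ?_
  have hd : MDifferentiableAt (𝓘(ℝ, ℝ).prod (𝓡 d)) (𝓡 d) (fun p : ℝ × M => φ p.1 p.2)
    (q.1, q.2.proj) := (contMDiff_flow hX hφ).mdifferentiable one_ne_zero _
  have h5 := tangentMap_comp_at (I := 𝓡 d) (f := fun x : M => (q.1, x)) q.2 hd
    (mdifferentiableAt_const.prodMk mdifferentiableAt_id)
  rw [tangentMap_prod_right] at h5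
  exact h5.symm

lemma bundleFlow_add
    (hX : ContMDiff (𝓡 d) (𝓡 d).tangent 1 (fun x => (⟨x, X x⟩ : TangentBundle (𝓡 d) M)))
    (hφ : IsFlowOf φ X) (s t : ℝ) (v : TangentBundle (𝓡 d) M) :
    bundleFlow φ (s + t) v = bundleFlow φ t (bundleFlow φ s v) := by
  have h : φ (s + t) = φ t ∘ φ s := funext fun x => flow_add hX hφ s t x
  have h1 : bundleFlow φ (s + t) v = tangentMap (𝓡 d) (𝓡 d) (φ (s + t)) v := rfl
  rw [h1, h, tangentMap_comp_at v (mdifferentiableAt_flow hX hφ _ _)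
    (mdifferentiableAt_flow hX hφ _ _)]
  rfl

lemma tangentFlow_apply_field
    (hX : ContMDiff (𝓡 d) (𝓡 d).tangent 1 (fun x => (⟨x, X x⟩ : TangentBundle (𝓡 d) M)))
    (hφ : IsFlowOf φ X) (t : ℝ) (x : M) : tangentFlow φ t x (X x) = X (φ t x) := by
  suffices h : ∀ y, φ 0 x = y → tangentFlow φ t y (X y) = X (φ t y) from h x (hφ x).1
  rintro _ rfl
  have h1 : IsMIntegralCurve (I := 𝓡 d) (φ t ∘ fun s => φ s x) X := by
    have h := (hφ x).2.comp_add t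
    have heq : (fun s => φ s x) ∘ (· + t) = φ t ∘ fun s => φ s x :=
      funext fun s => flow_add hX hφ s t x
    rwa [heq] at h
  have h2 := (mdifferentiableAt_flow hX hφ t (φ 0 x)).hasMFDerivAt.comp (0 : ℝ) ((hφ x).2 0)
  have h3 := DFunLike.congr_fun (hasMFDerivAt_unique h2 (h1 0)) (1 : ℝ)
  have h4 : tangentFlow φ t (φ 0 x) ((1 : ℝ) • X (φ 0 x)) = (1 : ℝ) • X (φ t (φ 0 x)) := h3
  rwa [one_smul, one_smul] at h4

end TangentFlow

section TotalSpaceOperations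

variable {d : ℕ} {M : Type*} [TopologicalSpace M] [ChartedSpace (EuclideanSpace ℝ (Fin d)) M]
  [IsManifold (𝓡 d) ∞ M] {Y : Type*} [TopologicalSpace Y] {p : Y → M}
  {a b : ∀ y, TangentSpace (𝓡 d) (p y)} {c : Y → ℝ} {S : Set Y} {y₀ : Y}

/-- Continuity of a family of tangent vectors, read in the trivialization at a point. -/
lemma continuousWithinAt_tangent_iff :
    ContinuousWithinAt (fun y => (⟨p y, a y⟩ : TangentBundle (𝓡 d) M)) S y₀ ↔
      ContinuousWithinAt p S y₀ ∧ ContinuousWithinAt (fun y =>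
        (trivializationAt (EuclideanSpace ℝ (Fin d)) (TangentSpace (𝓡 d))
          (p y₀)).continuousLinearMapAt ℝ (p y) (a y)) S y₀ := by
  rw [FiberBundle.continuousWithinAt_totalSpace]
  refine and_congr_right fun hp => ?_
  have hev : ∀ᶠ y in 𝓝[S] y₀, p y ∈
      (trivializationAt (EuclideanSpace ℝ (Fin d)) (TangentSpace (𝓡 d)) (p y₀)).baseSet :=
    hp.eventually ((trivializationAt (EuclideanSpace ℝ (Fin d)) (TangentSpace (𝓡 d))
      (p y₀)).open_baseSet.mem_nhds
      (FiberBundle.mem_baseSet_trivializationAt' _))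
  have h : ∀ y, p y ∈
      (trivializationAt (EuclideanSpace ℝ (Fin d)) (TangentSpace (𝓡 d)) (p y₀)).baseSet →
      (trivializationAt (EuclideanSpace ℝ (Fin d)) (TangentSpace (𝓡 d)) (p y₀)
        (⟨p y, a y⟩ : TangentBundle (𝓡 d) M)).2 =
      (trivializationAt (EuclideanSpace ℝ (Fin d)) (TangentSpace (𝓡 d))
        (p y₀)).continuousLinearMapAt ℝ (p y) (a y) := fun y hy =>
    (congrFun (Trivialization.coe_linearMapAt_of_mem (R := ℝ) _ hy) (a y)).symm
  exact Filter.EventuallyEq.congr_continuousWithinAt (hev.mono h)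
    (h y₀ (FiberBundle.mem_baseSet_trivializationAt' _))

lemma ContinuousWithinAt.tangent_smul (hc : ContinuousWithinAt c S y₀)
    (ha : ContinuousWithinAt (fun y => (⟨p y, a y⟩ : TangentBundle (𝓡 d) M)) S y₀) :
    ContinuousWithinAt (fun y => (⟨p y, c y • a y⟩ : TangentBundle (𝓡 d) M)) S y₀ := by
  rw [continuousWithinAt_tangent_iff] at ha ⊢
  refine ⟨ha.1, ?_⟩
  simp only [map_smul]
  exact hc.smul ha.2

lemma ContinuousWithinAt.tangent_sub
    (ha : ContinuousWithinAt (fun y => (⟨p y, a y⟩ : TangentBundle (𝓡 d) M)) S y₀)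
    (hb : ContinuousWithinAt (fun y => (⟨p y, b y⟩ : TangentBundle (𝓡 d) M)) S y₀) :
    ContinuousWithinAt (fun y => (⟨p y, a y - b y⟩ : TangentBundle (𝓡 d) M)) S y₀ := by
  rw [continuousWithinAt_tangent_iff] at ha hb ⊢
  refine ⟨ha.1, ?_⟩
  simp only [map_sub]
  exact ha.2.sub hb.2

end TotalSpaceOperations

section TangentNorm

variable {d : ℕ} {M : Type*} [TopologicalSpace M] [ChartedSpace (EuclideanSpace ℝ (Fin d)) M]
  [IsManifold (𝓡 d) ∞ M] [RiemannianBundle (fun x : M => TangentSpace (𝓡 d) x)]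
  [IsContMDiffRiemannianBundle (𝓡 d) ∞ (EuclideanSpace ℝ (Fin d))
      (fun x : M => TangentSpace (𝓡 d) x)]
  {Y : Type*} [TopologicalSpace Y] {p : Y → M}
  {a b : ∀ y, TangentSpace (𝓡 d) (p y)} {S : Set Y} {y₀ : Y}

lemma isContinuousRiemannianBundle_tangent :
    IsContinuousRiemannianBundle (EuclideanSpace ℝ (Fin d))
      (fun x : M => TangentSpace (𝓡 d) x) := by
  obtain ⟨g, hg, hg'⟩ := IsContMDiffRiemannianBundle.exists_contMDiff (IB := 𝓡 d) (n := ∞)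
    (F := EuclideanSpace ℝ (Fin d)) (E := fun x : M => TangentSpace (𝓡 d) x)
  exact ⟨g, hg.continuous, hg'⟩

lemma ContinuousWithinAt.tangent_norm
    (ha : ContinuousWithinAt (fun y => (⟨p y, a y⟩ : TangentBundle (𝓡 d) M)) S y₀) :
    ContinuousWithinAt (fun y => ‖a y‖) S y₀ := by
  have : IsContinuousRiemannianBundle (EuclideanSpace ℝ (Fin d))
      (fun x : M => TangentSpace (𝓡 d) x) := isContinuousRiemannianBundle_tangent
  have h := ha.inner_bundle ha
  have h2 : (fun y => ‖a y‖) = fun y => √(Inner.inner ℝ (a y) (a y)) := by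
    funext y
    rw [real_inner_self_eq_norm_sq, Real.sqrt_sq (norm_nonneg _)]
  rw [h2]
  exact Real.continuous_sqrt.continuousAt.comp_continuousWithinAt h

end TangentNorm

/-! ### Continuous splittings over compact sets -/

section SplittingProjections

variable {d : ℕ} {M : Type*} [TopologicalSpace M] [ChartedSpace (EuclideanSpace ℝ (Fin d)) M]
  [IsManifold (𝓡 d) ∞ M]

variable (d) in
/-- The coordinates of tangent vectors at `x` in the trivialization at `x₀`. -/
noncomputable def tangentCoord (x₀ x : M) :
    TangentSpace (𝓡 d) x →L[ℝ] EuclideanSpace ℝ (Fin d) :=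
  (trivializationAt (EuclideanSpace ℝ (Fin d)) (TangentSpace (𝓡 d)) x₀).continuousLinearMapAt ℝ x

lemma tangentCoord_bijective {x₀ x : M}
    (hx : x ∈ (trivializationAt (EuclideanSpace ℝ (Fin d)) (TangentSpace (𝓡 d)) x₀).baseSet) :
    Function.Bijective (tangentCoord d x₀ x) := by
  have h := ((trivializationAt (EuclideanSpace ℝ (Fin d)) (TangentSpace (𝓡 d))
    x₀).continuousLinearEquivAt ℝ x hx).bijective
  rwa [Trivialization.coe_continuousLinearEquivAt_eq] at h

variable (d) in
lemma eventually_mem_baseSet (x₀ : M) : ∀ᶠ x in 𝓝 x₀,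
    x ∈ (trivializationAt (EuclideanSpace ℝ (Fin d)) (TangentSpace (𝓡 d)) x₀).baseSet :=
  (trivializationAt (EuclideanSpace ℝ (Fin d)) (TangentSpace (𝓡 d)) x₀).open_baseSet.mem_nhds
    (FiberBundle.mem_baseSet_trivializationAt' _)

variable {Λ : Set M} {E F : ∀ x : M, Submodule ℝ (TangentSpace (𝓡 d) x)}

/-- In the trivialization at a point, the projections onto the first bundle of a continuous
splitting form a continuous family: in continuous frames they are `L ∘ pr₁ ∘ L⁻¹`, where `L` maps
coefficients to vectors. -/
lemma exists_continuous_splitting_projection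
    (hE : IsContinuousSubbundle (fun x : M => x) Λ E)
    (hF : IsContinuousSubbundle (fun x : M => x) Λ F)
    (hinf : ∀ x ∈ Λ, E x ⊓ F x = ⊥) (hsup : ∀ x ∈ Λ, E x ⊔ F x = ⊤) {x₀ : M} (hx₀ : x₀ ∈ Λ) :
    ∃ Q : M → EuclideanSpace ℝ (Fin d) →L[ℝ] EuclideanSpace ℝ (Fin d),
      ContinuousWithinAt Q Λ x₀ ∧ ∀ᶠ x in 𝓝[Λ] x₀, ∀ a ∈ E x, ∀ b ∈ F x,
        Q x (tangentCoord d x₀ x (a + b)) = tangentCoord d x₀ x a := by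
  obtain ⟨V, hV, k, s, hs, hsE⟩ := hE x₀ hx₀
  obtain ⟨W, hW, l, u, hu, huF⟩ := hF x₀ hx₀
  let L : M → ((Fin k → ℝ) × (Fin l → ℝ)) →L[ℝ] EuclideanSpace ℝ (Fin d) := fun x =>
    (∑ i, ((ContinuousLinearMap.proj i).comp (ContinuousLinearMap.fst ℝ (Fin k → ℝ)
      (Fin l → ℝ))).smulRight (tangentCoord d x₀ x (s i x))) +
    ∑ j, ((ContinuousLinearMap.proj j).comp (ContinuousLinearMap.snd ℝ (Fin k → ℝ)
      (Fin l → ℝ))).smulRight (tangentCoord d x₀ x (u j x))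
  have hLapp : ∀ x c, L x c = tangentCoord d x₀ x (∑ i, c.1 i • s i x + ∑ j, c.2 j • u j x) := by
    intro x c
    simp [L]
  have hcont : ∀ {n : ℕ} {w : Fin n → ∀ x : M, TangentSpace (𝓡 d) x} {V : Set M}, V ∈ 𝓝 x₀ →
      (∀ i, ContinuousOn (fun x => (⟨x, w i x⟩ : TangentBundle (𝓡 d) M)) (Λ ∩ V)) →
      ∀ i, ContinuousWithinAt (fun x => tangentCoord d x₀ x (w i x)) Λ x₀ := by
    intro n w V hV hw i
    have h := (hw i x₀ ⟨hx₀, mem_of_mem_nhds hV⟩).mono_of_mem_nhdsWithin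
      (Filter.inter_mem self_mem_nhdsWithin (mem_nhdsWithin_of_mem_nhds hV))
    exact (continuousWithinAt_tangent_iff.1 h).2
  have hLc : ContinuousWithinAt L Λ x₀ := by
    rw [continuousWithinAt_clm_apply]
    intro c
    simp only [hLapp, map_add, map_sum, map_smul]
    refine ContinuousWithinAt.add ?_ ?_
    · exact tendsto_finsetSum _ fun i _ => (hcont hV hs i).const_smul (c.1 i)
    · exact tendsto_finsetSum _ fun i _ => (hcont hW hu i).const_smul (c.2 i)
  have hinv : ∀ x ∈ Λ, x ∈ V → x ∈ W →
      x ∈ (trivializationAt (EuclideanSpace ℝ (Fin d)) (TangentSpace (𝓡 d)) x₀).baseSet →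
      (L x).IsInvertible := by
    intro x hx hxV hxW hxb
    have hb := tangentCoord_bijective hxb
    have hmemE : ∀ c : Fin k → ℝ, ∑ i, c i • s i x ∈ E x := fun c => by
      rw [← (hsE x ⟨hx, hxV⟩).2]
      exact Submodule.sum_mem _ fun i _ => Submodule.smul_mem _ _ (Submodule.subset_span ⟨i, rfl⟩)
    have hmemF : ∀ c : Fin l → ℝ, ∑ i, c i • u i x ∈ F x := fun c => by
      rw [← (huF x ⟨hx, hxW⟩).2]
      exact Submodule.sum_mem _ fun i _ => Submodule.smul_mem _ _ (Submodule.subset_span ⟨i, rfl⟩)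
    have hinj : Function.Injective (L x) := by
      rw [injective_iff_map_eq_zero]
      intro c hc
      rw [hLapp] at hc
      have h0 := (injective_iff_map_eq_zero _).1 hb.1 _ hc
      have h1 : ∑ i, c.1 i • s i x ∈ E x ⊓ F x := by
        refine ⟨hmemE _, ?_⟩
        rw [eq_neg_of_add_eq_zero_left h0]
        exact Submodule.neg_mem _ (hmemF _)
      rw [hinf x hx, Submodule.mem_bot] at h1
      rw [h1, zero_add] at h0
      have h2 := Fintype.linearIndependent_iff.1 (hsE x ⟨hx, hxV⟩).1 _ h1
      have h3 := Fintype.linearIndependent_iff.1 (huF x ⟨hx, hxW⟩).1 _ h0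
      exact Prod.ext (funext h2) (funext h3)
    have hsurj : Function.Surjective (L x) := by
      intro y
      obtain ⟨v, rfl⟩ := hb.2 y
      have hv : v ∈ E x ⊔ F x := by rw [hsup x hx]; trivial
      obtain ⟨a, ha, b, hb, rfl⟩ := Submodule.mem_sup.1 hv
      rw [← (hsE x ⟨hx, hxV⟩).2] at ha
      rw [← (huF x ⟨hx, hxW⟩).2] at hb
      obtain ⟨c, rfl⟩ := (Submodule.mem_span_range_iff_exists_fun ℝ).1 ha
      obtain ⟨c', rfl⟩ := (Submodule.mem_span_range_iff_exists_fun ℝ).1 hb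
      exact ⟨(c, c'), hLapp x (c, c')⟩
    exact ⟨(LinearEquiv.ofBijective (L x).toLinearMap ⟨hinj, hsurj⟩).toContinuousLinearEquiv,
      by ext <;> rfl⟩
  refine ⟨fun x => (L x ∘L (ContinuousLinearMap.inl ℝ (Fin k → ℝ) (Fin l → ℝ) ∘L
    ContinuousLinearMap.fst ℝ (Fin k → ℝ) (Fin l → ℝ))) ∘L (L x).inverse, ?_, ?_⟩
  · have h0 := hinv x₀ hx₀ (mem_of_mem_nhds hV) (mem_of_mem_nhds hW)
      (FiberBundle.mem_baseSet_trivializationAt' _)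
    have h1 : ContinuousWithinAt (fun x => (L x).inverse) Λ x₀ :=
      (h0.contDiffAt_map_inverse (n := 0)).continuousAt.comp_continuousWithinAt hLc
    exact (hLc.clm_comp continuousWithinAt_const).clm_comp h1
  · filter_upwards [self_mem_nhdsWithin, mem_nhdsWithin_of_mem_nhds hV,
      mem_nhdsWithin_of_mem_nhds hW, mem_nhdsWithin_of_mem_nhds (eventually_mem_baseSet d x₀)]
      with x hx hxV hxW hxb a ha b hb
    rw [← (hsE x ⟨hx, hxV⟩).2] at ha
    rw [← (huF x ⟨hx, hxW⟩).2] at hb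
    obtain ⟨c, rfl⟩ := (Submodule.mem_span_range_iff_exists_fun ℝ).1 ha
    obtain ⟨c', rfl⟩ := (Submodule.mem_span_range_iff_exists_fun ℝ).1 hb
    have h1 := hLapp x (c, c')
    simp only at h1
    rw [← h1]
    simp only [ContinuousLinearMap.comp_apply]
    rw [(hinv x hx hxV hxW hxb).inverse_apply_self]
    simp [hLapp]

/-- The second bundle of a continuous splitting is closed over the set where the splitting is
defined: it is the kernel of the continuous projections onto the first bundle. -/
lemma mem_of_mem_closure_of_splitting
    (hE : IsContinuousSubbundle (fun x : M => x) Λ E)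
    (hF : IsContinuousSubbundle (fun x : M => x) Λ F)
    (hinf : ∀ x ∈ Λ, E x ⊓ F x = ⊥) (hsup : ∀ x ∈ Λ, E x ⊔ F x = ⊤)
    {A : Set (TangentBundle (𝓡 d) M)} (hA : ∀ e ∈ A, e.proj ∈ Λ ∧ e.2 ∈ F e.proj)
    {e : TangentBundle (𝓡 d) M} (he : e ∈ closure A) (heΛ : e.proj ∈ Λ) : e.2 ∈ F e.proj := by
  obtain ⟨Q, hQ, hQ'⟩ := exists_continuous_splitting_projection hE hF hinf hsup heΛ
  have hv : e.2 ∈ E e.proj ⊔ F e.proj := by rw [hsup _ heΛ]; trivial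
  obtain ⟨a, ha, b, hb, hab⟩ := Submodule.mem_sup.1 hv
  have hp : ContinuousWithinAt (fun e : TangentBundle (𝓡 d) M => e.proj) A e :=
    (FiberBundle.continuous_proj _ _).continuousWithinAt
  have hcoord : ContinuousWithinAt (fun e' : TangentBundle (𝓡 d) M =>
      tangentCoord d e.proj e'.proj e'.2) A e :=
    (continuousWithinAt_tangent_iff.1 (continuousWithinAt_id (s := A) (x := e))).2
  have hpt : Filter.Tendsto (fun e : TangentBundle (𝓡 d) M => e.proj) (𝓝[A] e) (𝓝[Λ] e.proj) :=
    tendsto_nhdsWithin_iff.2 ⟨hp, by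
      filter_upwards [self_mem_nhdsWithin] with e' he' using (hA e' he').1⟩
  have hlim : Filter.Tendsto (fun e' : TangentBundle (𝓡 d) M =>
      Q e'.proj (tangentCoord d e.proj e'.proj e'.2)) (𝓝[A] e)
      (𝓝 (Q e.proj (tangentCoord d e.proj e.proj e.2))) :=
    (isBoundedBilinearMap_apply.continuous.tendsto
      (Q e.proj, tangentCoord d e.proj e.proj e.2)).comp
      ((Filter.Tendsto.comp (g := Q) (x := 𝓝[A] e)
        (f := fun e' : TangentBundle (𝓡 d) M => e'.proj) hQ hpt).prodMk_nhds hcoord)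
  have hzero : ∀ᶠ e' in 𝓝[A] e, Q e'.proj (tangentCoord d e.proj e'.proj e'.2) = 0 := by
    filter_upwards [hpt.eventually hQ', self_mem_nhdsWithin] with e' h1 h2
    have h3 := h1 0 (Submodule.zero_mem _) e'.2 (hA e' h2).2
    rwa [zero_add, map_zero] at h3
  have : (𝓝[A] e).NeBot := mem_closure_iff_nhdsWithin_neBot.1 he
  have h0 := tendsto_nhds_unique (hlim.congr' hzero) tendsto_const_nhds
  have h1 := hQ'.self_of_nhdsWithin heΛ a ha b hb
  rw [hab, h0] at h1
  have h2 := (injective_iff_map_eq_zero _).1 (tangentCoord_bijective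
    (FiberBundle.mem_baseSet_trivializationAt' e.proj)).1 a h1.symm
  rw [← hab, h2, zero_add]
  exact hb

variable [RiemannianBundle (fun x : M => TangentSpace (𝓡 d) x)]
  [IsContMDiffRiemannianBundle (𝓡 d) ∞ (EuclideanSpace ℝ (Fin d))
      (fun x : M => TangentSpace (𝓡 d) x)]

/-- The angle between the bundles of a continuous splitting over a compact set is bounded below. -/
lemma exists_norm_le_mul_norm_add
    (hE : IsContinuousSubbundle (fun x : M => x) Λ E)
    (hF : IsContinuousSubbundle (fun x : M => x) Λ F)
    (hinf : ∀ x ∈ Λ, E x ⊓ F x = ⊥) (hsup : ∀ x ∈ Λ, E x ⊔ F x = ⊤) (hΛ : IsCompact Λ) :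
    ∃ K : ℝ, 1 ≤ K ∧ ∀ x ∈ Λ, ∀ a ∈ E x, ∀ b ∈ F x, ‖a‖ ≤ K * ‖a + b‖ := by
  have : IsContinuousRiemannianBundle (EuclideanSpace ℝ (Fin d))
      (fun x : M => TangentSpace (𝓡 d) x) := isContinuousRiemannianBundle_tangent
  have key : ∃ K : ℝ, 1 ≤ K ∧ ∀ x ∈ Λ, x ∈ Λ → ∀ a ∈ E x, ∀ b ∈ F x, ‖a‖ ≤ K * ‖a + b‖ := by
    refine hΛ.induction_on (p := fun S => ∃ K : ℝ, 1 ≤ K ∧ ∀ x ∈ S, x ∈ Λ →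
      ∀ a ∈ E x, ∀ b ∈ F x, ‖a‖ ≤ K * ‖a + b‖) ⟨1, le_rfl, by simp⟩ ?_ ?_ ?_
    · rintro S T hST ⟨K, hK, h⟩
      exact ⟨K, hK, fun x hx => h x (hST hx)⟩
    · rintro S T ⟨K, hK, h⟩ ⟨K', hK', h'⟩
      refine ⟨max K K', hK.trans (le_max_left _ _), ?_⟩
      rintro x (hx | hx) hxΛ a ha b hb
      · exact (h x hx hxΛ a ha b hb).trans
          (mul_le_mul_of_nonneg_right (le_max_left _ _) (norm_nonneg _))
      · exact (h' x hx hxΛ a ha b hb).trans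
          (mul_le_mul_of_nonneg_right (le_max_right _ _) (norm_nonneg _))
    · intro x₀ hx₀
      obtain ⟨Q, hQ, hQ'⟩ := exists_continuous_splitting_projection hE hF hinf hsup hx₀
      obtain ⟨C₁, hC₁, h₁⟩ := eventually_norm_trivializationAt_lt (EuclideanSpace ℝ (Fin d))
        (fun x : M => TangentSpace (𝓡 d) x) x₀
      obtain ⟨C₂, hC₂, h₂⟩ := eventually_norm_symmL_trivializationAt_lt (EuclideanSpace ℝ (Fin d))
        (fun x : M => TangentSpace (𝓡 d) x) x₀
      have h₃ : ∀ᶠ x in 𝓝[Λ] x₀, ‖Q x‖ < ‖Q x₀‖ + 1 :=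
        hQ.norm.eventually (gt_mem_nhds (lt_add_one _))
      refine ⟨_, Filter.inter_mem (Filter.inter_mem hQ' h₃) (mem_nhdsWithin_of_mem_nhds
        (Filter.inter_mem (Filter.inter_mem h₁ h₂) (eventually_mem_baseSet d x₀))),
        max 1 (C₂ * ((‖Q x₀‖ + 1) * C₁)), le_max_left _ _, ?_⟩
      rintro x ⟨⟨hxQ, hx₃⟩, ⟨hx₁, hx₂⟩, hxb⟩ - a ha b hb
      have e1 : a = (trivializationAt (EuclideanSpace ℝ (Fin d)) (TangentSpace (𝓡 d)) x₀).symmL ℝ x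
          (Q x (tangentCoord d x₀ x (a + b))) := by
        rw [hxQ a ha b hb]
        exact ((trivializationAt (EuclideanSpace ℝ (Fin d)) (TangentSpace (𝓡 d))
          x₀).symmL_continuousLinearMapAt hxb a).symm
      have e2 : ‖tangentCoord d x₀ x (a + b)‖ ≤ C₁ * ‖a + b‖ :=
        (ContinuousLinearMap.le_opNorm _ _).trans
          (mul_le_mul_of_nonneg_right hx₁.le (norm_nonneg _))
      have e3 : ‖Q x (tangentCoord d x₀ x (a + b))‖ ≤ (‖Q x₀‖ + 1) * (C₁ * ‖a + b‖) :=
        ((Q x).le_opNorm _).trans (mul_le_mul hx₃.le e2 (norm_nonneg _) (by positivity))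
      have e4 : ‖a‖ ≤ C₂ * ((‖Q x₀‖ + 1) * (C₁ * ‖a + b‖)) := by
        conv_lhs => rw [e1]
        exact (ContinuousLinearMap.le_opNorm _ _).trans
          (mul_le_mul hx₂.le e3 (norm_nonneg _) hC₂.le)
      refine e4.trans ?_
      rw [← mul_assoc (‖Q x₀‖ + 1), ← mul_assoc C₂]
      exact mul_le_mul_of_nonneg_right (le_max_right _ _) (norm_nonneg _)
  obtain ⟨K, hK, h⟩ := key
  exact ⟨K, hK, fun x hx => h x hx hx⟩

end SplittingProjections

/-! ### The extended set -/

section ExtendedSet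

variable {d : ℕ} {M : Type*} [TopologicalSpace M] [ChartedSpace (EuclideanSpace ℝ (Fin d)) M]
  [RiemannianBundle (fun x : M => TangentSpace (𝓡 d) x)]

lemma norm_apply_le_restrNorm {x y : M} (A : TangentSpace (𝓡 d) x →L[ℝ] TangentSpace (𝓡 d) y)
    {S : Submodule ℝ (TangentSpace (𝓡 d) x)} {v : TangentSpace (𝓡 d) x} (hv : v ∈ S) :
    ‖A v‖ ≤ restrNorm A S * ‖v‖ :=
  (A.comp S.subtypeL).le_opNorm ⟨v, hv⟩

lemma restrNorm_le {x y : M} {A : TangentSpace (𝓡 d) x →L[ℝ] TangentSpace (𝓡 d) y}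
    {S : Submodule ℝ (TangentSpace (𝓡 d) x)} {c : ℝ} (hc : 0 ≤ c) (h : ∀ v ∈ S, ‖A v‖ ≤ c * ‖v‖) :
    restrNorm A S ≤ c :=
  (A.comp S.subtypeL).opNorm_le_bound hc fun v => h v v.2

lemma restrNorm_nonneg {x y : M} (A : TangentSpace (𝓡 d) x →L[ℝ] TangentSpace (𝓡 d) y)
    (S : Submodule ℝ (TangentSpace (𝓡 d) x)) : 0 ≤ restrNorm A S :=
  norm_nonneg (A.comp S.subtypeL)

/-- The Riemannian norm on a tangent space is equivalent to the norm of the model space. -/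
lemma exists_norm_le_mul_norm_model (x : M) : ∃ κ > 0, ∀ v : EuclideanSpace ℝ (Fin d),
    ‖v‖ ≤ κ * ‖(show TangentSpace (𝓡 d) x from v)‖ ∧
      ‖(show TangentSpace (𝓡 d) x from v)‖ ≤ κ * ‖v‖ := by
  let A : TangentSpace (𝓡 d) x →L[ℝ] EuclideanSpace ℝ (Fin d) :=
    ⟨⟨⟨fun v => v, fun _ _ => rfl⟩, fun _ _ => rfl⟩, continuous_id⟩
  let B : EuclideanSpace ℝ (Fin d) →L[ℝ] TangentSpace (𝓡 d) x :=
    ⟨⟨⟨fun v => v, fun _ _ => rfl⟩, fun _ _ => rfl⟩, continuous_id⟩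
  refine ⟨‖A‖ + ‖B‖ + 1, by positivity, fun v => ⟨?_, ?_⟩⟩
  · refine (A.le_opNorm v).trans (mul_le_mul_of_nonneg_right ?_ (norm_nonneg _))
    linarith [norm_nonneg B]
  · refine (B.le_opNorm v).trans (mul_le_mul_of_nonneg_right ?_ (norm_nonneg _))
    linarith [norm_nonneg A]

variable {X : ∀ x : M, TangentSpace (𝓡 d) x} {φ : ℝ → M → M} {Λ : Set M}

lemma norm_unitDir {x : M} (hx : x ∉ singSet X) : ‖(unitDir X x).2‖ = 1 := by
  have h : ‖X x‖ ≠ 0 := norm_ne_zero_iff.2 hx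
  change ‖‖X x‖⁻¹ • X x‖ = 1
  rw [norm_smul, norm_inv, norm_norm, inv_mul_cancel₀ h]

lemma restrNorm_tangentFlow_span_field_le {t : ℝ} {x : M} (hx : x ∉ singSet X) :
    restrNorm (tangentFlow φ t x) (ℝ ∙ X x) ≤
      ‖tangentFlow φ t (unitDir X x).proj (unitDir X x).2‖ := by
  refine restrNorm_le (norm_nonneg _) fun v hv => ?_
  obtain ⟨a, rfl⟩ := Submodule.mem_span_singleton.1 hv
  have h0 : ‖X x‖ ≠ 0 := norm_ne_zero_iff.2 hx
  change _ ≤ ‖tangentFlow φ t x (‖X x‖⁻¹ • X x)‖ * ‖a • X x‖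
  rw [map_smul, map_smul, norm_smul, norm_smul, norm_smul, norm_inv, norm_norm]
  refine le_of_eq ?_
  field_simp

variable [IsManifold (𝓡 d) ∞ M]

lemma unitDir_mem_extendedSet {x : M} (hx : x ∈ Λ \ singSet X) :
    unitDir X x ∈ extendedSet X Λ := subset_closure ⟨x, hx, rfl⟩

section Flow

variable [T2Space M]

lemma proj_mem_of_mem_extendedSet (hΛ : IsCompact Λ) {e : TangentBundle (𝓡 d) M}
    (he : e ∈ extendedSet X Λ) : e.proj ∈ Λ := by
  have hcl : IsClosed {e : TangentBundle (𝓡 d) M | e.proj ∈ Λ} :=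
    hΛ.isClosed.preimage (FiberBundle.continuous_proj _ _)
  refine closure_minimal ?_ hcl he
  rintro _ ⟨x, hx, rfl⟩
  exact hx.1

variable [CompactSpace M]

lemma tangentFlow_ne_zero
    (hX : ContMDiff (𝓡 d) (𝓡 d).tangent 1 (fun x => (⟨x, X x⟩ : TangentBundle (𝓡 d) M)))
    (hφ : IsFlowOf φ X) (t : ℝ) {x : M} {v : TangentSpace (𝓡 d) x} (hv : v ≠ 0) :
    tangentFlow φ t x v ≠ 0 := by
  intro h
  have h1 := bundleFlow_add hX hφ t (-t) ⟨x, v⟩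
  rw [add_neg_cancel, bundleFlow_zero hφ] at h1
  have h2 := congrArg (fun e : TangentBundle (𝓡 d) M => ‖e.2‖) h1
  have h3 : ‖v‖ = ‖tangentFlow φ (-t) (φ t x) (tangentFlow φ t x v)‖ := h2
  rw [h, map_zero, norm_zero] at h3
  exact hv (norm_eq_zero.1 h3)

lemma field_flow_ne_zero
    (hX : ContMDiff (𝓡 d) (𝓡 d).tangent 1 (fun x => (⟨x, X x⟩ : TangentBundle (𝓡 d) M)))
    (hφ : IsFlowOf φ X) (t : ℝ) {x : M} (hx : x ∉ singSet X) : φ t x ∉ singSet X := by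
  intro h
  have h1 := tangentFlow_ne_zero hX hφ t hx
  rw [tangentFlow_apply_field hX hφ] at h1
  exact h1 h

lemma sphereFlow_unitDir
    (hX : ContMDiff (𝓡 d) (𝓡 d).tangent 1 (fun x => (⟨x, X x⟩ : TangentBundle (𝓡 d) M)))
    (hφ : IsFlowOf φ X) (t : ℝ) {x : M} (hx : x ∉ singSet X) :
    sphereFlow φ t (unitDir X x) = unitDir X (φ t x) := by
  have h0 : ‖X x‖ ≠ 0 := norm_ne_zero_iff.2 hx
  have h : tangentFlow φ t x (‖X x‖⁻¹ • X x) = ‖X x‖⁻¹ • X (φ t x) := by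
    rw [map_smul, tangentFlow_apply_field hX hφ]
  have h2 : ‖tangentFlow φ t x (‖X x‖⁻¹ • X x)‖⁻¹ • tangentFlow φ t x (‖X x‖⁻¹ • X x) =
      ‖X (φ t x)‖⁻¹ • X (φ t x) := by
    rw [h, norm_smul, norm_inv, norm_norm, smul_smul, mul_inv, inv_inv, mul_right_comm,
      mul_inv_cancel₀ h0, one_mul]
  exact congrArg (fun v => (⟨φ t x, v⟩ : TangentBundle (𝓡 d) M)) h2

lemma norm_tangentFlow_unitDir
    (hX : ContMDiff (𝓡 d) (𝓡 d).tangent 1 (fun x => (⟨x, X x⟩ : TangentBundle (𝓡 d) M)))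
    (hφ : IsFlowOf φ X) (t : ℝ) (x : M) :
    ‖tangentFlow φ t (unitDir X x).proj (unitDir X x).2‖ = ‖X (φ t x)‖ / ‖X x‖ := by
  change ‖tangentFlow φ t x (‖X x‖⁻¹ • X x)‖ = _
  rw [map_smul, tangentFlow_apply_field hX hφ, norm_smul, norm_inv, norm_norm, div_eq_inv_mul]

end Flow

variable [IsContMDiffRiemannianBundle (𝓡 d) ∞ (EuclideanSpace ℝ (Fin d))
      (fun x : M => TangentSpace (𝓡 d) x)]

lemma continuous_norm_tangentBundle : Continuous fun e : TangentBundle (𝓡 d) M => ‖e.2‖ := by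
  rw [← continuousOn_univ]
  exact fun e _ => ContinuousWithinAt.tangent_norm (continuousWithinAt_id (s := univ) (x := e))

lemma continuous_norm_field
    (hX : ContMDiff (𝓡 d) (𝓡 d).tangent 1 (fun x => (⟨x, X x⟩ : TangentBundle (𝓡 d) M))) :
    Continuous fun x => ‖X x‖ :=
  continuous_norm_tangentBundle.comp hX.continuous

lemma norm_eq_one_of_mem_extendedSet {e : TangentBundle (𝓡 d) M}
    (he : e ∈ extendedSet X Λ) : ‖e.2‖ = 1 := by
  have hcl : IsClosed {e : TangentBundle (𝓡 d) M | ‖e.2‖ = 1} :=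
    isClosed_eq continuous_norm_tangentBundle continuous_const
  refine closure_minimal ?_ hcl he
  rintro _ ⟨x, hx, rfl⟩
  exact norm_unitDir hx.2

/-- Over a regular point of `Λ`, the extended set contains only the direction of the field. -/
lemma norm_smul_eq_field_of_mem_extendedSet
    (hX : ContMDiff (𝓡 d) (𝓡 d).tangent 1 (fun x => (⟨x, X x⟩ : TangentBundle (𝓡 d) M)))
    {e : TangentBundle (𝓡 d) M} (he : e ∈ extendedSet X Λ) : ‖X e.proj‖ • e.2 = X e.proj := by
  have hp : Continuous fun e : TangentBundle (𝓡 d) M => e.proj := FiberBundle.continuous_proj _ _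
  have hc : Continuous fun e : TangentBundle (𝓡 d) M => ‖‖X e.proj‖ • e.2 - X e.proj‖ := by
    rw [← continuousOn_univ]
    refine fun e _ => ContinuousWithinAt.tangent_norm (ContinuousWithinAt.tangent_sub
      (ContinuousWithinAt.tangent_smul ?_ ?_) ?_)
    · exact ((continuous_norm_field hX).comp hp).continuousWithinAt
    · exact continuousWithinAt_id
    · exact (hX.continuous.comp hp).continuousWithinAt
  have hcl : IsClosed {e : TangentBundle (𝓡 d) M | ‖‖X e.proj‖ • e.2 - X e.proj‖ = 0} :=
    isClosed_eq hc continuous_const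
  have h := closure_minimal (s := unitDir X '' (Λ \ singSet X)) ?_ hcl he
  · exact sub_eq_zero.1 (norm_eq_zero.1 h)
  · rintro _ ⟨x, hx, rfl⟩
    have h : ‖X x‖ ≠ 0 := norm_ne_zero_iff.2 hx.2
    change ‖‖X x‖ • (‖X x‖⁻¹ • X x) - X x‖ = 0
    rw [smul_smul, mul_inv_cancel₀ h, one_smul, sub_self, norm_zero]

lemma eq_unitDir_of_mem_extendedSet
    (hX : ContMDiff (𝓡 d) (𝓡 d).tangent 1 (fun x => (⟨x, X x⟩ : TangentBundle (𝓡 d) M)))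
    {e : TangentBundle (𝓡 d) M} (he : e ∈ extendedSet X Λ) (hs : e.proj ∉ singSet X) :
    e = unitDir X e.proj := by
  have h0 : ‖X e.proj‖ ≠ 0 := norm_ne_zero_iff.2 hs
  have h : e.2 = ‖X e.proj‖⁻¹ • X e.proj := by
    conv_rhs => rw [← norm_smul_eq_field_of_mem_extendedSet hX he]
    rw [norm_smul, norm_norm, norm_eq_one_of_mem_extendedSet he, mul_one, smul_smul,
      inv_mul_cancel₀ h0, one_smul]
  exact congrArg (fun v => (⟨e.proj, v⟩ : TangentBundle (𝓡 d) M)) h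

variable [T2Space M] [CompactSpace M]

lemma sphereFlow_mem_extendedSet
    (hX : ContMDiff (𝓡 d) (𝓡 d).tangent 1 (fun x => (⟨x, X x⟩ : TangentBundle (𝓡 d) M)))
    (hφ : IsFlowOf φ X) (hinv : IsInvariant φ Λ) (t : ℝ) {e : TangentBundle (𝓡 d) M}
    (he : e ∈ extendedSet X Λ) : sphereFlow φ t e ∈ extendedSet X Λ := by
  have hb : Continuous fun e : TangentBundle (𝓡 d) M =>
      (⟨φ t e.proj, tangentFlow φ t e.proj e.2⟩ : TangentBundle (𝓡 d) M) :=
    (continuous_bundleFlow hX hφ).comp (continuous_const.prodMk continuous_id)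
  have hne : ‖tangentFlow φ t e.proj e.2‖ ≠ 0 := by
    refine norm_ne_zero_iff.2 (tangentFlow_ne_zero hX hφ t fun h => ?_)
    have := norm_eq_one_of_mem_extendedSet he
    rw [h, norm_zero] at this
    exact zero_ne_one this
  have hc : ContinuousWithinAt (sphereFlow φ t) (unitDir X '' (Λ \ singSet X)) e :=
    ContinuousWithinAt.tangent_smul
      ((ContinuousWithinAt.tangent_norm hb.continuousWithinAt).inv₀ hne) hb.continuousWithinAt
  refine hc.mem_closure he ?_
  rintro _ ⟨x, hx, rfl⟩
  rw [sphereFlow_unitDir hX hφ t hx.2]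
  exact ⟨φ t x, ⟨hinv t hx.1, field_flow_ne_zero hX hφ t hx.2⟩, rfl⟩

/-- Along a positively singular hyperbolic set the field lies in the area expanding bundle: its
component in the contracted bundle would grow without bound in the past. -/
lemma field_mem_right
    (hX : ContMDiff (𝓡 d) (𝓡 d).tangent 1 (fun x => (⟨x, X x⟩ : TangentBundle (𝓡 d) M)))
    (hφ : IsFlowOf φ X) (hΛ : IsCompact Λ) (hinv : IsInvariant φ Λ)
    {E F : ∀ x : M, Submodule ℝ (TangentSpace (𝓡 d) x)} {C r : ℝ}
    (h : IsPosSingularHyperbolicWith φ X Λ E F C r) {x : M} (hx : x ∈ Λ) : X x ∈ F x := by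
  obtain ⟨K, hK, hang⟩ := exists_norm_le_mul_norm_add h.splitting.continuous_left
    h.splitting.continuous_right h.splitting.inf_eq h.splitting.sup_eq hΛ
  obtain ⟨B, hB⟩ := isCompact_univ.exists_bound_of_continuousOn
    (continuous_norm_field hX).continuousOn
  have hv : X x ∈ E x ⊔ F x := by rw [h.splitting.sup_eq x hx]; trivial
  obtain ⟨a, ha, b, hb, hab⟩ := Submodule.mem_sup.1 hv
  have hbound : ∀ t > 0, ‖a‖ ≤ C * Real.exp (-r * t) * (K * B) := by
    intro t ht
    have hy : φ (-t) x ∈ Λ := hinv (-t) hx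
    have ha' : tangentFlow φ (-t) x a ∈ E (φ (-t) x) := by
      rw [← h.splitting.map_left x hx (-t)]; exact ⟨a, ha, rfl⟩
    have hb' : tangentFlow φ (-t) x b ∈ F (φ (-t) x) := by
      rw [← h.splitting.map_right x hx (-t)]; exact ⟨b, hb, rfl⟩
    have h1 : ‖tangentFlow φ (-t) x a‖ ≤ K * B := by
      refine (hang _ hy _ ha' _ hb').trans ?_
      rw [← map_add, hab, tangentFlow_apply_field hX hφ]
      have := hB (φ (-t) x) trivial
      rw [norm_norm] at this
      exact mul_le_mul_of_nonneg_left this (by linarith)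
    have h2 := bundleFlow_add hX hφ (-t) t ⟨x, a⟩
    rw [neg_add_cancel, bundleFlow_zero hφ] at h2
    have h3 : ‖a‖ = ‖tangentFlow φ t (φ (-t) x) (tangentFlow φ (-t) x a)‖ :=
      congrArg (fun e : TangentBundle (𝓡 d) M => ‖e.2‖) h2
    rw [h3]
    refine (norm_apply_le_restrNorm _ ha').trans ?_
    exact mul_le_mul (h.contracting _ hy t ht).le h1 (norm_nonneg _)
      (mul_nonneg (by linarith [h.one_lt]) (Real.exp_pos _).le)
  have hlim : Filter.Tendsto (fun t : ℝ => C * Real.exp (-r * t) * (K * B)) Filter.atTop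
      (𝓝 (C * 0 * (K * B))) := by
    refine (Filter.Tendsto.const_mul C ?_).mul_const _
    refine Real.tendsto_exp_atBot.comp ?_
    exact Filter.tendsto_id.const_mul_atTop_of_neg (neg_lt_zero.2 h.pos)
  have h0 : ‖a‖ ≤ C * 0 * (K * B) := ge_of_tendsto hlim
    ((Filter.eventually_gt_atTop 0).mono hbound)
  have h1 : a = 0 := norm_le_zero_iff.1 (by simpa using h0)
  rw [← hab, h1, zero_add]
  exact hb

lemma mem_right_of_mem_extendedSet
    (hX : ContMDiff (𝓡 d) (𝓡 d).tangent 1 (fun x => (⟨x, X x⟩ : TangentBundle (𝓡 d) M)))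
    (hφ : IsFlowOf φ X) (hΛ : IsCompact Λ) (hinv : IsInvariant φ Λ)
    {E F : ∀ x : M, Submodule ℝ (TangentSpace (𝓡 d) x)} {C r : ℝ}
    (h : IsPosSingularHyperbolicWith φ X Λ E F C r) {e : TangentBundle (𝓡 d) M}
    (he : e ∈ extendedSet X Λ) : e.2 ∈ F e.proj := by
  refine mem_of_mem_closure_of_splitting h.splitting.continuous_left
    h.splitting.continuous_right h.splitting.inf_eq h.splitting.sup_eq
    (A := unitDir X '' (Λ \ singSet X)) ?_ he (proj_mem_of_mem_extendedSet hΛ he)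
  rintro _ ⟨x, hx, rfl⟩
  exact ⟨hx.1, Submodule.smul_mem _ _ (field_mem_right hX hφ hΛ hinv h hx.1)⟩

end ExtendedSet

/-! ### Normal projections -/

section FrameAlgebra

variable {V W : Type*} [AddCommGroup V] [Module ℝ V] [AddCommGroup W] [Module ℝ W]

/-- If `v = ∑ cᵢ sᵢ` with `c_{i₀} ≠ 0` and the `sᵢ` are independent, then `v` and the `sᵢ` with
`i ≠ i₀` are independent. -/
lemma linearIndependent_cons_succAbove {n : ℕ} {s : Fin (n + 1) → V} (hs : LinearIndependent ℝ s)
    {c : Fin (n + 1) → ℝ} {i₀ : Fin (n + 1)} (hc : c i₀ ≠ 0) :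
    LinearIndependent ℝ (Fin.cons (∑ i, c i • s i) (fun j => s (i₀.succAbove j)) :
      Fin (n + 1) → V) := by
  rw [linearIndependent_finCons]
  refine ⟨hs.comp _ Fin.succAbove_right_injective, fun hmem => hc ?_⟩
  obtain ⟨a, ha⟩ := (Submodule.mem_span_range_iff_exists_fun ℝ).1 hmem
  have h0 : ∑ i, (c i - (i₀.insertNth 0 a : Fin (n + 1) → ℝ) i) • s i = 0 := by
    simp only [sub_smul, Finset.sum_sub_distrib]
    rw [sub_eq_zero, ← ha, Fin.sum_univ_succAbove (fun i => (i₀.insertNth 0 a :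
      Fin (n + 1) → ℝ) i • s i) i₀]
    simp
  have h1 := Fintype.linearIndependent_iff.1 hs _ h0 i₀
  simpa using h1

/-- A linear map with kernel spanned by the first vector of an independent family maps the other
vectors to an independent family, with the same span as the image of the whole family. -/
lemma linearIndependent_and_span_map_tail {n : ℕ} {w : V} {s : Fin n → V}
    (h : LinearIndependent ℝ (Fin.cons w s : Fin (n + 1) → V)) (A : V →ₗ[ℝ] W) (hw : A w = 0)
    (hker : ∀ v, A v = 0 → v ∈ Submodule.span ℝ {w}) :
    LinearIndependent ℝ (fun i => A (s i)) ∧ Submodule.span ℝ (range fun i => A (s i)) =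
      (Submodule.span ℝ (range (Fin.cons w s : Fin (n + 1) → V))).map A := by
  refine ⟨?_, ?_⟩
  · rw [Fintype.linearIndependent_iff]
    intro g hg
    have h1 : A (∑ i, g i • s i) = 0 := by simpa using hg
    obtain ⟨a, ha⟩ := Submodule.mem_span_singleton.1 (hker _ h1)
    have h2 : ∑ i, (Fin.cons (-a) g : Fin (n + 1) → ℝ) i •
        (Fin.cons w s : Fin (n + 1) → V) i = 0 := by
      rw [Fin.sum_univ_succ]
      simp [ha]
    intro i
    simpa using Fintype.linearIndependent_iff.1 h _ h2 i.succ
  · rw [Submodule.map_span]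
    refine le_antisymm (Submodule.span_mono ?_) (Submodule.span_le.2 ?_)
    · rintro _ ⟨i, rfl⟩
      exact ⟨_, ⟨i.succ, rfl⟩, by simp⟩
    · rintro _ ⟨_, ⟨i, rfl⟩, rfl⟩
      refine Fin.cases ?_ (fun j => ?_) i
      · simp [hw]
      · exact Submodule.subset_span ⟨j, by simp⟩

end FrameAlgebra

section NormalProjection

variable {d : ℕ} {M : Type*} [TopologicalSpace M] [ChartedSpace (EuclideanSpace ℝ (Fin d)) M]
  [RiemannianBundle (fun x : M => TangentSpace (𝓡 d) x)] {x : M}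

lemma normalProj_apply (w v : TangentSpace (𝓡 d) x) :
    normalProj x w v = v - ((‖w‖ ^ 2)⁻¹ * inner ℝ w v) • w := rfl

lemma normalProj_smul {c : ℝ} (hc : c ≠ 0) (w : TangentSpace (𝓡 d) x) :
    normalProj x (c • w) = normalProj x w := by
  ext1 v
  rw [normalProj_apply, normalProj_apply, norm_smul, inner_smul_left, smul_smul, mul_pow,
    Real.norm_eq_abs, sq_abs]
  congr 2
  simp only [conj_trivial]
  rcases eq_or_ne (‖w‖ ^ 2) 0 with h | h
  · simp [h]
  · field_simp

lemma normalProj_self (w : TangentSpace (𝓡 d) x) : normalProj x w w = 0 := by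
  rcases eq_or_ne w 0 with rfl | h
  · exact map_zero _
  · have h1 : ‖w‖ ^ 2 ≠ 0 := pow_ne_zero 2 (norm_ne_zero_iff.2 h)
    rw [normalProj_apply, real_inner_self_eq_norm_sq, inv_mul_cancel₀ h1, one_smul, sub_self]

lemma mem_span_of_normalProj_eq_zero {w v : TangentSpace (𝓡 d) x} (h : normalProj x w v = 0) :
    v ∈ Submodule.span ℝ {w} := by
  rw [normalProj_apply, sub_eq_zero] at h
  rw [h]
  exact Submodule.smul_mem _ _ (Submodule.mem_span_singleton_self w)

lemma sub_normalProj_mem_span (w v : TangentSpace (𝓡 d) x) :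
    v - normalProj x w v ∈ Submodule.span ℝ {w} := by
  rw [normalProj_apply, sub_sub_cancel]
  exact Submodule.smul_mem _ _ (Submodule.mem_span_singleton_self w)

lemma inner_normalProj {w : TangentSpace (𝓡 d) x} (hw : w ≠ 0) (v : TangentSpace (𝓡 d) x) :
    inner ℝ w (normalProj x w v) = 0 := by
  have h1 : ‖w‖ ^ 2 ≠ 0 := pow_ne_zero 2 (norm_ne_zero_iff.2 hw)
  rw [normalProj_apply, inner_sub_right, inner_smul_right, real_inner_self_eq_norm_sq,
    mul_comm (‖w‖ ^ 2)⁻¹, inv_mul_cancel_right₀ h1, sub_self]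

lemma normalProj_eq_self_of_mem {w v : TangentSpace (𝓡 d) x} (h : v ∈ normalSpace x w) :
    normalProj x w v = v := by
  rw [normalProj_apply, Submodule.mem_orthogonal_singleton_iff_inner_right.1 h, mul_zero, zero_smul,
    sub_zero]

lemma normalProj_mem_normalSpace {w : TangentSpace (𝓡 d) x} (hw : w ≠ 0)
    (v : TangentSpace (𝓡 d) x) : normalProj x w v ∈ normalSpace x w :=
  Submodule.mem_orthogonal_singleton_iff_inner_right.2 (inner_normalProj hw v)

/-- The area of the parallelogram spanned by `w` and `v` is `‖w‖` times its height. -/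
lemma norm_sq_mul_norm_sq_normalProj (w v : TangentSpace (𝓡 d) x) :
    ‖w‖ ^ 2 * ‖normalProj x w v‖ ^ 2 = ‖w‖ ^ 2 * ‖v‖ ^ 2 - inner ℝ w v ^ 2 := by
  rcases eq_or_ne w 0 with rfl | h
  · simp
  · have h1 : ‖w‖ ≠ 0 := norm_ne_zero_iff.2 h
    rw [normalProj_apply, norm_sub_sq_real, inner_smul_right, norm_smul, mul_pow,
      Real.norm_eq_abs, sq_abs, real_inner_comm]
    field_simp
    ring

lemma norm_normalProj_le (w v : TangentSpace (𝓡 d) x) : ‖normalProj x w v‖ ≤ ‖v‖ := by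
  rcases eq_or_ne w 0 with rfl | h
  · rw [normalProj_apply, smul_zero, sub_zero]
  · have h1 : 0 < ‖w‖ ^ 2 := pow_pos (norm_pos_iff.2 h) 2
    have h2 := norm_sq_mul_norm_sq_normalProj w v
    have h3 : ‖w‖ ^ 2 * ‖normalProj x w v‖ ^ 2 ≤ ‖w‖ ^ 2 * ‖v‖ ^ 2 := by
      rw [h2]; linarith [sq_nonneg (inner ℝ w v)]
    exact le_of_sq_le_sq (le_of_mul_le_mul_left h3 h1) (norm_nonneg _)

/-- The projections along `w` of two complementary subspaces, the second of which contains `w`, are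
complementary in the orthogonal complement of `w`. -/
lemma map_normalProj_inf_eq_bot {w : TangentSpace (𝓡 d) x}
    {E F : Submodule ℝ (TangentSpace (𝓡 d) x)} (hw : w ∈ F) (hEF : E ⊓ F = ⊥) :
    E.map (normalProj x w).toLinearMap ⊓ F.map (normalProj x w).toLinearMap = ⊥ := by
  rw [eq_bot_iff]
  rintro _ ⟨⟨a, ha, rfl⟩, b, hb, hab⟩
  have h1 : normalProj x w (a - b) = 0 := by
    rw [map_sub, sub_eq_zero]; exact hab.symm
  have h2 : a - b ∈ F :=
    (Submodule.span_singleton_le_iff_mem w F).2 hw (mem_span_of_normalProj_eq_zero h1)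
  have h3 : a ∈ E ⊓ F := ⟨ha, by simpa using F.add_mem h2 hb⟩
  rw [hEF, Submodule.mem_bot] at h3
  rw [h3, map_zero]
  exact Submodule.zero_mem _

lemma map_normalProj_sup_eq {w : TangentSpace (𝓡 d) x} (hw : w ≠ 0)
    {E F : Submodule ℝ (TangentSpace (𝓡 d) x)} (hEF : E ⊔ F = ⊤) :
    E.map (normalProj x w).toLinearMap ⊔ F.map (normalProj x w).toLinearMap = normalSpace x w := by
  rw [← Submodule.map_sup, hEF]
  refine le_antisymm ?_ fun v hv => ⟨v, trivial, normalProj_eq_self_of_mem hv⟩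
  rintro _ ⟨v, -, rfl⟩
  exact normalProj_mem_normalSpace hw v

lemma map_normalProj_le {w : TangentSpace (𝓡 d) x} {F : Submodule ℝ (TangentSpace (𝓡 d) x)}
    (hw : w ∈ F) : F.map (normalProj x w).toLinearMap ≤ F := by
  rintro _ ⟨v, hv, rfl⟩
  exact F.sub_mem hv (F.smul_mem _ hw)

/-- If `w` is mapped to a multiple of `w'`, the projections along `w` and `w'` intertwine a linear
map with its action on the quotients. -/
lemma normalProj_comp_normalProj {y : M} {A : TangentSpace (𝓡 d) x →L[ℝ] TangentSpace (𝓡 d) y}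
    {w : TangentSpace (𝓡 d) x} {w' : TangentSpace (𝓡 d) y} (h : normalProj y w' (A w) = 0)
    (v : TangentSpace (𝓡 d) x) :
    normalProj y w' (A (normalProj x w v)) = normalProj y w' (A v) := by
  rw [normalProj_apply w v, map_sub, map_smul, map_sub, map_smul, h, smul_zero, sub_zero]

variable [IsManifold (𝓡 d) ∞ M] [IsContMDiffRiemannianBundle (𝓡 d) ∞ (EuclideanSpace ℝ (Fin d))
      (fun x : M => TangentSpace (𝓡 d) x)]

lemma ContinuousWithinAt.tangent_normalProj {Y : Type*} [TopologicalSpace Y] {p : Y → M}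
    {w v : ∀ y, TangentSpace (𝓡 d) (p y)} {S : Set Y} {y₀ : Y}
    (hw : ContinuousWithinAt (fun y => (⟨p y, w y⟩ : TangentBundle (𝓡 d) M)) S y₀)
    (hv : ContinuousWithinAt (fun y => (⟨p y, v y⟩ : TangentBundle (𝓡 d) M)) S y₀)
    (h0 : w y₀ ≠ 0) :
    ContinuousWithinAt (fun y => (⟨p y, normalProj (p y) (w y) (v y)⟩ : TangentBundle (𝓡 d) M))
      S y₀ := by
  have : IsContinuousRiemannianBundle (EuclideanSpace ℝ (Fin d))
      (fun x : M => TangentSpace (𝓡 d) x) := isContinuousRiemannianBundle_tangent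
  refine hv.tangent_sub (ContinuousWithinAt.tangent_smul (ContinuousWithinAt.mul ?_ ?_) hw)
  · exact (hw.tangent_norm.pow 2).inv₀ (pow_ne_zero 2 (norm_ne_zero_iff.2 h0))
  · exact hw.inner_bundle hv

end NormalProjection

/-! ### Projected subbundles -/

section NormalSubbundles

variable {d : ℕ} {M : Type*} [TopologicalSpace M] [ChartedSpace (EuclideanSpace ℝ (Fin d)) M]
  [IsManifold (𝓡 d) ∞ M] [RiemannianBundle (fun x : M => TangentSpace (𝓡 d) x)]
  [IsContMDiffRiemannianBundle (𝓡 d) ∞ (EuclideanSpace ℝ (Fin d))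
      (fun x : M => TangentSpace (𝓡 d) x)]
  {Λ : Set M} {S : Set (TangentBundle (𝓡 d) M)}
  {E F : ∀ x : M, Submodule ℝ (TangentSpace (𝓡 d) x)}

/-- The family `π_e(E)` of projections of a family of subspaces `E` along the vector `e`. -/
noncomputable def projectedBundle (E : ∀ x : M, Submodule ℝ (TangentSpace (𝓡 d) x))
    (e : TangentBundle (𝓡 d) M) : Submodule ℝ (TangentSpace (𝓡 d) e.proj) :=
  (E e.proj).map (normalProj e.proj e.2).toLinearMap

/-- A bundle transverse to the vectors along which it is projected has a continuous projection:
project a frame. -/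
lemma isContinuousSubbundle_projectedBundle_left
    (hE : IsContinuousSubbundle (fun x : M => x) Λ E) (hinf : ∀ x ∈ Λ, E x ⊓ F x = ⊥)
    (hS : ∀ e ∈ S, e.proj ∈ Λ ∧ e.2 ≠ 0 ∧ e.2 ∈ F e.proj) :
    IsContinuousSubbundle (fun e : TangentBundle (𝓡 d) M => e.proj) S (projectedBundle E) := by
  intro e₀ he₀
  obtain ⟨V, hV, k, s, hs, hsE⟩ := hE e₀.proj (hS e₀ he₀).1
  have hp : Continuous fun e : TangentBundle (𝓡 d) M => e.proj := FiberBundle.continuous_proj _ _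
  refine ⟨(fun e : TangentBundle (𝓡 d) M => e.proj) ⁻¹' V, hp.continuousAt hV, k,
    fun i e => normalProj e.proj e.2 (s i e.proj), fun i e he => ?_, fun e he => ?_⟩
  · refine ContinuousWithinAt.tangent_normalProj continuousWithinAt_id ?_ (hS e he.1).2.1
    exact ContinuousWithinAt.comp (t := Λ ∩ V) (g := fun x => (⟨x, s i x⟩ : TangentBundle (𝓡 d) M))
      (hs i e.proj ⟨(hS e he.1).1, he.2⟩) hp.continuousWithinAt
      (fun e' he' => ⟨(hS e' he'.1).1, he'.2⟩)
  · have heΛ := hS e he.1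
    obtain ⟨hli, hspan⟩ := hsE e.proj ⟨heΛ.1, he.2⟩
    refine ⟨?_, ?_⟩
    · rw [Fintype.linearIndependent_iff]
      intro g hg
      have h1 : normalProj e.proj e.2 (∑ i, g i • s i e.proj) = 0 := by simpa using hg
      have h2 : ∑ i, g i • s i e.proj ∈ F e.proj :=
        (Submodule.span_singleton_le_iff_mem _ _).2 heΛ.2.2 (mem_span_of_normalProj_eq_zero h1)
      have h3 : ∑ i, g i • s i e.proj ∈ E e.proj := by
        rw [← hspan]
        exact Submodule.sum_mem _ fun i _ => Submodule.smul_mem _ _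
          (Submodule.subset_span ⟨i, rfl⟩)
      have h4 : ∑ i, g i • s i e.proj ∈ E e.proj ⊓ F e.proj := ⟨h3, h2⟩
      rw [hinf _ heΛ.1, Submodule.mem_bot] at h4
      exact Fintype.linearIndependent_iff.1 hli g h4
    · rw [projectedBundle, ← hspan, Submodule.map_span, ← range_comp]
      rfl

/-- The projection of a bundle along a vector field that it contains is continuous: near a given
point one vector of a frame can be exchanged against the field, and the projections of the other
ones form a frame. -/
lemma isContinuousSubbundle_projectedBundle_right
    (hF : IsContinuousSubbundle (fun x : M => x) Λ F)
    (hS : ∀ e ∈ S, e.proj ∈ Λ ∧ e.2 ≠ 0 ∧ e.2 ∈ F e.proj) :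
    IsContinuousSubbundle (fun e : TangentBundle (𝓡 d) M => e.proj) S (projectedBundle F) := by
  intro e₀ he₀
  obtain ⟨h0Λ, h0, h0F⟩ := hS e₀ he₀
  obtain ⟨V, hV, k, s, hs, hsF⟩ := hF e₀.proj h0Λ
  have hp : Continuous fun e : TangentBundle (𝓡 d) M => e.proj := FiberBundle.continuous_proj _ _
  obtain ⟨hli, hspan⟩ := hsF e₀.proj ⟨h0Λ, mem_of_mem_nhds hV⟩
  rw [← hspan] at h0F
  obtain ⟨c, hc⟩ := (Submodule.mem_span_range_iff_exists_fun ℝ).1 h0F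
  obtain ⟨i₀, hi₀⟩ : ∃ i, c i ≠ 0 := by
    by_contra! hcon
    exact h0 (by rw [← hc]; simp [hcon])
  obtain ⟨n, rfl⟩ : ∃ n, k = n + 1 := Nat.exists_eq_succ_of_ne_zero (by rintro rfl; exact i₀.elim0)
  -- the exchanged frame
  let w : Fin (n + 1) → ∀ e : TangentBundle (𝓡 d) M, TangentSpace (𝓡 d) e.proj := fun i e =>
    (Fin.cons e.2 (fun j => s (i₀.succAbove j) e.proj) : Fin (n + 1) → TangentSpace (𝓡 d) e.proj) i
  have hsc : ∀ i, ∀ e ∈ S ∩ (fun e : TangentBundle (𝓡 d) M => e.proj) ⁻¹' V,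
      ContinuousWithinAt (fun e : TangentBundle (𝓡 d) M =>
        (⟨e.proj, s i e.proj⟩ : TangentBundle (𝓡 d) M))
        (S ∩ (fun e : TangentBundle (𝓡 d) M => e.proj) ⁻¹' V) e := fun i e he =>
    ContinuousWithinAt.comp (t := Λ ∩ V) (g := fun x => (⟨x, s i x⟩ : TangentBundle (𝓡 d) M))
      (hs i e.proj ⟨(hS e he.1).1, he.2⟩) hp.continuousWithinAt
      (fun e' he' => ⟨(hS e' he'.1).1, he'.2⟩)
  have he₀V : e₀ ∈ S ∩ (fun e : TangentBundle (𝓡 d) M => e.proj) ⁻¹' V :=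
    ⟨he₀, (mem_of_mem_nhds hV : e₀.proj ∈ V)⟩
  have hwc : ∀ i, ContinuousWithinAt (fun e => tangentCoord d e₀.proj e.proj (w i e))
      (S ∩ (fun e : TangentBundle (𝓡 d) M => e.proj) ⁻¹' V) e₀ := by
    refine Fin.cases ?_ fun j => ?_
    · exact (continuousWithinAt_tangent_iff.1 (continuousWithinAt_id (x := e₀))).2
    · exact (continuousWithinAt_tangent_iff.1 (hsc (i₀.succAbove j) e₀ he₀V)).2
  have hw0 : LinearIndependent ℝ (fun i => w i e₀) := by
    have h := linearIndependent_cons_succAbove hli hi₀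
    rw [hc] at h
    exact h
  have hw0' : LinearIndependent ℝ (fun i => tangentCoord d e₀.proj e₀.proj (w i e₀)) :=
    hw0.map' (tangentCoord d e₀.proj e₀.proj).toLinearMap (LinearMap.ker_eq_bot.2
      (tangentCoord_bijective (FiberBundle.mem_baseSet_trivializationAt' e₀.proj)).1)
  have hev : ∀ᶠ e in 𝓝[S ∩ (fun e : TangentBundle (𝓡 d) M => e.proj) ⁻¹' V] e₀,
      LinearIndependent ℝ (fun i => w i e) := by
    have h1 : Filter.Tendsto (fun e => fun i => tangentCoord d e₀.proj e.proj (w i e))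
        (𝓝[S ∩ (fun e : TangentBundle (𝓡 d) M => e.proj) ⁻¹' V] e₀)
        (𝓝 fun i => tangentCoord d e₀.proj e₀.proj (w i e₀)) := tendsto_pi_nhds.2 hwc
    filter_upwards [h1.eventually hw0'.eventually] with e he
    exact LinearIndependent.of_comp (tangentCoord d e₀.proj e.proj).toLinearMap he
  obtain ⟨U, hU, hUli⟩ := mem_nhdsWithin_iff_exists_mem_nhds_inter.1 hev
  refine ⟨U ∩ (fun e : TangentBundle (𝓡 d) M => e.proj) ⁻¹' V,
    Filter.inter_mem hU (hp.continuousAt hV), n,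
    fun j e => normalProj e.proj e.2 (s (i₀.succAbove j) e.proj), fun j e he => ?_, fun e he => ?_⟩
  · refine ContinuousWithinAt.tangent_normalProj continuousWithinAt_id ?_ (hS e he.1).2.1
    exact (hsc _ e ⟨he.1, he.2.2⟩).mono fun e' he' => ⟨he'.1, he'.2.2⟩
  · have heS := hS e he.1
    obtain ⟨hlie, hspane⟩ := hsF e.proj ⟨heS.1, he.2.2⟩
    have hwe : LinearIndependent ℝ (fun i => w i e) := hUli ⟨he.2.1, he.1, he.2.2⟩
    have hle : Submodule.span ℝ (range fun i => w i e) ≤ Submodule.span ℝ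
        (range fun i => s i e.proj) := by
      rw [Submodule.span_le]
      rintro _ ⟨i, rfl⟩
      refine Fin.cases ?_ (fun j => ?_) i
      · change e.2 ∈ Submodule.span ℝ (range fun i => s i e.proj)
        rw [hspane]; exact heS.2.2
      · exact Submodule.subset_span ⟨i₀.succAbove j, rfl⟩
    -- both families are independent of the same length, so they span the same space
    have hfr : Submodule.span ℝ (range fun i => w i e) = F e.proj := by
      rw [← hspane]
      have : FiniteDimensional ℝ (Submodule.span ℝ (range fun i => s i e.proj)) :=
        FiniteDimensional.span_of_finite ℝ (finite_range _)
      refine Submodule.eq_of_le_of_finrank_eq hle ?_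
      rw [finrank_span_eq_card hwe, finrank_span_eq_card hlie]
    have hfin := linearIndependent_and_span_map_tail (w := e.2)
      (s := fun j => s (i₀.succAbove j) e.proj) hwe (normalProj e.proj e.2).toLinearMap
      (normalProj_self e.2) (fun v hv => mem_span_of_normalProj_eq_zero hv)
    refine ⟨hfin.1, hfin.2.trans ?_⟩
    rw [projectedBundle, ← hfr]

end NormalSubbundles

/-! ### Estimates for the extended linear Poincaré flow -/

section Estimates

variable {d : ℕ} {M : Type*} [TopologicalSpace M] [ChartedSpace (EuclideanSpace ℝ (Fin d)) M]
  [RiemannianBundle (fun x : M => TangentSpace (𝓡 d) x)]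
  {E F : ∀ x : M, Submodule ℝ (TangentSpace (𝓡 d) x)} {φ : ℝ → M → M}

/-- The area of the image of the unit square spanned by `w` and `v`, as base times height. -/
lemma exists_orthonormalBasis_absDet_eq {x : M} {w v : TangentSpace (𝓡 d) x} (hw : ‖w‖ = 1)
    (hv : ‖v‖ = 1) (hwv : inner ℝ w v = 0) :
    ∃ u : OrthonormalBasis (Fin 2) ℝ (Submodule.span ℝ (range ![w, v])),
      ∀ (y : M) (A : TangentSpace (𝓡 d) x →L[ℝ] TangentSpace (𝓡 d) y),
        absDet A u = ‖A w‖ * ‖normalProj y (A w) (A v)‖ := by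
  have ho : Orthonormal ℝ ![w, v] := by
    refine ⟨fun i => ?_, fun i j hij => ?_⟩
    · fin_cases i
      · exact hw
      · exact hv
    · fin_cases i <;> fin_cases j
      · exact absurd rfl hij
      · exact hwv
      · exact (real_inner_comm w v).trans hwv
      · exact absurd rfl hij
  let b : Fin 2 → Submodule.span ℝ (range ![w, v]) := fun i =>
    ⟨![w, v] i, Submodule.subset_span ⟨i, rfl⟩⟩
  have hb : Orthonormal ℝ b := by
    refine ⟨fun i => ho.1 i, fun i j hij => ho.2 hij⟩
  have hspan : ⊤ ≤ Submodule.span ℝ (range b) := by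
    rintro ⟨z, hz⟩ -
    have : Submodule.span ℝ (range ![w, v]) =
        (Submodule.span ℝ (range b)).map (Submodule.span ℝ (range ![w, v])).subtype := by
      rw [Submodule.map_span, ← range_comp]
      rfl
    rw [this] at hz
    obtain ⟨z', hz', rfl⟩ := hz
    exact hz'
  refine ⟨OrthonormalBasis.mk hb hspan, fun y A => ?_⟩
  have h0 : ((OrthonormalBasis.mk hb hspan 0 : Submodule.span ℝ (range ![w, v])) :
      TangentSpace (𝓡 d) x) = w := by
    rw [OrthonormalBasis.coe_mk]
    rfl
  have h1 : ((OrthonormalBasis.mk hb hspan 1 : Submodule.span ℝ (range ![w, v])) :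
      TangentSpace (𝓡 d) x) = v := by
    rw [OrthonormalBasis.coe_mk]
    rfl
  rw [absDet, Matrix.det_fin_two]
  simp only [Matrix.of_apply, h0, h1]
  rw [real_inner_self_eq_norm_sq, real_inner_self_eq_norm_sq, real_inner_comm (A w) (A v),
    ← pow_two (inner ℝ (A w) (A v)), ← norm_sq_mul_norm_sq_normalProj, ← mul_pow,
    Real.sqrt_sq (mul_nonneg (norm_nonneg _) (norm_nonneg _))]

lemma extPoincareFlow_apply {t : ℝ} {e : TangentBundle (𝓡 d) M}
    (he : tangentFlow φ t e.proj e.2 ≠ 0) (v : TangentSpace (𝓡 d) e.proj) :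
    extPoincareFlow φ t e v =
      normalProj (φ t e.proj) (tangentFlow φ t e.proj e.2) (tangentFlow φ t e.proj v) :=
  DFunLike.congr_fun (normalProj_smul (inv_ne_zero (norm_ne_zero_iff.2 he))
    (tangentFlow φ t e.proj e.2)) (tangentFlow φ t e.proj v)

/-- The extended linear Poincaré flow is the action of the tangent flow on the quotients by the
lines spanned by the base vectors. -/
lemma extPoincareFlow_normalProj {t : ℝ} {e : TangentBundle (𝓡 d) M}
    (he : tangentFlow φ t e.proj e.2 ≠ 0) (v : TangentSpace (𝓡 d) e.proj) :
    extPoincareFlow φ t e (normalProj e.proj e.2 v) =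
      normalProj (φ t e.proj) (tangentFlow φ t e.proj e.2) (tangentFlow φ t e.proj v) :=
  (extPoincareFlow_apply he _).trans (normalProj_comp_normalProj (normalProj_self _) v)

lemma projectedBundle_unitDir {X : ∀ x : M, TangentSpace (𝓡 d) x} {x : M} (hx : x ∉ singSet X) :
    projectedBundle E (unitDir X x) = (E x).map (normalProj x (X x)).toLinearMap :=
  congrArg (fun A : TangentSpace (𝓡 d) x →L[ℝ] TangentSpace (𝓡 d) x => (E x).map A.toLinearMap)
    (normalProj_smul (inv_ne_zero (norm_ne_zero_iff.2 hx)) (X x))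

lemma map_extPoincareFlow_projectedBundle {t : ℝ} {e : TangentBundle (𝓡 d) M}
    (he : tangentFlow φ t e.proj e.2 ≠ 0)
    (hE : (E e.proj).map (tangentFlow φ t e.proj).toLinearMap = E (φ t e.proj)) :
    (projectedBundle E e).map (extPoincareFlow φ t e).toLinearMap =
      projectedBundle E (sphereFlow φ t e) := by
  have h : projectedBundle E (sphereFlow φ t e) = (E (φ t e.proj)).map
      (normalProj (φ t e.proj) (tangentFlow φ t e.proj e.2)).toLinearMap :=
    congrArg (fun A : TangentSpace (𝓡 d) (φ t e.proj) →L[ℝ] TangentSpace (𝓡 d) (φ t e.proj) =>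
      (E (φ t e.proj)).map A.toLinearMap) (normalProj_smul
        (inv_ne_zero (norm_ne_zero_iff.2 he)) (tangentFlow φ t e.proj e.2))
  rw [h, ← hE, projectedBundle]
  ext z
  constructor
  · rintro ⟨_, ⟨a, ha, rfl⟩, rfl⟩
    exact ⟨_, ⟨a, ha, rfl⟩, (extPoincareFlow_normalProj he a).symm⟩
  · rintro ⟨_, ⟨a, ha, rfl⟩, rfl⟩
    exact ⟨_, ⟨a, ha, rfl⟩, extPoincareFlow_normalProj he a⟩

lemma norm_extPoincareFlow_le {t : ℝ} {e : TangentBundle (𝓡 d) M}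
    (v : TangentSpace (𝓡 d) e.proj) : ‖extPoincareFlow φ t e v‖ ≤ ‖tangentFlow φ t e.proj v‖ :=
  norm_normalProj_le (sphereFlow φ t e).2 (tangentFlow φ t e.proj v)

lemma restrNorm_extPoincareFlow_right_le {t : ℝ} {e : TangentBundle (𝓡 d) M}
    (he : e.2 ∈ F e.proj) : restrNorm (extPoincareFlow φ t e) (projectedBundle F e) ≤
      restrNorm (tangentFlow φ t e.proj) (F e.proj) :=
  restrNorm_le (restrNorm_nonneg _ _) fun v hv =>
    (norm_extPoincareFlow_le v).trans (norm_apply_le_restrNorm _ (map_normalProj_le he hv))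

lemma restrNorm_extPoincareFlow_left_le {t : ℝ} {e : TangentBundle (𝓡 d) M} {K : ℝ} (hK0 : 0 ≤ K)
    (he : tangentFlow φ t e.proj e.2 ≠ 0) (heF : e.2 ∈ F e.proj)
    (hK : ∀ a ∈ E e.proj, ∀ b ∈ F e.proj, ‖a‖ ≤ K * ‖a + b‖) :
    restrNorm (extPoincareFlow φ t e) (projectedBundle E e) ≤
      K * restrNorm (tangentFlow φ t e.proj) (E e.proj) := by
  refine restrNorm_le (mul_nonneg hK0 (restrNorm_nonneg _ _)) ?_
  rintro _ ⟨a, ha, rfl⟩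
  have h1 : ‖a‖ ≤ K * ‖normalProj e.proj e.2 a‖ := by
    have h := hK a ha (-(a - normalProj e.proj e.2 a)) ((F e.proj).neg_mem
      ((Submodule.span_singleton_le_iff_mem _ _).2 heF (sub_normalProj_mem_span e.2 a)))
    rwa [neg_sub, add_sub_cancel] at h
  refine (congrArg norm (extPoincareFlow_normalProj he a)).le.trans ((norm_normalProj_le _ _).trans
    ((norm_apply_le_restrNorm _ ha).trans ?_))
  refine (mul_le_mul_of_nonneg_left h1 (restrNorm_nonneg _ _)).trans (le_of_eq ?_)
  change _ = K * restrNorm (tangentFlow φ t e.proj) (E e.proj) * ‖normalProj e.proj e.2 a‖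
  ring

variable [IsManifold (𝓡 d) ∞ M] [IsContMDiffRiemannianBundle (𝓡 d) ∞ (EuclideanSpace ℝ (Fin d))
      (fun x : M => TangentSpace (𝓡 d) x)] [T2Space M] [CompactSpace M]
  {X : ∀ x : M, TangentSpace (𝓡 d) x} {Λ : Set M} {C r : ℝ}

lemma tangentFlow_ne_zero_of_mem_extendedSet
    (hX : ContMDiff (𝓡 d) (𝓡 d).tangent 1 (fun x => (⟨x, X x⟩ : TangentBundle (𝓡 d) M)))
    (hφ : IsFlowOf φ X) (t : ℝ) {e : TangentBundle (𝓡 d) M} (he : e ∈ extendedSet X Λ) :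
    tangentFlow φ t e.proj e.2 ≠ 0 :=
  tangentFlow_ne_zero hX hφ t (norm_ne_zero_iff.1
    (by rw [norm_eq_one_of_mem_extendedSet he]; exact one_ne_zero))

/-- The projections of a singular hyperbolic splitting form a dominated splitting of the normal
bundle of the extended set. -/
lemma isDominatedSplitting_projectedBundle
    (hX : ContMDiff (𝓡 d) (𝓡 d).tangent 1 (fun x => (⟨x, X x⟩ : TangentBundle (𝓡 d) M)))
    (hφ : IsFlowOf φ X) (hΛ : IsCompact Λ) (hinv : IsInvariant φ Λ)
    (h : IsPosSingularHyperbolicWith φ X Λ E F C r) {K : ℝ} (hK1 : 1 ≤ K)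
    (hK : ∀ x ∈ Λ, ∀ a ∈ E x, ∀ b ∈ F x, ‖a‖ ≤ K * ‖a + b‖) :
    IsDominatedSplitting (fun e : TangentBundle (𝓡 d) M => e.proj) (sphereFlow φ)
      (extPoincareFlow φ) (extendedSet X Λ) (fun e => normalSpace e.proj e.2)
      (projectedBundle E) (projectedBundle F) (K * C) r := by
  have hproj : ∀ e ∈ extendedSet X Λ, e.proj ∈ Λ := fun e he => proj_mem_of_mem_extendedSet hΛ he
  have hF : ∀ e ∈ extendedSet X Λ, e.2 ∈ F e.proj :=
    fun e he => mem_right_of_mem_extendedSet hX hφ hΛ hinv h he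
  have h0 : ∀ e ∈ extendedSet X Λ, e.2 ≠ 0 := fun e he => norm_ne_zero_iff.1
    (by rw [norm_eq_one_of_mem_extendedSet he]; exact one_ne_zero)
  have hS : ∀ e ∈ extendedSet X Λ, e.proj ∈ Λ ∧ e.2 ≠ 0 ∧ e.2 ∈ F e.proj :=
    fun e he => ⟨hproj e he, h0 e he, hF e he⟩
  have hne : ∀ e ∈ extendedSet X Λ, ∀ t, tangentFlow φ t e.proj e.2 ≠ 0 :=
    fun e he t => tangentFlow_ne_zero_of_mem_extendedSet hX hφ t he
  refine ⟨isContinuousSubbundle_projectedBundle_left h.splitting.continuous_left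
      h.splitting.inf_eq hS, isContinuousSubbundle_projectedBundle_right
      h.splitting.continuous_right hS, fun e he => ?_, fun e he => ?_, fun e he t => ?_,
      fun e he t => ?_, fun e he t ht => ?_⟩
  · exact map_normalProj_inf_eq_bot (hF e he) (h.splitting.inf_eq _ (hproj e he))
  · exact map_normalProj_sup_eq (h0 e he) (h.splitting.sup_eq _ (hproj e he))
  · exact map_extPoincareFlow_projectedBundle (hne e he t) (h.splitting.map_left _ (hproj e he) t)
  · exact map_extPoincareFlow_projectedBundle (hne e he t) (h.splitting.map_right _ (hproj e he) t)
  · have h1 := restrNorm_extPoincareFlow_left_le (zero_le_one.trans hK1) (hne e he t) (hF e he)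
      (hK _ (hproj e he))
    have h2 : restrNorm (extPoincareFlow φ (-t) (sphereFlow φ t e))
        (projectedBundle F (sphereFlow φ t e)) ≤
        restrNorm (tangentFlow φ (-t) (φ t e.proj)) (F (φ t e.proj)) :=
      restrNorm_extPoincareFlow_right_le
        (hF _ (sphereFlow_mem_extendedSet hX hφ hinv t he))
    have h3 := h.splitting.dominated _ (hproj e he) t ht
    refine (mul_le_mul h1 h2 (restrNorm_nonneg _ _)
      (mul_nonneg (zero_le_one.trans hK1) (restrNorm_nonneg _ _))).trans_lt ?_
    rw [mul_assoc, mul_assoc]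
    exact mul_lt_mul_of_pos_left h3 (zero_lt_one.trans_le hK1)

lemma norm_extPoincareFlow_lt_of_mem_left
    (hX : ContMDiff (𝓡 d) (𝓡 d).tangent 1 (fun x => (⟨x, X x⟩ : TangentBundle (𝓡 d) M)))
    (hφ : IsFlowOf φ X) (hΛ : IsCompact Λ) (hinv : IsInvariant φ Λ)
    (h : IsPosSingularHyperbolicWith φ X Λ E F C r) {K : ℝ} (hK1 : 1 ≤ K)
    (hK : ∀ x ∈ Λ, ∀ a ∈ E x, ∀ b ∈ F x, ‖a‖ ≤ K * ‖a + b‖) {e : TangentBundle (𝓡 d) M}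
    (he : e ∈ extendedSet X Λ) {t : ℝ} (ht : 0 < t) {v : TangentSpace (𝓡 d) e.proj}
    (hv : v ∈ projectedBundle E e) (hv0 : v ≠ 0) :
    ‖extPoincareFlow φ t e v‖ < K * C * Real.exp (-r * t) * ‖v‖ := by
  have h1 := restrNorm_extPoincareFlow_left_le (zero_le_one.trans hK1)
    (tangentFlow_ne_zero_of_mem_extendedSet hX hφ t he)
    (mem_right_of_mem_extendedSet hX hφ hΛ hinv h he)
    (hK _ (proj_mem_of_mem_extendedSet hΛ he))
  have h2 := h.contracting _ (proj_mem_of_mem_extendedSet hΛ he) t ht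
  refine (norm_apply_le_restrNorm _ hv).trans_lt ?_
  refine mul_lt_mul_of_pos_right (h1.trans_lt ?_) (norm_pos_iff.2 hv0)
  rw [mul_assoc]
  exact mul_lt_mul_of_pos_left h2 (zero_lt_one.trans_le hK1)

/-- The area of a parallelogram in `F` with one side along `e` is the length of that side times the
length of the normal component of the other one. -/
lemma norm_tangentFlow_mul_norm_extPoincareFlow_lt_of_mem_right
    (hX : ContMDiff (𝓡 d) (𝓡 d).tangent 1 (fun x => (⟨x, X x⟩ : TangentBundle (𝓡 d) M)))
    (hφ : IsFlowOf φ X) (hΛ : IsCompact Λ) (hinv : IsInvariant φ Λ)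
    (h : IsPosSingularHyperbolicWith φ X Λ E F C r) {e : TangentBundle (𝓡 d) M}
    (he : e ∈ extendedSet X Λ) {t : ℝ} (ht : 0 < t) {v : TangentSpace (𝓡 d) e.proj}
    (hv : v ∈ projectedBundle F e) (hv0 : v ≠ 0) :
    ‖tangentFlow φ (-t) e.proj e.2‖ * ‖extPoincareFlow φ (-t) e v‖ <
      C * Real.exp (-r * t) * ‖v‖ := by
  have heF := mem_right_of_mem_extendedSet hX hφ hΛ hinv h he
  have he1 := norm_eq_one_of_mem_extendedSet he
  have he0 : e.2 ≠ 0 := norm_ne_zero_iff.1 (by rw [he1]; exact one_ne_zero)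
  have hvF : v ∈ F e.proj := map_normalProj_le heF hv
  have hev : inner ℝ e.2 v = 0 := by
    obtain ⟨a, -, rfl⟩ := hv
    exact inner_normalProj he0 a
  have hvn : 0 < ‖v‖ := norm_pos_iff.2 hv0
  have hu1 : ‖‖v‖⁻¹ • v‖ = 1 := by rw [norm_smul, norm_inv, norm_norm, inv_mul_cancel₀ hvn.ne']
  have hu2 : inner ℝ e.2 (‖v‖⁻¹ • v) = 0 := by rw [inner_smul_right, hev, mul_zero]
  obtain ⟨u, hu⟩ := exists_orthonormalBasis_absDet_eq he1 hu1 hu2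
  have hle : Submodule.span ℝ (range ![e.2, ‖v‖⁻¹ • v]) ≤ F e.proj := by
    rw [Submodule.span_le]
    rintro _ ⟨i, rfl⟩
    fin_cases i
    · exact heF
    · exact (F e.proj).smul_mem _ hvF
  have h1 := h.area_expanding _ (proj_mem_of_mem_extendedSet hΛ he) _ hle u t ht
  rw [hu, map_smul, map_smul, norm_smul, norm_inv, norm_norm] at h1
  have h2 := extPoincareFlow_apply (tangentFlow_ne_zero_of_mem_extendedSet hX hφ (-t) he) v
  have h3 : ‖extPoincareFlow φ (-t) e v‖ = ‖normalProj (φ (-t) e.proj)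
    (tangentFlow φ (-t) e.proj e.2) (tangentFlow φ (-t) e.proj v)‖ := congrArg norm h2
  rw [h3]
  calc _ = ‖tangentFlow φ (-t) e.proj e.2‖ * (‖v‖⁻¹ * ‖normalProj (φ (-t) e.proj)
        (tangentFlow φ (-t) e.proj e.2) (tangentFlow φ (-t) e.proj v)‖) * ‖v‖ := by
        field_simp
    _ < _ := mul_lt_mul_of_pos_right h1 hvn

end Estimates

/-! ### Restriction to the regular points -/

section RegularPoints

variable {d : ℕ} {M : Type*} [TopologicalSpace M] [ChartedSpace (EuclideanSpace ℝ (Fin d)) M]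
  [IsManifold (𝓡 d) ∞ M] [RiemannianBundle (fun x : M => TangentSpace (𝓡 d) x)]
  {φ : ℝ → M → M} {X : ∀ x : M, TangentSpace (𝓡 d) x} {Λ : Set M} {C r : ℝ}

section Flow

variable [T2Space M] [CompactSpace M]

lemma extPoincareFlow_unitDir
    (hX : ContMDiff (𝓡 d) (𝓡 d).tangent 1 (fun x => (⟨x, X x⟩ : TangentBundle (𝓡 d) M)))
    (hφ : IsFlowOf φ X) (t : ℝ) {x : M} (hx : x ∉ singSet X) :
    extPoincareFlow φ t (unitDir X x) = poincareFlow φ X t x := by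
  have h0 : ‖X x‖⁻¹ ≠ 0 := inv_ne_zero (norm_ne_zero_iff.2 hx)
  have h1 : tangentFlow φ t x (‖X x‖⁻¹ • X x) = ‖X x‖⁻¹ • X (φ t x) := by
    rw [map_smul, tangentFlow_apply_field hX hφ]
  have h2 : tangentFlow φ t x (‖X x‖⁻¹ • X x) ≠ 0 :=
    tangentFlow_ne_zero hX hφ t (smul_ne_zero h0 hx)
  ext1 v
  refine (extPoincareFlow_apply (e := unitDir X x) h2 v).trans ?_
  change normalProj (φ t x) (tangentFlow φ t x (‖X x‖⁻¹ • X x)) (tangentFlow φ t x v) =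
    normalProj (φ t x) (X (φ t x)) (tangentFlow φ t x v)
  rw [h1, normalProj_smul h0]

/-- A family over the tangent bundle has the same value at `Φ_t^#(X(x)/‖X(x)‖)` and at the direction
of `X` at `φ t x`. Both have the base point `φ t x` by definition, so that the values have the same
type. -/
lemma comp_sphereFlow_unitDir
    (hX : ContMDiff (𝓡 d) (𝓡 d).tangent 1 (fun x => (⟨x, X x⟩ : TangentBundle (𝓡 d) M)))
    (hφ : IsFlowOf φ X) (t : ℝ) {x : M} (hx : x ∉ singSet X) (Z : M → Type*)
    (g : ∀ e : TangentBundle (𝓡 d) M, Z e.proj) :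
    (g (sphereFlow φ t (unitDir X x)) : Z (φ t x)) = g (unitDir X (φ t x)) := by
  have h := sphereFlow_unitDir hX hφ t hx
  have h1 : ‖tangentFlow φ t x (‖X x‖⁻¹ • X x)‖⁻¹ • tangentFlow φ t x (‖X x‖⁻¹ • X x) =
      ‖X (φ t x)‖⁻¹ • X (φ t x) := eq_of_heq (TotalSpace.mk.inj h).2
  have h2 : ∀ w w' : TangentSpace (𝓡 d) (φ t x), w = w' →
      (g ⟨φ t x, w⟩ : Z (φ t x)) = g ⟨φ t x, w'⟩ := by
    rintro w _ rfl
    rfl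
  exact h2 _ _ h1

end Flow

variable [IsContMDiffRiemannianBundle (𝓡 d) ∞ (EuclideanSpace ℝ (Fin d))
      (fun x : M => TangentSpace (𝓡 d) x)]

lemma continuousWithinAt_unitDir
    (hX : ContMDiff (𝓡 d) (𝓡 d).tangent 1 (fun x => (⟨x, X x⟩ : TangentBundle (𝓡 d) M)))
    {S : Set M} {x : M} (hx : x ∉ singSet X) : ContinuousWithinAt (unitDir X) S x :=
  ContinuousWithinAt.tangent_smul (p := fun x : M => x)
    ((continuous_norm_field hX).continuousWithinAt.inv₀ (norm_ne_zero_iff.2 hx))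
    hX.continuous.continuousWithinAt

/-- Continuous subbundles over the extended set restrict to the set of regular points. -/
lemma IsContinuousSubbundle.comp_unitDir
    (hX : ContMDiff (𝓡 d) (𝓡 d).tangent 1 (fun x => (⟨x, X x⟩ : TangentBundle (𝓡 d) M)))
    {Δ : ∀ e : TangentBundle (𝓡 d) M, Submodule ℝ (TangentSpace (𝓡 d) e.proj)}
    (hΔ : IsContinuousSubbundle (fun e : TangentBundle (𝓡 d) M => e.proj) (extendedSet X Λ) Δ) :
    IsContinuousSubbundle (fun x : M => x) (Λ \ singSet X) (fun x => Δ (unitDir X x)) := by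
  intro x₀ hx₀
  obtain ⟨V, hV, k, s, hs, hsΔ⟩ := hΔ _ (unitDir_mem_extendedSet hx₀)
  obtain ⟨U, hU, hUV⟩ := mem_nhdsWithin_iff_exists_mem_nhds_inter.1
    ((continuousWithinAt_unitDir hX (S := Λ \ singSet X) hx₀.2) hV)
  have hmaps : ∀ x ∈ (Λ \ singSet X) ∩ U, unitDir X x ∈ extendedSet X Λ ∩ V :=
    fun x hx => ⟨unitDir_mem_extendedSet hx.1, hUV ⟨hx.2, hx.1⟩⟩
  refine ⟨U, hU, k, fun i x => s i (unitDir X x), fun i x hx => ?_,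
    fun x hx => hsΔ _ (hmaps x hx)⟩
  exact ContinuousWithinAt.comp (t := extendedSet X Λ ∩ V)
    (g := fun e : TangentBundle (𝓡 d) M => (⟨e.proj, s i e⟩ : TangentBundle (𝓡 d) M))
    (hs i _ (hmaps x hx)) (continuousWithinAt_unitDir hX hx.1.2) hmaps

variable [T2Space M] [CompactSpace M]

/-- At the regular points, a dominated splitting for the extended linear Poincaré flow is one for
the linear Poincaré flow. -/
lemma IsDominatedSplitting.comp_unitDir
    (hX : ContMDiff (𝓡 d) (𝓡 d).tangent 1 (fun x => (⟨x, X x⟩ : TangentBundle (𝓡 d) M)))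
    (hφ : IsFlowOf φ X)
    {Δs Δu : ∀ e : TangentBundle (𝓡 d) M, Submodule ℝ (TangentSpace (𝓡 d) e.proj)}
    (h : IsDominatedSplitting (fun e : TangentBundle (𝓡 d) M => e.proj) (sphereFlow φ)
      (extPoincareFlow φ) (extendedSet X Λ) (fun e => normalSpace e.proj e.2) Δs Δu C r) :
    IsDominatedSplitting (fun x : M => x) φ (poincareFlow φ X) (Λ \ singSet X)
      (fun x => normalSpace x (X x)) (fun x => Δs (unitDir X x)) (fun x => Δu (unitDir X x))
      C r := by
  refine ⟨h.continuous_left.comp_unitDir hX, h.continuous_right.comp_unitDir hX,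
    fun x hx => h.inf_eq _ (unitDir_mem_extendedSet hx), fun x hx => ?_, fun x hx t => ?_,
    fun x hx t => ?_, fun x hx t ht => ?_⟩
  · refine (h.sup_eq _ (unitDir_mem_extendedSet hx)).trans ?_
    change (ℝ ∙ (‖X x‖⁻¹ • X x))ᗮ = (ℝ ∙ X x)ᗮ
    rw [Submodule.span_singleton_smul_eq
      (IsUnit.mk0 _ (inv_ne_zero (norm_ne_zero_iff.2 hx.2 : ‖X x‖ ≠ 0)))]
  · rw [← extPoincareFlow_unitDir hX hφ t hx.2]
    exact (h.map_left _ (unitDir_mem_extendedSet hx) t).trans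
      (comp_sphereFlow_unitDir hX hφ t hx.2
        (fun y => Submodule ℝ (TangentSpace (𝓡 d) y)) Δs)
  · rw [← extPoincareFlow_unitDir hX hφ t hx.2]
    exact (h.map_right _ (unitDir_mem_extendedSet hx) t).trans
      (comp_sphereFlow_unitDir hX hφ t hx.2
        (fun y => Submodule ℝ (TangentSpace (𝓡 d) y)) Δu)
  · have h1 := h.dominated _ (unitDir_mem_extendedSet hx) t ht
    have h2 := comp_sphereFlow_unitDir hX hφ t hx.2 (fun _ => ℝ)
      (fun e => restrNorm (extPoincareFlow φ (-t) e) (Δu e))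
    have h3 : restrNorm (extPoincareFlow φ t (unitDir X x)) (Δs (unitDir X x)) *
        restrNorm (extPoincareFlow φ (-t) (unitDir X (φ t x))) (Δu (unitDir X (φ t x))) <
        C * Real.exp (-r * t) := by
      rw [← h2]; exact h1
    rw [extPoincareFlow_unitDir hX hφ t hx.2,
      extPoincareFlow_unitDir hX hφ (-t) (field_flow_ne_zero hX hφ t hx.2)] at h3
    exact h3

end RegularPoints

/-! ### Hyperbolic fixed points -/

section HyperbolicFixedPoint

variable {V : Type*} [NormedAddCommGroup V] [NormedSpace ℝ V]

/-- A fixed point `p` of a map `g` with hyperbolic derivative at `p` is isolated as an invariant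
set: the only full orbit close to `p` is constant. Writing `u` and `s` for the unstable and stable
components of the distance to `p`, an orbit with `‖s‖ ≤ ‖u‖` at some time has this property forever
after and `‖u‖` at least triples at each step; an orbit that never has it halves `‖s‖` at each step
of its infinite past. -/
lemma exists_forall_orbit_eq_fixedPoint {P Q L : V →L[ℝ] V} (hPQ : ∀ v, P v + Q v = v)
    (hPL : ∀ v, P (L v) = L (P v)) (hQL : ∀ v, Q (L v) = L (Q v))
    (hu : ∀ v, 4 * ‖P v‖ ≤ ‖L (P v)‖) (hs : ∀ v, ‖L (Q v)‖ ≤ 1 / 4 * ‖Q v‖)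
    {g : V → V} {p : V} (hg : HasFDerivAt g L p) (hgp : g p = p) :
    ∃ ρ > 0, ∀ x : ℤ → V, (∀ n, g (x n) = x (n + 1)) → (∀ n, x n ∈ Metric.ball p ρ) →
      x 0 = p := by
  -- with this bound on the remainder, its components are at most `‖x - p‖ / 8`
  set δ : ℝ := (8 * (‖P‖ + ‖Q‖ + 1))⁻¹ with hδ
  have hden : 0 < 8 * (‖P‖ + ‖Q‖ + 1) := by positivity
  have hδ0 : 0 < δ := inv_pos.2 hden
  have hδ1 : δ * (8 * (‖P‖ + ‖Q‖ + 1)) = 1 := inv_mul_cancel₀ hden.ne'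
  have hPδ : ‖P‖ * δ ≤ 1 / 8 := by nlinarith [norm_nonneg P, norm_nonneg Q]
  have hQδ : ‖Q‖ * δ ≤ 1 / 8 := by nlinarith [norm_nonneg P, norm_nonneg Q]
  obtain ⟨ρ, hρ, hball⟩ := Metric.eventually_nhds_iff_ball.1
    ((hasFDerivAt_iff_isLittleO.1 hg).bound hδ0)
  refine ⟨ρ, hρ, fun x hx hxρ => ?_⟩
  -- one step of the orbit
  have hsum : ∀ n, ‖x n - p‖ ≤ ‖P (x n - p)‖ + ‖Q (x n - p)‖ := fun n => by
    conv_lhs => rw [← hPQ (x n - p)]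
    exact norm_add_le _ _
  have hrem : ∀ n, ‖x (n + 1) - p - L (x n - p)‖ ≤ δ * ‖x n - p‖ := fun n => by
    have := hball (x n) (hxρ n)
    rwa [hgp, hx] at this
  have hstepu : ∀ n, 4 * ‖P (x n - p)‖ - 1 / 8 * (‖P (x n - p)‖ + ‖Q (x n - p)‖) ≤
      ‖P (x (n + 1) - p)‖ := fun n => by
    have h1 : ‖P (x (n + 1) - p - L (x n - p))‖ ≤ 1 / 8 * ‖x n - p‖ :=
      (P.le_opNorm _).trans ((mul_le_mul_of_nonneg_left (hrem n) (norm_nonneg P)).trans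
        (by rw [← mul_assoc]; exact mul_le_mul_of_nonneg_right hPδ (norm_nonneg _)))
    rw [map_sub P _ (L _), hPL] at h1
    have h2 := norm_sub_norm_le (L (P (x n - p))) (P (x (n + 1) - p))
    rw [norm_sub_rev] at h2
    linarith [hu (x n - p), hsum n]
  have hsteps : ∀ n, ‖Q (x (n + 1) - p)‖ ≤
      1 / 4 * ‖Q (x n - p)‖ + 1 / 8 * (‖P (x n - p)‖ + ‖Q (x n - p)‖) := fun n => by
    have h1 : ‖Q (x (n + 1) - p - L (x n - p))‖ ≤ 1 / 8 * ‖x n - p‖ :=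
      (Q.le_opNorm _).trans ((mul_le_mul_of_nonneg_left (hrem n) (norm_nonneg Q)).trans
        (by rw [← mul_assoc]; exact mul_le_mul_of_nonneg_right hQδ (norm_nonneg _)))
    rw [map_sub Q _ (L _), hQL] at h1
    have h2 := norm_sub_norm_le (Q (x (n + 1) - p)) (L (Q (x n - p)))
    linarith [hs (x n - p), hsum n]
  have hxb : ∀ n, ‖x n - p‖ ≤ ρ := fun n => by
    have := hxρ n
    rw [mem_ball_iff_norm] at this
    exact this.le
  -- in the unstable cone the orbit is trivial
  have hcone : ∀ n, ‖Q (x n - p)‖ ≤ ‖P (x n - p)‖ → ‖P (x n - p)‖ ≤ 0 := fun n hn => by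
    have h1 : ∀ k : ℕ, ‖Q (x (n + k) - p)‖ ≤ ‖P (x (n + k) - p)‖ ∧
        3 ^ k * ‖P (x n - p)‖ ≤ ‖P (x (n + k) - p)‖ := by
      intro k
      induction k with
      | zero => simpa using hn
      | succ k ih =>
        have h2 := hstepu (n + k)
        have h3 := hsteps (n + k)
        have h4 := norm_nonneg (P (x (n + k) - p))
        rw [Nat.cast_succ, ← add_assoc, pow_succ]
        constructor <;> linarith [ih.1, ih.2]
    by_contra! hpos
    obtain ⟨k, hk⟩ := pow_unbounded_of_one_lt (‖P‖ * ρ / ‖P (x n - p)‖) (by norm_num : (1 : ℝ) < 3)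
    rw [div_lt_iff₀ hpos] at hk
    have h5 := (P.le_opNorm (x (n + k) - p)).trans
      (mul_le_mul_of_nonneg_left (hxb (n + k)) (norm_nonneg P))
    linarith [(h1 k).2]
  have hPle : ∀ n, ‖P (x n - p)‖ ≤ ‖Q (x n - p)‖ := fun n => by
    rcases le_total ‖Q (x n - p)‖ ‖P (x n - p)‖ with h | h
    · exact (hcone n h).trans (norm_nonneg _)
    · exact h
  have hback : ∀ k : ℕ, 2 ^ k * ‖Q (x 0 - p)‖ ≤ ‖Q (x (-k) - p)‖ := by
    intro k
    induction k with
    | zero => simp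
    | succ k ih =>
      have h2 := hsteps (-((k + 1 : ℕ) : ℤ))
      have h3 : -((k + 1 : ℕ) : ℤ) + 1 = -k := by push_cast; ring
      rw [h3] at h2
      rw [pow_succ]
      linarith [hPle (-((k + 1 : ℕ) : ℤ))]
  have hQ0 : ‖Q (x 0 - p)‖ ≤ 0 := by
    by_contra! hpos
    obtain ⟨k, hk⟩ := pow_unbounded_of_one_lt (‖Q‖ * ρ / ‖Q (x 0 - p)‖) one_lt_two
    rw [div_lt_iff₀ hpos] at hk
    have h5 := (Q.le_opNorm (x (-k) - p)).trans
      (mul_le_mul_of_nonneg_left (hxb (-k)) (norm_nonneg Q))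
    linarith [hback k]
  have h0 : ‖x 0 - p‖ ≤ 0 := by linarith [hsum 0, hPle 0]
  exact sub_eq_zero.1 (norm_le_zero_iff.1 h0)

end HyperbolicFixedPoint

/-! ### Hyperbolic singularities are isolated -/

section HyperbolicSingularity

variable {d : ℕ} {M : Type*} [TopologicalSpace M] [ChartedSpace (EuclideanSpace ℝ (Fin d)) M]
  [IsManifold (𝓡 d) ∞ M] [RiemannianBundle (fun x : M => TangentSpace (𝓡 d) x)]
  {φ : ℝ → M → M} {X : ∀ x : M, TangentSpace (𝓡 d) x}

variable [T2Space M] [CompactSpace M]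

/-- The only full orbit near a hyperbolic singularity is the singularity. -/
lemma exists_isOpen_forall_flow_mem_closure_eq
    (hX : ContMDiff (𝓡 d) (𝓡 d).tangent 1 (fun x => (⟨x, X x⟩ : TangentBundle (𝓡 d) M)))
    (hφ : IsFlowOf φ X) {σ : M} (hσ : IsHyperbolicSingularity φ X σ) :
    ∃ V : Set M, IsOpen V ∧ σ ∈ V ∧ ∀ x, (∀ t, φ t x ∈ closure V) → x = σ := by
  obtain ⟨hX0, Es, Eu, C, hC, r, hr, hcompl, hEs, hEu, hcs, hcu⟩ := hσ
  have hfix := flow_eq_self hX hφ hX0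
  obtain ⟨κ, hκ, hnorm⟩ := exists_norm_le_mul_norm_model (d := d) σ
  -- a time after which the hyperbolicity dominates the change of norm
  obtain ⟨T, hT, hTκ⟩ : ∃ T > 0, κ * (C * Real.exp (-r * T)) * κ ≤ 1 / 4 := by
    have hlim : Filter.Tendsto (fun t : ℝ => κ * (C * Real.exp (-r * t)) * κ) Filter.atTop
        (𝓝 (κ * (C * 0) * κ)) := by
      refine (((Real.tendsto_exp_atBot.comp ?_).const_mul C).const_mul κ).mul_const κ
      exact Filter.tendsto_id.const_mul_atTop_of_neg (neg_lt_zero.2 hr)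
    have h1 := (hlim.eventually_le_const (by norm_num : κ * (C * 0) * κ < 1 / 4)).and
      (Filter.eventually_gt_atTop 0)
    obtain ⟨T, h2, h3⟩ := h1.exists
    exact ⟨T, h3, h2⟩
  set χ := extChartAt (𝓡 d) σ with hχ
  let L : EuclideanSpace ℝ (Fin d) →L[ℝ] EuclideanSpace ℝ (Fin d) := tangentFlow φ T σ
  let g : EuclideanSpace ℝ (Fin d) → EuclideanSpace ℝ (Fin d) := fun y => χ (φ T (χ.symm y))
  have hg : HasFDerivAt g L (χ σ) := by
    have h := (mdifferentiableAt_flow hX hφ T σ).hasMFDerivAt.2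
    rw [writtenInExtChartAt, hfix T] at h
    have h1 : range (𝓡 d) = univ := ModelWithCorners.range_eq_univ _
    rw [h1] at h
    exact hasFDerivWithinAt_univ.1 h
  have hgσ : g (χ σ) = χ σ := by
    simp only [g]
    rw [χ.left_inv (mem_extChartAt_source σ), hfix]
  let S : Submodule ℝ (EuclideanSpace ℝ (Fin d)) := Es σ
  let U : Submodule ℝ (EuclideanSpace ℝ (Fin d)) := Eu σ
  have hSU : IsCompl U S := hcompl.symm
  -- `φ T σ` and `σ` are equal but not by definition, so bundles and norms are transported
  have htr : ∀ (G : ∀ x : M, Submodule ℝ (TangentSpace (𝓡 d) x)) (y : M), y = σ →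
      ∀ v : EuclideanSpace ℝ (Fin d), v ∈ (show Submodule ℝ (EuclideanSpace ℝ (Fin d)) from G y) →
        v ∈ (show Submodule ℝ (EuclideanSpace ℝ (Fin d)) from G σ) := by
    rintro G y rfl v hv
    exact hv
  have hLS : ∀ v ∈ S, L v ∈ S := fun v hv =>
    htr Es _ (hfix T) _ (by
      have h : tangentFlow φ T σ v ∈ Es (φ T σ) := hEs T ▸ ⟨v, hv, rfl⟩
      exact h)
  have hLU : ∀ v ∈ U, L v ∈ U := fun v hv =>
    htr Eu _ (hfix T) _ (by
      have h : tangentFlow φ T σ v ∈ Eu (φ T σ) := hEu T ▸ ⟨v, hv, rfl⟩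
      exact h)
  have htn : ∀ y : M, y = σ → ∀ v : EuclideanSpace ℝ (Fin d),
      ‖(show TangentSpace (𝓡 d) y from v)‖ = ‖(show TangentSpace (𝓡 d) σ from v)‖ := by
    rintro y rfl v
    rfl
  have hs : ∀ v ∈ S, ‖L v‖ ≤ 1 / 4 * ‖v‖ := fun v hv => by
    have h1 : ‖tangentFlow φ T σ v‖ ≤ C * Real.exp (-r * T) * (κ * ‖v‖) :=
      (norm_apply_le_restrNorm (tangentFlow φ T σ) hv).trans (mul_le_mul (hcs T hT).le
        (hnorm v).2 (norm_nonneg _) (by positivity))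
    have h2 : ‖(show TangentSpace (𝓡 d) σ from L v)‖ ≤ C * Real.exp (-r * T) * (κ * ‖v‖) :=
      (htn _ (hfix T) (L v)).symm.le.trans h1
    calc ‖L v‖ ≤ κ * ‖(show TangentSpace (𝓡 d) σ from L v)‖ := (hnorm (L v)).1
      _ ≤ κ * (C * Real.exp (-r * T) * (κ * ‖v‖)) := mul_le_mul_of_nonneg_left h2 hκ.le
      _ = κ * (C * Real.exp (-r * T)) * κ * ‖v‖ := by ring
      _ ≤ 1 / 4 * ‖v‖ := mul_le_mul_of_nonneg_right hTκ (norm_nonneg _)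
  have hu : ∀ v ∈ U, 4 * ‖v‖ ≤ ‖L v‖ := fun v hv => by
    have h0 : ∀ y : M, σ = y → ∀ w ∈ Eu y, ‖tangentFlow φ (-T) y w‖ ≤
        C * Real.exp (-r * T) * ‖w‖ := by
      rintro _ rfl w hw
      exact (norm_apply_le_restrNorm _ hw).trans
        (mul_le_mul_of_nonneg_right (hcu T hT).le (norm_nonneg _))
    have h1 : ‖tangentFlow φ (-T) (φ T σ) (tangentFlow φ T σ v)‖ ≤
        C * Real.exp (-r * T) * ‖tangentFlow φ T σ v‖ :=
      h0 _ (hfix T).symm _ (hEu T ▸ ⟨v, hv, rfl⟩)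
    have h2 := bundleFlow_add hX hφ T (-T) ⟨σ, v⟩
    rw [add_neg_cancel, bundleFlow_zero hφ] at h2
    have h3 : ‖(show TangentSpace (𝓡 d) σ from v)‖ =
        ‖tangentFlow φ (-T) (φ T σ) (tangentFlow φ T σ v)‖ :=
      congrArg (fun e : TangentBundle (𝓡 d) M => ‖e.2‖) h2
    have h4 : ‖tangentFlow φ T σ v‖ ≤ κ * ‖L v‖ :=
      (htn _ (hfix T) (L v)).le.trans (hnorm (L v)).2
    have h5 : ‖v‖ ≤ 1 / 4 * ‖L v‖ :=
      calc ‖v‖ ≤ κ * ‖(show TangentSpace (𝓡 d) σ from v)‖ := (hnorm v).1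
        _ ≤ κ * (C * Real.exp (-r * T) * (κ * ‖L v‖)) := by
          refine mul_le_mul_of_nonneg_left (h3.le.trans (h1.trans ?_)) hκ.le
          exact mul_le_mul_of_nonneg_left h4 (by positivity)
        _ = κ * (C * Real.exp (-r * T)) * κ * ‖L v‖ := by ring
        _ ≤ 1 / 4 * ‖L v‖ := mul_le_mul_of_nonneg_right hTκ (norm_nonneg _)
    linarith
  let P : EuclideanSpace ℝ (Fin d) →L[ℝ] EuclideanSpace ℝ (Fin d) :=
    LinearMap.toContinuousLinearMap (U.projection S hSU)
  let Q : EuclideanSpace ℝ (Fin d) →L[ℝ] EuclideanSpace ℝ (Fin d) :=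
    LinearMap.toContinuousLinearMap (S.projection U hSU.symm)
  have hPU : ∀ v, P v ∈ U := fun v => Submodule.projection_apply_mem hSU v
  have hQS : ∀ v, Q v ∈ S := fun v => Submodule.projection_apply_mem hSU.symm v
  have hPQ : ∀ v, P v + Q v = v := fun v => Submodule.projection_add_projection_eq_self hSU v
  have hPu : ∀ v ∈ U, P v = v := fun v hv => Submodule.projection_apply_left hSU ⟨v, hv⟩
  have hQs : ∀ v ∈ S, Q v = v := fun v hv => Submodule.projection_apply_left hSU.symm ⟨v, hv⟩
  have hPs : ∀ v ∈ S, P v = 0 := fun v hv => by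
    have := hPQ v; rw [hQs v hv] at this; simpa using this
  have hQu : ∀ v ∈ U, Q v = 0 := fun v hv => by
    have := hPQ v; rw [hPu v hv] at this; simpa using this
  obtain ⟨ρ, hρ, hmain⟩ := exists_forall_orbit_eq_fixedPoint (P := P) (Q := Q) (L := L) hPQ
    (fun v => by
      conv_lhs => rw [← hPQ v, map_add L, map_add P, hPu _ (hLU _ (hPU v)), hPs _ (hLS _ (hQS v)),
        add_zero])
    (fun v => by
      conv_lhs => rw [← hPQ v, map_add L, map_add Q, hQu _ (hLU _ (hPU v)), hQs _ (hLS _ (hQS v)),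
        zero_add])
    (fun v => hu _ (hPU v)) (fun v => hs _ (hQS v)) hg hgσ
  have hW : χ.source ∩ χ ⁻¹' Metric.ball (χ σ) ρ ∈ 𝓝 σ :=
    Filter.inter_mem (extChartAt_source_mem_nhds (I := 𝓡 d) σ)
      ((continuousAt_extChartAt (I := 𝓡 d) σ) (Metric.ball_mem_nhds _ hρ))
  obtain ⟨K, hK, hKc, hKW⟩ := exists_mem_nhds_isClosed_subset hW
  refine ⟨interior K, isOpen_interior, mem_interior_iff_mem_nhds.2 hK, fun x hx => ?_⟩
  have hx' : ∀ t, φ t x ∈ χ.source ∩ χ ⁻¹' Metric.ball (χ σ) ρ := fun t =>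
    hKW (closure_minimal interior_subset hKc (hx t))
  have h1 := hmain (fun n : ℤ => χ (φ (n * T) x)) (fun n => by
    simp only [g]
    rw [χ.left_inv (hx' _).1, ← flow_add hX hφ]
    congr 2
    push_cast
    ring) (fun n => (hx' _).2)
  simp only [Int.cast_zero, zero_mul, (hφ x).1] at h1
  have h2 := (hx' 0).1
  rw [(hφ x).1] at h2
  exact χ.injOn h2 (mem_extChartAt_source σ) h1

end HyperbolicSingularity

/-! ### Pragmatical cocycles -/

section PragmaticalCocycles

variable {d : ℕ} {M : Type*} [TopologicalSpace M] [ChartedSpace (EuclideanSpace ℝ (Fin d)) M]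
  [RiemannianBundle (fun x : M => TangentSpace (𝓡 d) x)]
  {φ : ℝ → M → M} {X : ∀ x : M, TangentSpace (𝓡 d) x} {Λ : Set M}

open Classical in
/-- The speed `‖X‖` on `U`, and the constant `c` off `U`. -/
noncomputable def cutoffSpeed (X : ∀ x : M, TangentSpace (𝓡 d) x) (U : Set M) (c : ℝ) (x : M) : ℝ :=
  if x ∈ U then ‖X x‖ else c

open Classical in
/-- The coboundary of the cutoff speed over the regular points. Over `σ`, where the speed vanishes,
it is completed by the growth of the tangent flow. -/
noncomputable def speedCocycle (φ : ℝ → M → M) (X : ∀ x : M, TangentSpace (𝓡 d) x) (σ : M)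
    (U : Set M) (c : ℝ) (e : TangentBundle (𝓡 d) M) (t : ℝ) : ℝ :=
  if e.proj = σ then ‖tangentFlow φ t e.proj e.2‖
  else cutoffSpeed X U c (φ t e.proj) / cutoffSpeed X U c e.proj

lemma cutoffSpeed_pos {U : Set M} {σ x : M} {c : ℝ} (hc : 0 < c)
    (hU : ∀ y ∈ U, X y = 0 → y = σ) (hx : x ≠ σ) : 0 < cutoffSpeed X U c x := by
  rw [cutoffSpeed]
  split_ifs with h
  · exact norm_pos_iff.2 fun h0 => hx (hU x h h0)
  · exact hc

/-- Where the isolating neighborhoods contain all points of small speed, the product of the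
normalized cutoff speeds is the truncation of the speed at `c`. -/
lemma prod_cutoffSpeed_div_eq {s : Finset M} {U : M → Set M} {c : ℝ} (hc : 0 < c)
    (hUc : ∀ σ ∈ s, ∀ x ∈ U σ, ‖X x‖ < c)
    (hdisj : ∀ σ ∈ s, ∀ τ ∈ s, σ ≠ τ → Disjoint (U σ) (U τ)) {x : M}
    (hx : ‖X x‖ < c → ∃ σ ∈ s, x ∈ U σ) :
    ∏ σ ∈ s, cutoffSpeed X (U σ) c x / c = min ‖X x‖ c / c := by
  by_cases h : ∃ σ ∈ s, x ∈ U σ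
  · obtain ⟨σ, hσ, hxσ⟩ := h
    rw [Finset.prod_eq_single_of_mem σ hσ, cutoffSpeed, if_pos hxσ,
      min_eq_left (hUc σ hσ x hxσ).le]
    intro τ hτ hne
    rw [cutoffSpeed, if_neg fun hxτ => disjoint_left.1 (hdisj τ hτ σ hσ hne) hxτ hxσ,
      div_self hc.ne']
  · rw [Finset.prod_eq_one, min_eq_right (not_lt.1 fun h' => h (hx h')), div_self hc.ne']
    intro σ hσ
    rw [cutoffSpeed, if_neg fun hxσ => h ⟨σ, hσ, hxσ⟩, div_self hc.ne']

variable [IsManifold (𝓡 d) ∞ M]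

/-- The empty product is a reparametrizing cocycle. -/
lemma isReparametrizing_one : IsReparametrizing φ X Λ fun _ _ => 1 :=
  ⟨∅, fun _ => ∅, fun _ _ _ => 1, by simp, by simp, by simp⟩

lemma continuousOn_cutoffSpeed [IsContMDiffRiemannianBundle (𝓡 d) ∞
      (EuclideanSpace ℝ (Fin d)) (fun x : M => TangentSpace (𝓡 d) x)]
    (hX : ContMDiff (𝓡 d) (𝓡 d).tangent 1 (fun x => (⟨x, X x⟩ : TangentBundle (𝓡 d) M)))
    {U : Set M} {c : ℝ} (hUo : IsOpen U) (hUc : ∀ x ∈ U, ‖X x‖ < c)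
    (hsep : ∀ x ∈ Λ, x ∉ U → ‖X x‖ < c → Uᶜ ∈ 𝓝 x) :
    ContinuousOn (cutoffSpeed X U c) Λ := by
  intro x hx
  refine ContinuousAt.continuousWithinAt ?_
  by_cases hxU : x ∈ U
  · refine (continuous_norm_field hX).continuousAt.congr ?_
    filter_upwards [hUo.mem_nhds hxU] with y hy
    rw [cutoffSpeed, if_pos hy]
  · have hval : cutoffSpeed X U c x = c := if_neg hxU
    rcases lt_or_ge ‖X x‖ c with h | h
    · refine continuousAt_const.congr (f := fun _ => c) ?_
      filter_upwards [hsep x hx hxU h] with y hy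
      rw [cutoffSpeed, if_neg hy]
    · -- here the cutoff speed is squeezed between `min ‖X‖ c` and `c`
      rw [ContinuousAt, hval]
      have h1 : Filter.Tendsto (fun y => min ‖X y‖ c) (𝓝 x) (𝓝 c) := by
        have := ((continuous_norm_field hX).min (continuous_const (y := c))).tendsto x
        rwa [min_eq_right h] at this
      refine tendsto_of_tendsto_of_tendsto_of_le_of_le h1 tendsto_const_nhds (fun y => ?_)
        fun y => ?_
      · change min ‖X y‖ c ≤ cutoffSpeed X U c y
        rw [cutoffSpeed]
        split_ifs
        · exact min_le_left _ _
        · exact min_le_right _ _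
      · change cutoffSpeed X U c y ≤ c
        rw [cutoffSpeed]
        split_ifs with hy
        · exact (hUc y hy).le
        · exact le_rfl

variable [T2Space M] [CompactSpace M]

lemma norm_tangentFlow_add
    (hX : ContMDiff (𝓡 d) (𝓡 d).tangent 1 (fun x => (⟨x, X x⟩ : TangentBundle (𝓡 d) M)))
    (hφ : IsFlowOf φ X) (s t : ℝ) {e : TangentBundle (𝓡 d) M} (he : e.2 ≠ 0) :
    ‖tangentFlow φ (s + t) e.proj e.2‖ = ‖tangentFlow φ s e.proj e.2‖ *
      ‖tangentFlow φ t (sphereFlow φ s e).proj (sphereFlow φ s e).2‖ := by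
  have h0 : ‖tangentFlow φ s e.proj e.2‖ ≠ 0 :=
    norm_ne_zero_iff.2 (tangentFlow_ne_zero hX hφ s he)
  have h1 : ‖tangentFlow φ (s + t) e.proj e.2‖ =
      ‖tangentFlow φ t (φ s e.proj) (tangentFlow φ s e.proj e.2)‖ :=
    congrArg (fun e : TangentBundle (𝓡 d) M => ‖e.2‖) (bundleFlow_add hX hφ s t e)
  have h2 : ‖tangentFlow φ t (sphereFlow φ s e).proj (sphereFlow φ s e).2‖ =
      ‖tangentFlow φ s e.proj e.2‖⁻¹ *
        ‖tangentFlow φ t (φ s e.proj) (tangentFlow φ s e.proj e.2)‖ := by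
    change ‖tangentFlow φ t (φ s e.proj)
      (‖tangentFlow φ s e.proj e.2‖⁻¹ • tangentFlow φ s e.proj e.2)‖ = _
    rw [map_smul, norm_smul, norm_inv, norm_norm]
  rw [h1, h2, mul_inv_cancel_left₀ h0]

variable [IsContMDiffRiemannianBundle (𝓡 d) ∞ (EuclideanSpace ℝ (Fin d))
      (fun x : M => TangentSpace (𝓡 d) x)]

lemma speedCocycle_eq_norm_of_mem
    (hX : ContMDiff (𝓡 d) (𝓡 d).tangent 1 (fun x => (⟨x, X x⟩ : TangentBundle (𝓡 d) M)))
    (hφ : IsFlowOf φ X) {σ : M} {U : Set M} {c : ℝ} (hU : ∀ y ∈ U, X y = 0 → y = σ)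
    {e : TangentBundle (𝓡 d) M} (he : e ∈ extendedSet X Λ) {t : ℝ} (h1 : e.proj ∈ U)
    (h2 : φ t e.proj ∈ U) : speedCocycle φ X σ U c e t = ‖tangentFlow φ t e.proj e.2‖ := by
  rw [speedCocycle]
  split_ifs with h
  · rfl
  · rw [cutoffSpeed, cutoffSpeed, if_pos h1, if_pos h2, ← norm_tangentFlow_unitDir hX hφ]
    have h3 := eq_unitDir_of_mem_extendedSet hX he fun h0 => h (hU _ h1 h0)
    exact (congrArg (fun e' : TangentBundle (𝓡 d) M => ‖tangentFlow φ t e'.proj e'.2‖) h3).symm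

lemma isPragmatical_speedCocycle
    (hX : ContMDiff (𝓡 d) (𝓡 d).tangent 1 (fun x => (⟨x, X x⟩ : TangentBundle (𝓡 d) M)))
    (hφ : IsFlowOf φ X) (hΛ : IsCompact Λ) (hinv : IsInvariant φ Λ)
    {σ : M} {U : Set M} {c : ℝ} (hc : 0 < c) (hσ : X σ = 0) (hiso : IsIsolatingNhd φ U σ)
    (hUo : IsOpen U) (hUc : ∀ x ∈ U, ‖X x‖ < c)
    (hsep : ∀ x ∈ Λ, x ∉ U → ‖X x‖ < c → Uᶜ ∈ 𝓝 x) :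
    IsPragmatical φ X Λ σ U (speedCocycle φ X σ U c) := by
  have hU : ∀ y ∈ U, X y = 0 → y = σ := fun y hy hy0 => by
    have h : y ∈ {x | ∀ t, φ t x ∈ closure U} := fun t => by
      rw [flow_eq_self hX hφ hy0]
      exact subset_closure hy
    rw [hiso.2] at h
    exact h
  have hσU : σ ∈ U := mem_of_mem_nhds hiso.1
  have hfix := flow_eq_self hX hφ hσ
  have hiff : ∀ t x, φ t x = σ ↔ x = σ := fun t x => by
    constructor
    · intro h
      exact flow_injective hX hφ t (h.trans (hfix t).symm)
    · rintro rfl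
      exact hfix t
  have he0 : ∀ e ∈ extendedSet X Λ, e.2 ≠ 0 := fun e he => norm_ne_zero_iff.1
    (by rw [norm_eq_one_of_mem_extendedSet he]; exact one_ne_zero)
  have hp : Continuous fun e : TangentBundle (𝓡 d) M => e.proj := FiberBundle.continuous_proj _ _
  have hflow : Continuous fun q : TangentBundle (𝓡 d) M × ℝ => φ q.2 q.1.proj :=
    (continuous_flow hX hφ).comp (continuous_snd.prodMk (hp.comp continuous_fst))
  have hcut := continuousOn_cutoffSpeed hX hUo hUc hsep
  refine ⟨⟨?_, fun e he t => ?_, fun e he s t => ?_⟩, hσ, hiso, fun e he t h1 h2 =>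
    speedCocycle_eq_norm_of_mem hX hφ hU he h1 h2, fun e he t h1 h2 => ?_⟩
  · rintro ⟨e₀, t₀⟩ ⟨he₀, -⟩
    have hself : ∀ᶠ q : TangentBundle (𝓡 d) M × ℝ in 𝓝[extendedSet X Λ ×ˢ univ] (e₀, t₀),
        q ∈ extendedSet X Λ ×ˢ univ := self_mem_nhdsWithin
    by_cases h : e₀.proj = σ
    · have hn : ContinuousAt (fun q : TangentBundle (𝓡 d) M × ℝ =>
          ‖tangentFlow φ q.2 q.1.proj q.1.2‖) (e₀, t₀) :=
        (continuous_norm_tangentBundle.comp ((continuous_bundleFlow hX hφ).comp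
          (continuous_snd.prodMk continuous_fst))).continuousAt
      have h1 : ∀ᶠ q : TangentBundle (𝓡 d) M × ℝ in 𝓝 (e₀, t₀), q.1.proj ∈ U :=
        (hp.comp continuous_fst).continuousAt (hUo.mem_nhds (by
          change e₀.proj ∈ U
          rwa [h]))
      have h2 : ∀ᶠ q : TangentBundle (𝓡 d) M × ℝ in 𝓝 (e₀, t₀), φ q.2 q.1.proj ∈ U :=
        hflow.continuousAt (hUo.mem_nhds (by
          change φ t₀ e₀.proj ∈ U
          rwa [h, hfix]))
      refine hn.continuousWithinAt.congr_of_eventuallyEq ?_ ?_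
      · filter_upwards [hself, nhdsWithin_le_nhds h1, nhdsWithin_le_nhds h2] with q hq hq1 hq2
        exact speedCocycle_eq_norm_of_mem hX hφ hU hq.1 hq1 hq2
      · exact if_pos h
    · have h1 : ∀ᶠ q : TangentBundle (𝓡 d) M × ℝ in 𝓝 (e₀, t₀), q.1.proj ≠ σ :=
        (isOpen_ne.preimage (hp.comp continuous_fst)).mem_nhds h
      have hnum : ContinuousWithinAt (fun q : TangentBundle (𝓡 d) M × ℝ =>
          cutoffSpeed X U c (φ q.2 q.1.proj)) (extendedSet X Λ ×ˢ univ) (e₀, t₀) :=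
        ContinuousWithinAt.comp (t := Λ) (g := cutoffSpeed X U c)
          (hcut _ (hinv t₀ (proj_mem_of_mem_extendedSet hΛ he₀))) hflow.continuousWithinAt
          fun q hq => hinv q.2 (proj_mem_of_mem_extendedSet hΛ hq.1)
      have hden : ContinuousWithinAt (fun q : TangentBundle (𝓡 d) M × ℝ =>
          cutoffSpeed X U c q.1.proj) (extendedSet X Λ ×ˢ univ) (e₀, t₀) :=
        ContinuousWithinAt.comp (t := Λ) (g := cutoffSpeed X U c)
          (hcut _ (proj_mem_of_mem_extendedSet hΛ he₀)) (hp.comp continuous_fst).continuousWithinAt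
          fun q hq => proj_mem_of_mem_extendedSet hΛ hq.1
      refine (hnum.div hden (cutoffSpeed_pos hc hU h).ne').congr_of_eventuallyEq ?_ ?_
      · filter_upwards [nhdsWithin_le_nhds h1] with q hq
        exact if_neg hq
      · exact if_neg h
  · rw [speedCocycle]
    split_ifs with h
    · exact norm_pos_iff.2 (tangentFlow_ne_zero hX hφ t (he0 e he))
    · exact div_pos (cutoffSpeed_pos hc hU fun h' => h ((hiff t _).1 h')) (cutoffSpeed_pos hc hU h)
  · by_cases h : e.proj = σ
    · have h' : (sphereFlow φ s e).proj = σ := (hiff s _).2 h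
      rw [speedCocycle, speedCocycle, speedCocycle, if_pos h, if_pos h, if_pos h']
      exact norm_tangentFlow_add hX hφ s t (he0 e he)
    · have h' : (sphereFlow φ s e).proj ≠ σ := fun h' => h ((hiff s _).1 h')
      rw [speedCocycle, speedCocycle, speedCocycle, if_neg h, if_neg h, if_neg h',
        flow_add hX hφ]
      have h1 := (cutoffSpeed_pos (c := c) hc hU h').ne'
      have h2 := (cutoffSpeed_pos (c := c) hc hU h).ne'
      change _ = _ * (cutoffSpeed X U c (φ t (φ s e.proj)) / cutoffSpeed X U c (φ s e.proj))
      change cutoffSpeed X U c (φ s e.proj) ≠ 0 at h1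
      field_simp
  · have h : e.proj ≠ σ := fun h => h1 (h ▸ hσU)
    have h2' : φ t e.proj ∉ U := h2
    rw [speedCocycle, if_neg h, cutoffSpeed, cutoffSpeed, if_neg h1, if_neg h2', div_self hc.ne']

end PragmaticalCocycles

/-! ### The reparametrizing cocycle -/

section ReparametrizingCocycle

variable {d : ℕ} {M : Type*} [TopologicalSpace M] [ChartedSpace (EuclideanSpace ℝ (Fin d)) M]
  [IsManifold (𝓡 d) ∞ M] [RiemannianBundle (fun x : M => TangentSpace (𝓡 d) x)]
  [T2Space M] [CompactSpace M] [IsContMDiffRiemannianBundle (𝓡 d) ∞ (EuclideanSpace ℝ (Fin d))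
      (fun x : M => TangentSpace (𝓡 d) x)]
  {φ : ℝ → M → M} {X : ∀ x : M, TangentSpace (𝓡 d) x} {Λ : Set M}

/-- If the singularities in `Λ` are hyperbolic, they are finitely many, and they have disjoint
isolating neighborhoods, the union of which contains the points of `Λ` with speed less than some
`c > 0`. -/
lemma exists_isolating_nhds
    (hX : ContMDiff (𝓡 d) (𝓡 d).tangent 1 (fun x => (⟨x, X x⟩ : TangentBundle (𝓡 d) M)))
    (hφ : IsFlowOf φ X) (hΛ : IsCompact Λ)
    (hhyp : ∀ σ ∈ Λ ∩ singSet X, IsHyperbolicSingularity φ X σ) :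
    ∃ (s : Finset M) (U : M → Set M), ∃ c > 0, (s : Set M) = Λ ∩ singSet X ∧
      (∀ σ ∈ s, IsOpen (U σ) ∧ IsIsolatingNhd φ (U σ) σ ∧ ∀ x ∈ U σ, ‖X x‖ < c) ∧
      (∀ σ ∈ s, ∀ τ ∈ s, σ ≠ τ → Disjoint (U σ) (U τ)) ∧
      ∀ x ∈ Λ, ‖X x‖ < c → ∃ σ ∈ s, x ∈ U σ := by
  choose! V hVo hσV hV using fun σ (hσ : σ ∈ Λ ∩ singSet X) =>
    exists_isOpen_forall_flow_mem_closure_eq hX hφ (hhyp σ hσ)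
  have hcl : IsClosed (singSet X) := by
    have h : singSet X = {x | ‖X x‖ = 0} := by
      ext x
      exact norm_eq_zero.symm
    rw [h]
    exact isClosed_eq (continuous_norm_field hX) continuous_const
  have hfin : (Λ ∩ singSet X).Finite := by
    obtain ⟨t, ht, htV⟩ := (hΛ.inter_right hcl).elim_nhds_subcover V
      fun σ hσ => (hVo σ hσ).mem_nhds (hσV σ hσ)
    refine t.finite_toSet.subset fun x hx => ?_
    obtain ⟨σ, hσ, hxσ⟩ := mem_iUnion₂.1 (htV hx)
    have h := hV σ (ht σ hσ) x fun t => by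
      rw [flow_eq_self hX hφ hx.2]
      exact subset_closure hxσ
    rw [h]
    exact hσ
  obtain ⟨D, hD, hDd⟩ := hfin.t2_separation
  have hWo : ∀ σ ∈ Λ ∩ singSet X, IsOpen (V σ ∩ D σ) := fun σ hσ => (hVo σ hσ).inter (hD σ).2
  have hcomp : IsCompact (Λ \ ⋃ σ ∈ Λ ∩ singSet X, V σ ∩ D σ) :=
    hΛ.diff (isOpen_biUnion hWo)
  obtain ⟨c, hc, hcle⟩ := hcomp.exists_forall_le' (continuous_norm_field hX).continuousOn
    (a := 0) fun x hx => norm_pos_iff.2 fun h0 => hx.2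
      (mem_biUnion (x := x) ⟨hx.1, h0⟩ ⟨hσV x ⟨hx.1, h0⟩, (hD x).1⟩)
  refine ⟨hfin.toFinset, fun σ => V σ ∩ D σ ∩ {x | ‖X x‖ < c}, c, hc, hfin.coe_toFinset,
    fun σ hσ => ?_, fun σ hσ τ hτ hne => ?_, fun x hx hxc => ?_⟩
  · rw [hfin.mem_toFinset] at hσ
    have hopen : IsOpen (V σ ∩ D σ ∩ {x | ‖X x‖ < c}) :=
      (hWo σ hσ).inter (isOpen_lt (continuous_norm_field hX) continuous_const)
    have hmem : σ ∈ V σ ∩ D σ ∩ {x | ‖X x‖ < c} := by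
      refine ⟨⟨hσV σ hσ, (hD σ).1⟩, ?_⟩
      have h0 : X σ = 0 := hσ.2
      rw [mem_ofPred_eq, h0, norm_zero]
      exact hc
    refine ⟨hopen, ⟨hopen.mem_nhds hmem, ?_⟩, fun x hx => hx.2⟩
    ext x
    constructor
    · exact fun hx => hV σ hσ x fun t => closure_mono (fun y hy => hy.1.1) (hx t)
    · rintro rfl t
      rw [flow_eq_self hX hφ hσ.2]
      exact subset_closure hmem
  · rw [hfin.mem_toFinset] at hσ hτ
    exact (hDd hσ hτ hne).mono (fun x hx => hx.1.2) fun x hx => hx.1.2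
  · by_contra! hcon
    refine hxc.not_ge (hcle x ⟨hx, fun hxW => ?_⟩)
    obtain ⟨σ, hσ, hxσ⟩ := mem_iUnion₂.1 hxW
    exact hcon σ (hfin.mem_toFinset.2 hσ) ⟨hxσ, hxc⟩

/-- There is a reparametrizing cocycle that is at most a constant times the growth of the vectors
of the extended set. -/
lemma exists_isReparametrizing_le
    (hX : ContMDiff (𝓡 d) (𝓡 d).tangent 1 (fun x => (⟨x, X x⟩ : TangentBundle (𝓡 d) M)))
    (hφ : IsFlowOf φ X) (hΛ : IsCompact Λ) (hinv : IsInvariant φ Λ)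
    (hhyp : ∀ σ ∈ Λ ∩ singSet X, IsHyperbolicSingularity φ X σ) :
    ∃ h : TangentBundle (𝓡 d) M → ℝ → ℝ, ∃ K : ℝ, 1 ≤ K ∧ IsReparametrizing φ X Λ h ∧
      ∀ e ∈ extendedSet X Λ, ∀ t, 0 ≤ h e t ∧ h e t ≤ K * ‖tangentFlow φ t e.proj e.2‖ := by
  obtain ⟨s, U, c, hc, hs, hU, hdisj, hcov⟩ := exists_isolating_nhds hX hφ hΛ hhyp
  obtain ⟨B, hB⟩ := isCompact_univ.exists_bound_of_continuousOn
    (continuous_norm_field hX).continuousOn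
  have hmem : ∀ x, x ∈ s ↔ x ∈ Λ ∩ singSet X := fun x => by rw [← hs, Finset.mem_coe]
  have hprag : ∀ σ ∈ s, IsPragmatical φ X Λ σ (U σ) (speedCocycle φ X σ (U σ) c) := by
    intro σ hσ
    refine isPragmatical_speedCocycle hX hφ hΛ hinv hc ((hmem σ).1 hσ).2 (hU σ hσ).2.1
      (hU σ hσ).1 (hU σ hσ).2.2 fun x hx hxU hxc => ?_
    obtain ⟨τ, hτ, hxτ⟩ := hcov x hx hxc
    have hne : τ ≠ σ := by
      rintro rfl
      exact hxU hxτ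
    exact Filter.mem_of_superset ((hU τ hτ).1.mem_nhds hxτ)
      (hdisj τ hτ σ hσ hne).subset_compl_right
  refine ⟨fun e t => ∏ σ ∈ s, speedCocycle φ X σ (U σ) c e t, max 1 (B / c), le_max_left _ _,
    ⟨s, U, _, hprag, hdisj, fun e _ t => rfl⟩, fun e he t =>
    ⟨Finset.prod_nonneg fun σ hσ => ((hprag σ hσ).cocycle.pos e he t).le, ?_⟩⟩
  have heΛ := proj_mem_of_mem_extendedSet hΛ he
  beta_reduce
  by_cases hsing : e.proj ∈ singSet X
  · -- over a singularity only its own factor is not constant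
    have hes : e.proj ∈ s := (hmem _).2 ⟨heΛ, hsing⟩
    have h1 : ∏ σ ∈ s, speedCocycle φ X σ (U σ) c e t = ‖tangentFlow φ t e.proj e.2‖ := by
      rw [Finset.prod_eq_single_of_mem _ hes, speedCocycle, if_pos rfl]
      intro σ hσ hne
      rw [speedCocycle, if_neg hne.symm, flow_eq_self hX hφ hsing]
      refine div_self (cutoffSpeed_pos hc (fun y hy hy0 => ?_) hne.symm).ne'
      have h2 : y ∈ {x | ∀ t, φ t x ∈ closure (U σ)} := fun t => by
        rw [flow_eq_self hX hφ hy0]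
        exact subset_closure hy
      rw [(hU σ hσ).2.1.2] at h2
      exact h2
    rw [h1]
    exact le_mul_of_one_le_left (norm_nonneg _) (le_max_left _ _)
  · have hne : ∀ σ ∈ s, e.proj ≠ σ := fun σ hσ h => hsing (h ▸ ((hmem σ).1 hσ).2)
    have hn : 0 < ‖X e.proj‖ := norm_pos_iff.2 hsing
    have h1 : ∏ σ ∈ s, speedCocycle φ X σ (U σ) c e t =
        min ‖X (φ t e.proj)‖ c / min ‖X e.proj‖ c := by
      have h2 := prod_cutoffSpeed_div_eq (X := X) hc (fun σ hσ => (hU σ hσ).2.2) hdisj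
        (hcov _ (hinv t heΛ))
      have h3 := prod_cutoffSpeed_div_eq (X := X) hc (fun σ hσ => (hU σ hσ).2.2) hdisj
        (hcov _ heΛ)
      rw [← div_div_div_cancel_right₀ hc.ne', ← h2, ← h3, ← Finset.prod_div_distrib]
      refine Finset.prod_congr rfl fun σ hσ => ?_
      rw [speedCocycle, if_neg (hne σ hσ), div_div_div_cancel_right₀ hc.ne']
    have h4 : ‖tangentFlow φ t e.proj e.2‖ = ‖X (φ t e.proj)‖ / ‖X e.proj‖ :=
      (congrArg (fun e' : TangentBundle (𝓡 d) M => ‖tangentFlow φ t e'.proj e'.2‖)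
        (eq_unitDir_of_mem_extendedSet hX he hsing)).trans (norm_tangentFlow_unitDir hX hφ t _)
    have h5 : ‖X e.proj‖ ≤ max 1 (B / c) * min ‖X e.proj‖ c := by
      rcases le_total ‖X e.proj‖ c with h | h
      · rw [min_eq_left h]
        exact le_mul_of_one_le_left hn.le (le_max_left _ _)
      · have h6 := hB e.proj trivial
        rw [norm_norm] at h6
        rw [min_eq_right h]
        exact (h6.trans (div_mul_cancel₀ B hc.ne').symm.le).trans
          (mul_le_mul_of_nonneg_right (le_max_right _ _) hc.le)
    rw [h1, h4, ← mul_div_assoc, div_le_div_iff₀ (lt_min hn hc) hn, mul_right_comm, mul_comm]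
    exact mul_le_mul h5 (min_le_left _ _) (le_min (norm_nonneg _) hc.le)
      (hn.le.trans h5)

end ReparametrizingCocycle

/-! ### Time reversal -/

section TimeReversal

variable {d : ℕ} {M : Type*} [TopologicalSpace M] [ChartedSpace (EuclideanSpace ℝ (Fin d)) M]

/-- The opposite tangent vector, at the same base point. -/
noncomputable def oppositeVector (e : TangentBundle (𝓡 d) M) : TangentBundle (𝓡 d) M :=
  ⟨e.proj, -e.2⟩

lemma continuous_oppositeVector [IsManifold (𝓡 d) ∞ M] :
    Continuous (oppositeVector : TangentBundle (𝓡 d) M → TangentBundle (𝓡 d) M) := by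
  rw [← continuousOn_univ]
  intro e _
  have h := ContinuousWithinAt.tangent_smul (c := fun _ => (-1 : ℝ)) continuousWithinAt_const
    (continuousWithinAt_id (s := univ) (x := e))
  refine h.congr (fun e' _ => ?_) ?_ <;>
  exact congrArg (fun w => (⟨_, w⟩ : TangentBundle (𝓡 d) M)) (neg_one_smul ℝ _).symm

variable [RiemannianBundle (fun x : M => TangentSpace (𝓡 d) x)] {φ : ℝ → M → M}
  {X : ∀ x : M, TangentSpace (𝓡 d) x} {Λ : Set M}

lemma sphereFlow_oppositeVector (t : ℝ) (e : TangentBundle (𝓡 d) M) :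
    sphereFlow φ t (oppositeVector e) = oppositeVector (sphereFlow φ t e) := by
  have h : ‖tangentFlow φ t e.proj (-e.2)‖⁻¹ • tangentFlow φ t e.proj (-e.2) =
      -(‖tangentFlow φ t e.proj e.2‖⁻¹ • tangentFlow φ t e.proj e.2) := by
    rw [map_neg, norm_neg, smul_neg]
  exact congrArg (fun w => (⟨φ t e.proj, w⟩ : TangentBundle (𝓡 d) M)) h

lemma normalProj_neg {x : M} (w : TangentSpace (𝓡 d) x) : normalProj x (-w) = normalProj x w := by
  rw [← neg_one_smul ℝ w]
  exact normalProj_smul (neg_ne_zero.2 one_ne_zero) w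

lemma extPoincareFlow_oppositeVector (t : ℝ) (e : TangentBundle (𝓡 d) M) :
    extPoincareFlow φ t (oppositeVector e) = extPoincareFlow φ t e := by
  have h : ‖tangentFlow φ t e.proj (-e.2)‖⁻¹ • tangentFlow φ t e.proj (-e.2) =
      -(‖tangentFlow φ t e.proj e.2‖⁻¹ • tangentFlow φ t e.proj e.2) := by
    rw [map_neg, norm_neg, smul_neg]
  change (normalProj (φ t e.proj) (‖tangentFlow φ t e.proj (-e.2)‖⁻¹ •
    tangentFlow φ t e.proj (-e.2))).comp (tangentFlow φ t e.proj) = (normalProj (φ t e.proj)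
      (‖tangentFlow φ t e.proj e.2‖⁻¹ • tangentFlow φ t e.proj e.2)).comp (tangentFlow φ t e.proj)
  rw [h, normalProj_neg]

/-- A family over the tangent bundle has the same value at `Φ_t^#(-e)` and at `-Φ_t^#(e)`. Both have
the base point `φ t e.proj` by definition, so that the values have the same type. -/
lemma apply_oppositeVector_sphereFlow (Z : M → Type*) (g : ∀ e : TangentBundle (𝓡 d) M, Z e.proj)
    (t : ℝ) (e : TangentBundle (𝓡 d) M) :
    (g (sphereFlow φ t (oppositeVector e)) : Z (φ t e.proj)) =
      g (oppositeVector (sphereFlow φ t e)) := by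
  have h1 := eq_of_heq (TotalSpace.mk.inj (sphereFlow_oppositeVector (φ := φ) t e)).2
  have h2 : ∀ w w' : TangentSpace (𝓡 d) (φ t e.proj), w = w' →
      (g ⟨φ t e.proj, w⟩ : Z (φ t e.proj)) = g ⟨φ t e.proj, w'⟩ := by
    rintro w _ rfl
    rfl
  exact h2 _ _ h1

variable [IsManifold (𝓡 d) ∞ M]

lemma oppositeVector_mem_extendedSet {e : TangentBundle (𝓡 d) M} (he : e ∈ extendedSet X Λ) :
    oppositeVector e ∈ extendedSet (fun x => -X x) Λ := by
  refine continuous_oppositeVector.continuousAt.continuousWithinAt.mem_closure he ?_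
  rintro _ ⟨x, hx, rfl⟩
  refine ⟨x, ⟨hx.1, fun h => hx.2 (neg_eq_zero.1 h)⟩, ?_⟩
  have h : ‖-X x‖⁻¹ • -X x = -(‖X x‖⁻¹ • X x) := by rw [norm_neg, smul_neg]
  exact congrArg (fun w => (⟨x, w⟩ : TangentBundle (𝓡 d) M)) h

lemma IsPragmatical.timeReversal {σ : M} {U : Set M} {h : TangentBundle (𝓡 d) M → ℝ → ℝ}
    (H : IsPragmatical (fun t => φ (-t)) (fun x => -X x) Λ σ U h) :
    IsPragmatical φ X Λ σ U fun e t => h (oppositeVector e) (-t) := by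
  refine ⟨⟨?_, fun e he t => H.cocycle.pos _ (oppositeVector_mem_extendedSet he) _,
    fun e he s t => ?_⟩, neg_eq_zero.1 H.sing, ⟨H.isolating.1, ?_⟩, fun e he t h1 h2 => ?_,
    fun e he t h1 h2 => ?_⟩
  · refine H.cocycle.continuousOn.comp (f := fun q : TangentBundle (𝓡 d) M × ℝ =>
      (oppositeVector q.1, -q.2)) ?_ fun q hq => ⟨oppositeVector_mem_extendedSet hq.1, trivial⟩
    exact ((continuous_oppositeVector.comp continuous_fst).prodMk continuous_snd.neg).continuousOn
  · have h1 := H.cocycle.add _ (oppositeVector_mem_extendedSet he) (-s) (-t)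
    have h2 : sphereFlow (fun t => φ (-t)) (-s) (oppositeVector e) =
        oppositeVector (sphereFlow φ s e) := by
      refine Eq.trans ?_ (sphereFlow_oppositeVector s e)
      change sphereFlow φ (- -s) _ = _
      rw [neg_neg]
    rw [neg_add, h1, h2]
  · refine Eq.trans ?_ H.isolating.2
    ext x
    exact ⟨fun hx t => hx (-t), fun hx t => by
      have h1 : φ (- -t) x ∈ closure U := hx (-t)
      rwa [neg_neg] at h1⟩
  · have h3 := H.inside _ (oppositeVector_mem_extendedSet he) (-t) h1
    have h4 : φ (- -t) e.proj ∈ U := by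
      rw [neg_neg]
      exact h2
    refine (h3 h4).trans ?_
    change ‖tangentFlow φ (- -t) e.proj (-e.2)‖ = ‖tangentFlow φ t e.proj e.2‖
    rw [neg_neg, map_neg, norm_neg]
  · refine H.outside _ (oppositeVector_mem_extendedSet he) (-t) h1 ?_
    change φ (- -t) e.proj ∉ U
    rw [neg_neg]
    exact h2

lemma IsReparametrizing.timeReversal {h : TangentBundle (𝓡 d) M → ℝ → ℝ}
    (H : IsReparametrizing (fun t => φ (-t)) (fun x => -X x) Λ h) :
    IsReparametrizing φ X Λ fun e t => h (oppositeVector e) (-t) := by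
  obtain ⟨s, U, k, hk, hU, hprod⟩ := H
  exact ⟨s, U, _, fun σ hσ => (hk σ hσ).timeReversal, hU,
    fun e he t => hprod _ (oppositeVector_mem_extendedSet he) _⟩

lemma IsContinuousSubbundle.comp_oppositeVector
    {Δ : ∀ e : TangentBundle (𝓡 d) M, Submodule ℝ (TangentSpace (𝓡 d) e.proj)}
    (hΔ : IsContinuousSubbundle (fun e : TangentBundle (𝓡 d) M => e.proj)
      (extendedSet (fun x => -X x) Λ) Δ) :
    IsContinuousSubbundle (fun e : TangentBundle (𝓡 d) M => e.proj) (extendedSet X Λ)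
      (fun e => Δ (oppositeVector e)) := by
  intro e₀ he₀
  obtain ⟨V, hV, k, s, hs, hsΔ⟩ := hΔ _ (oppositeVector_mem_extendedSet he₀)
  have hmaps : ∀ e ∈ extendedSet X Λ ∩ oppositeVector ⁻¹' V,
      oppositeVector e ∈ extendedSet (fun x => -X x) Λ ∩ V :=
    fun e he => ⟨oppositeVector_mem_extendedSet he.1, he.2⟩
  refine ⟨oppositeVector ⁻¹' V, continuous_oppositeVector.continuousAt hV, k,
    fun i e => s i (oppositeVector e), fun i => ?_, fun e he => hsΔ _ (hmaps e he)⟩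
  exact ContinuousOn.comp (g := fun e : TangentBundle (𝓡 d) M =>
    (⟨e.proj, s i e⟩ : TangentBundle (𝓡 d) M)) (hs i) continuous_oppositeVector.continuousOn hmaps

variable [T2Space M] [CompactSpace M]

lemma sphereFlow_neg_sphereFlow
    (hX : ContMDiff (𝓡 d) (𝓡 d).tangent 1 (fun x => (⟨x, X x⟩ : TangentBundle (𝓡 d) M)))
    (hφ : IsFlowOf φ X) (t : ℝ) {e : TangentBundle (𝓡 d) M} (he : ‖e.2‖ = 1) :
    sphereFlow φ (-t) (sphereFlow φ t e) = e := by
  have h0 : 0 < ‖tangentFlow φ t e.proj e.2‖ := norm_pos_iff.2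
    (tangentFlow_ne_zero hX hφ t (norm_ne_zero_iff.1 (by rw [he]; exact one_ne_zero)))
  set c := ‖tangentFlow φ t e.proj e.2‖ with hc
  set w := tangentFlow φ (-t) (φ t e.proj) (tangentFlow φ t e.proj e.2) with hw
  have h1 : (⟨φ (-t) (φ t e.proj), w⟩ : TangentBundle (𝓡 d) M) = e := by
    have h := bundleFlow_add hX hφ t (-t) e
    rw [add_neg_cancel, bundleFlow_zero hφ] at h
    exact h.symm
  have h2 : ‖w‖ = 1 := (congrArg (fun e : TangentBundle (𝓡 d) M => ‖e.2‖) h1).trans he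
  have h3 : tangentFlow φ (-t) (φ t e.proj) (c⁻¹ • tangentFlow φ t e.proj e.2) = c⁻¹ • w := by
    rw [map_smul]
  have h4 : ‖tangentFlow φ (-t) (φ t e.proj) (c⁻¹ • tangentFlow φ t e.proj e.2)‖⁻¹ •
      tangentFlow φ (-t) (φ t e.proj) (c⁻¹ • tangentFlow φ t e.proj e.2) = w := by
    rw [h3, norm_smul, h2, mul_one, norm_inv, Real.norm_of_nonneg h0.le, inv_inv, smul_smul,
      mul_inv_cancel₀ h0.ne', one_smul]
  exact (congrArg (fun v => (⟨φ (-t) (φ t e.proj), v⟩ : TangentBundle (𝓡 d) M)) h4).trans h1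

variable [IsContMDiffRiemannianBundle (𝓡 d) ∞ (EuclideanSpace ℝ (Fin d))
      (fun x : M => TangentSpace (𝓡 d) x)]

/-- Reversing time exchanges the two bundles of a multisingular hyperbolic set. As the extended set
of `-X` consists of the opposite vectors, the bundles are moved to those. -/
lemma IsMultisingularHyperbolicWith.timeReversal
    (hX : ContMDiff (𝓡 d) (𝓡 d).tangent 1 (fun x => (⟨x, X x⟩ : TangentBundle (𝓡 d) M)))
    (hφ : IsFlowOf φ X) (hinv : IsInvariant φ Λ)
    {Δs Δu : ∀ e : TangentBundle (𝓡 d) M, Submodule ℝ (TangentSpace (𝓡 d) e.proj)} {C r : ℝ}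
    (H : IsMultisingularHyperbolicWith (fun t => φ (-t)) (fun x => -X x) Λ Δs Δu C r) :
    IsMultisingularHyperbolicWith φ X Λ (fun e => Δu (oppositeVector e))
      (fun e => Δs (oppositeVector e)) C r := by
  have hmap : ∀ (Δ : ∀ e : TangentBundle (𝓡 d) M, Submodule ℝ (TangentSpace (𝓡 d) e.proj)),
      (∀ b ∈ extendedSet (fun x => -X x) Λ, ∀ t, (Δ b).map
        (extPoincareFlow (fun t => φ (-t)) t b).toLinearMap =
          Δ (sphereFlow (fun t => φ (-t)) t b)) →
      ∀ e ∈ extendedSet X Λ, ∀ t, (Δ (oppositeVector e)).map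
        (extPoincareFlow φ t e).toLinearMap = Δ (oppositeVector (sphereFlow φ t e)) := by
    intro Δ hΔ e he t
    have h1 : ∀ s u, u = -s → (Δ (oppositeVector e)).map
        (extPoincareFlow φ u (oppositeVector e)).toLinearMap =
          Δ (sphereFlow φ u (oppositeVector e)) := by
      rintro s _ rfl
      exact hΔ _ (oppositeVector_mem_extendedSet he) s
    have h2 := h1 (-t) t (neg_neg t).symm
    rw [← extPoincareFlow_oppositeVector]
    exact h2.trans (apply_oppositeVector_sphereFlow
      (fun y => Submodule ℝ (TangentSpace (𝓡 d) y)) Δ t e)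
  refine ⟨H.one_lt, H.pos, ⟨H.splitting.continuous_right.comp_oppositeVector,
    H.splitting.continuous_left.comp_oppositeVector, fun e he => ?_, fun e he => ?_,
    hmap _ H.splitting.map_right, hmap _ H.splitting.map_left, fun e he t ht => ?_⟩, ?_, ?_⟩
  · exact (inf_comm (α := Submodule ℝ (TangentSpace (𝓡 d) e.proj)) _ _).trans <|
      H.splitting.inf_eq _ (oppositeVector_mem_extendedSet he)
  · refine (sup_comm (α := Submodule ℝ (TangentSpace (𝓡 d) e.proj)) _ _).trans <|
      (H.splitting.sup_eq _ (oppositeVector_mem_extendedSet he)).trans ?_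
    change (ℝ ∙ (-e.2))ᗮ = (ℝ ∙ e.2)ᗮ
    rw [← neg_one_smul ℝ e.2, Submodule.span_singleton_smul_eq (isUnit_one.neg)]
  · have h1 := H.splitting.dominated _ (oppositeVector_mem_extendedSet
      (sphereFlow_mem_extendedSet hX hφ hinv t he)) t ht
    have h2 : ∀ u, u = t → restrNorm (extPoincareFlow φ u (sphereFlow φ (-t)
        (oppositeVector (sphereFlow φ t e)))) (Δu (sphereFlow φ (-t)
          (oppositeVector (sphereFlow φ t e)))) =
        restrNorm (extPoincareFlow φ t e) (Δu (oppositeVector e)) := by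
      rintro _ rfl
      rw [sphereFlow_oppositeVector, sphereFlow_neg_sphereFlow hX hφ _
        (norm_eq_one_of_mem_extendedSet he), extPoincareFlow_oppositeVector]
      rfl
    have h3 : restrNorm (extPoincareFlow φ (-t) (oppositeVector (sphereFlow φ t e)))
        (Δs (oppositeVector (sphereFlow φ t e))) * restrNorm (extPoincareFlow φ (- -t)
          (sphereFlow φ (-t) (oppositeVector (sphereFlow φ t e)))) (Δu (sphereFlow φ (-t)
          (oppositeVector (sphereFlow φ t e)))) < C * Real.exp (-r * t) := h1
    rw [h2 _ (neg_neg t), extPoincareFlow_oppositeVector, mul_comm] at h3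
    exact h3
  · obtain ⟨h, hh, hexp⟩ := H.expanding
    refine ⟨_, hh.timeReversal, fun e he t ht v hv hv0 => ?_⟩
    have h1 := hexp _ (oppositeVector_mem_extendedSet he) t ht v hv hv0
    have h2 : ∀ u, u = t → ‖h (oppositeVector e) (-t) •
        extPoincareFlow φ u (oppositeVector e) v‖ =
        ‖h (oppositeVector e) (-t) • extPoincareFlow φ t e v‖ := by
      rintro _ rfl
      rw [extPoincareFlow_oppositeVector]
      rfl
    exact (h2 _ (neg_neg t)).symm.trans_lt h1
  · obtain ⟨h, hh, hcon⟩ := H.contracting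
    refine ⟨_, hh.timeReversal, fun e he t ht v hv hv0 => ?_⟩
    have h1 : ‖h (oppositeVector e) t • extPoincareFlow φ (-t) (oppositeVector e) v‖ <
      C * Real.exp (-r * t) * ‖v‖ := hcon _ (oppositeVector_mem_extendedSet he) t ht v hv hv0
    rw [extPoincareFlow_oppositeVector] at h1
    beta_reduce
    rw [neg_neg]
    exact h1

end TimeReversal

/-! ### Singular hyperbolic sets are multisingular hyperbolic -/

section SingularToMultisingular

variable {d : ℕ} {M : Type*} [TopologicalSpace M] [ChartedSpace (EuclideanSpace ℝ (Fin d)) M]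
  [IsManifold (𝓡 d) ∞ M] [RiemannianBundle (fun x : M => TangentSpace (𝓡 d) x)]
  [T2Space M] [CompactSpace M] [IsContMDiffRiemannianBundle (𝓡 d) ∞ (EuclideanSpace ℝ (Fin d))
      (fun x : M => TangentSpace (𝓡 d) x)]
  {φ : ℝ → M → M} {X : ∀ x : M, TangentSpace (𝓡 d) x} {Λ : Set M}
  {E F : ∀ x : M, Submodule ℝ (TangentSpace (𝓡 d) x)} {C r : ℝ}

/-- A positively singular hyperbolic set is multisingular hyperbolic with the projected splitting.
The constant also serves for the expansion with the full growth of the vectors of the extended set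
in place of a reparametrizing cocycle. -/
lemma exists_isMultisingularHyperbolicWith_projectedBundle
    (hX : ContMDiff (𝓡 d) (𝓡 d).tangent 1 (fun x => (⟨x, X x⟩ : TangentBundle (𝓡 d) M)))
    (hφ : IsFlowOf φ X) (hΛ : IsCompact Λ) (hinv : IsInvariant φ Λ)
    (h : IsPosSingularHyperbolicWith φ X Λ E F C r) :
    ∃ C', IsMultisingularHyperbolicWith φ X Λ (projectedBundle E) (projectedBundle F) C' r ∧
      (∀ e ∈ extendedSet X Λ, ∀ t > 0, ∀ v ∈ projectedBundle E e, v ≠ 0 →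
        ‖extPoincareFlow φ t e v‖ < C' * Real.exp (-r * t) * ‖v‖) ∧
      ∀ e ∈ extendedSet X Λ, ∀ t > 0, ∀ v ∈ projectedBundle F e, v ≠ 0 →
        ‖tangentFlow φ (-t) e.proj e.2‖ * ‖extPoincareFlow φ (-t) e v‖ <
          C' * Real.exp (-r * t) * ‖v‖ := by
  obtain ⟨K₁, hK₁, hang⟩ := exists_norm_le_mul_norm_add h.splitting.continuous_left
    h.splitting.continuous_right h.splitting.inf_eq h.splitting.sup_eq hΛ
  obtain ⟨hu, K₂, hK₂, hrep, hle⟩ := exists_isReparametrizing_le hX hφ hΛ hinv h.hyperbolic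
  have hC := h.one_lt
  have hC1 : K₁ * C ≤ max (K₁ * C) (K₂ * C) := le_max_left _ _
  have hC2 : K₂ * C ≤ max (K₁ * C) (K₂ * C) := le_max_right _ _
  have hC0 : C ≤ max (K₁ * C) (K₂ * C) := (le_mul_of_one_le_left (by linarith) hK₂).trans hC2
  have hdom := isDominatedSplitting_projectedBundle hX hφ hΛ hinv h hK₁ hang
  have hcon : ∀ e ∈ extendedSet X Λ, ∀ t > 0, ∀ v ∈ projectedBundle E e, v ≠ 0 →
      ‖extPoincareFlow φ t e v‖ < max (K₁ * C) (K₂ * C) * Real.exp (-r * t) * ‖v‖ :=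
    fun e he t ht v hv hv0 => (norm_extPoincareFlow_lt_of_mem_left hX hφ hΛ hinv h hK₁ hang he ht
      hv hv0).trans_le (by gcongr)
  have hexp : ∀ e ∈ extendedSet X Λ, ∀ t > 0, ∀ v ∈ projectedBundle F e, v ≠ 0 →
      ‖tangentFlow φ (-t) e.proj e.2‖ * ‖extPoincareFlow φ (-t) e v‖ <
        C * Real.exp (-r * t) * ‖v‖ := fun e he t ht v hv hv0 =>
    norm_tangentFlow_mul_norm_extPoincareFlow_lt_of_mem_right hX hφ hΛ hinv h he ht hv hv0
  refine ⟨max (K₁ * C) (K₂ * C), ⟨hC.trans_le hC0, h.pos, { hdom with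
    dominated := fun e he t ht => (hdom.dominated e he t ht).trans_le (by gcongr) },
    ⟨_, isReparametrizing_one, fun e he t ht v hv hv0 => ?_⟩,
    ⟨hu, hrep, fun e he t ht v hv hv0 => ?_⟩⟩, hcon,
    fun e he t ht v hv hv0 => (hexp e he t ht v hv hv0).trans_le (by gcongr)⟩
  · rw [one_smul]
    exact hcon e he t ht v hv hv0
  · obtain ⟨h1, h2⟩ := hle e he (-t)
    have h3 : ‖hu e (-t) • extPoincareFlow φ (-t) e v‖ =
        hu e (-t) * ‖extPoincareFlow φ (-t) e v‖ := by
      rw [norm_smul, Real.norm_of_nonneg h1]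
    calc ‖hu e (-t) • extPoincareFlow φ (-t) e v‖
        = hu e (-t) * ‖extPoincareFlow φ (-t) e v‖ := h3
      _ ≤ K₂ * ‖tangentFlow φ (-t) e.proj e.2‖ * ‖extPoincareFlow φ (-t) e v‖ :=
        mul_le_mul_of_nonneg_right h2 (norm_nonneg _)
      _ = K₂ * (‖tangentFlow φ (-t) e.proj e.2‖ * ‖extPoincareFlow φ (-t) e v‖) := mul_assoc _ _ _
      _ < K₂ * (C * Real.exp (-r * t) * ‖v‖) :=
        mul_lt_mul_of_pos_left (hexp e he t ht v hv hv0) (zero_lt_one.trans_le hK₂)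
      _ = K₂ * C * Real.exp (-r * t) * ‖v‖ := by ring
      _ ≤ max (K₁ * C) (K₂ * C) * Real.exp (-r * t) * ‖v‖ := by gcongr

end SingularToMultisingular

theorem mainTheorem4 {d : ℕ} {M : Type*} [TopologicalSpace M] [T2Space M] [CompactSpace M]
    [ChartedSpace (EuclideanSpace ℝ (Fin d)) M] [IsManifold (𝓡 d) ∞ M]
    [RiemannianBundle (fun x : M => TangentSpace (𝓡 d) x)]
    [IsContMDiffRiemannianBundle (𝓡 d) ∞ (EuclideanSpace ℝ (Fin d))
      (fun x : M => TangentSpace (𝓡 d) x)]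
    (X : ∀ x : M, TangentSpace (𝓡 d) x)
    (hX : ContMDiff (𝓡 d) (𝓡 d).tangent 1 (fun x => (⟨x, X x⟩ : TangentBundle (𝓡 d) M)))
    (φ : ℝ → M → M) (hφ : IsFlowOf φ X)
    (Λ : Set M) (hΛ : IsCompact Λ) (hinv : IsInvariant φ Λ) :
    (IsSingularHyperbolic φ X Λ → IsMultisingularHyperbolic φ X Λ) ∧
    ∀ (E F : ∀ x : M, Submodule ℝ (TangentSpace (𝓡 d) x)) (C r : ℝ),
      IsPosSingularHyperbolicWith φ X Λ E F C r →
      ∃ (Ds Du : ∀ x : M, Submodule ℝ (TangentSpace (𝓡 d) x))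
        (Δs Δu : ∀ e : TangentBundle (𝓡 d) M, Submodule ℝ (TangentSpace (𝓡 d) e.proj))
        (C' r' : ℝ),
        1 < C' ∧ 0 < r' ∧
        (∀ x ∈ Λ \ singSet X,
          Ds x = (E x).map (normalProj x (X x)).toLinearMap ∧
          Du x = (F x).map (normalProj x (X x)).toLinearMap) ∧
        IsDominatedSplitting (fun x : M => x) φ (poincareFlow φ X) (Λ \ singSet X)
          (fun x => normalSpace x (X x)) Ds Du C' r' ∧
        IsContractingFor (fun x : M => x) φ (poincareFlow φ X) (fun _ _ => 1)
          (Λ \ singSet X) Ds C' r' ∧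
        IsExpandingFor (fun x : M => x) φ (poincareFlow φ X)
          (fun x t => restrNorm (tangentFlow φ t x) (ℝ ∙ X x)) (Λ \ singSet X) Du C' r' ∧
        (∀ x ∈ Λ \ singSet X, Δs (unitDir X x) = Ds x ∧ Δu (unitDir X x) = Du x) ∧
        IsMultisingularHyperbolicWith φ X Λ Δs Δu C' r' := by
  refine ⟨?_, fun E F C r h => ?_⟩
  · rintro (⟨E, F, C, r, h⟩ | ⟨E, F, C, r, h⟩)
    · obtain ⟨C', hC', -⟩ := exists_isMultisingularHyperbolicWith_projectedBundle hX hφ hΛ hinv h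
      exact ⟨_, _, C', r, hC'⟩
    · have hX' : ContMDiff (𝓡 d) (𝓡 d).tangent 1
          (fun x => (⟨x, -X x⟩ : TangentBundle (𝓡 d) M)) := hX.neg_section
      have hφ' : IsFlowOf (fun t => φ (-t)) (fun x => -X x) := fun x => by
        refine ⟨(congrArg (φ · x) neg_zero).trans (hφ x).1, ?_⟩
        have h1 := (hφ x).2.comp_mul (-1)
        have h2 : (fun t => φ t x) ∘ (· * (-1)) = fun t => φ (-t) x := by
          funext t
          rw [Function.comp_apply, mul_neg_one]
        have h3 : ((-1 : ℝ) • X : ∀ x : M, TangentSpace (𝓡 d) x) = fun x => -X x :=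
          funext fun x => neg_one_smul ℝ (X x)
        rwa [h2, h3] at h1
      obtain ⟨C', hC', -⟩ := exists_isMultisingularHyperbolicWith_projectedBundle hX' hφ' hΛ
        (fun t => hinv (-t)) h
      exact ⟨_, _, C', r, hC'.timeReversal hX hφ hinv⟩
  · obtain ⟨C', hC', hcon, hexp⟩ :=
      exists_isMultisingularHyperbolicWith_projectedBundle hX hφ hΛ hinv h
    refine ⟨fun x => projectedBundle E (unitDir X x), fun x => projectedBundle F (unitDir X x),
      projectedBundle E, projectedBundle F, C', r, hC'.one_lt, hC'.pos,
      fun x hx => ⟨projectedBundle_unitDir hx.2, projectedBundle_unitDir hx.2⟩,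
      hC'.splitting.comp_unitDir hX hφ, fun x hx t ht v hv hv0 => ?_,
      fun x hx t ht v hv hv0 => ?_, fun x _ => ⟨rfl, rfl⟩, hC'⟩
    · rw [one_smul, ← extPoincareFlow_unitDir hX hφ t hx.2]
      exact hcon _ (unitDir_mem_extendedSet hx) t ht v hv hv0
    · rw [norm_smul, Real.norm_of_nonneg (restrNorm_nonneg _ _)]
      refine (mul_le_mul_of_nonneg_right (restrNorm_tangentFlow_span_field_le hx.2)
        (norm_nonneg _)).trans_lt ?_
      rw [← extPoincareFlow_unitDir hX hφ (-t) hx.2]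
      exact hexp _ (unitDir_mem_extendedSet hx) t ht v hv hv0
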